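/- **Setting.** Let $n,\mu\ge 1$ be integers. A spectral density is a nonnegative integrable function $f$ on $[-\pi,\pi)$. A complex-valued stochastic sequence $\xi(m)$, $m\in\mathbb Z$, with $n$th increments $\xi^{(n)}(m,s)=\sum_{l=0}^n(-1)^l\binom nl\xi(m-ls)$, $s\in\mathbb Z$, has stationary increments with spectral density $f$ if the increments have mean $0$, finite second moments, and $$E\,\xi^{(n)}(m_0+m,s_1)\overline{\xi^{(n)}(m_0,s_2)}=\frac1{2\pi}\int_{-\pi}^{\pi}e^{i\lambda m}(1-e^{-is_1\lambda})^n(1-e^{is_2\lambda})^n\lambda^{-2n}f(\lambda)\,d\lambda .$$ Let $\sum_k d_\mu(k)x^k=(\sum_{j\ge0}x^{\mu j})^n$, $D^\mu_{k,j}=d_\mu(j-k)$ for $j\ge k$ and $0$ for $j<k$. For complex coefficients $a(k)$, $k\ge 0$, put $A_{k,j}=a(k+j)$ and $b_\mu=D^\mu a$, where the series $b_\mu(k)=\sum_{m\ge k}d_\mu(m-k)a(m)$ are assumed to converge, with $\sum_k|b_\mu(k)|<\infty$ and $\sum_k(k+1)|b_\mu(k)|^2<\infty$. The symbol $D^\mu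 A$ is the matrix product. Let $$w_\mu(z)=\exp\Big\{\frac1{4\pi}\int_{-\pi}^{\pi}\frac{e^{i\lambda}+z}{e^{i\lambda}-z}\ln\frac{|1-e^{-i\lambda\mu}|^{2n}}{\lambda^{2n}}\,d\lambda\Big\}=\sum_{k\ge0} w_\mu(k)z^k\quad(|z|<1),$$ and $(W^\mu\varphi)(k)=\sum_{j\le k}w_\mu(k-j)\varphi(j)$; write $\varphi_\mu=W^\mu\varphi$. Norms of sequences are $\ell_2$-norms. The functional $A\xi=\sum_{k\ge0}a(k)\xi(k)$ is understood as $A\xi=B\xi-V\xi$, where $B\xi=\sum_{k\ge 0} b_\mu(k)\xi^{(n)}(k,\mu)$ in $L_2$ and $V\xi=\sum_{k=-\mu n}^{-1}v_\mu(k)\xi(k)$, $v_\mu(k)=\sum_{-k/\mu\le l\le n}(-1)^l\binom nl b_\mu(l\mu+k)$. It is estimated from $\xi(m)$, $m\le-1$, by $\hat A\xi=\eta-V\xi$ with $\eta$ in the closed linear span of $\xi^{(n)}(m,\mu)$, $m\le-1$. Let $A(e^{i\lambda})=\sum_k b_\mu(k)e^{i\lambda k}$ and $u(\lambda)=(1-e^{-i\lambda\mu})^n/(i\lambda)^n$.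 For a spectral density $f$, let $L_2^{0-}(f)$ be the closed span of $\{e^{i\lambda k}u(\lambda):k\le-1\}$ in $L_2(f)$. A function $h$ is a spectral characteristic for $f$ if $hu\in L_2^{0-}(f)$, and then $$\Delta(h;f)=\frac1{2\pi}\int_{-\pi}^{\pi}|A(e^{i\lambda})-h(\lambda)|^2|u(\lambda)|^2f(\lambda)\,d\lambda$$ is the mean square error of the corresponding estimate. Let $\Delta(f)$ be the minimum of $\Delta(h;f)$ over these $h$. For a class $D$ of spectral densities, $f^0\in D$ is *least favorable* if $\Delta(f)\le\Delta(f^0)$ for all $f\in D$. Let $H_D$ be the set of those $h$ that are spectral characteristics for every $f\in D$. Then $h^0\in H_D$ is *minimax-robust* if $\max_{f\in D}\Delta(h^0;f)$ exists and equals $\min_{h\in H_D}\sup_{f\in D}\Delta(h;f)$. A sequence $\varphi=\{\varphi(k):k\ge0\}$ *gives a canonical factorization* of $f(\lambda)=|\sum_k\varphi(k)e^{-i\lambda k}|^2$ if $\sum_k\varphi(k)z^k$ has radius of convergence greater than $1$ and no zeros in $|z|\le1$. Let $v$ be a bounded spectral density, $\varepsilon\ge0$, and $$D_\varepsilon=\Big\{f:\frac1{2\pi}\int_{-\pi}^{\pi}|f-v|\,d\lambda\le\varepsilon\Big\},\qquad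 P_1=\varepsilon+\frac1{2\pi}\int_{-\pi}^{\pi}v\,d\lambda .$$ Let $S$ be the set of $\varphi$ that give a canonical factorization, satisfy $\|\varphi\|^2=P_1$ and $v(\lambda)\le|\sum_k\varphi(k)e^{-i\lambda k}|^2$ a.e., and solve $D^\mu AW^\mu\varphi=\alpha\overline\varphi$ for some $\alpha\in\mathbb C$. Let $S^+$ be the set of $\varphi$ that give a canonical factorization, satisfy $\|\varphi\|^2=P_1$, and for which, for some constant $c$, a.e. $$\Big|\sum_k\varphi(k)e^{-i\lambda k}\Big|^2=\max\Big\{v(\lambda),\Big|c\sum_k(D^\mu A\varphi_\mu)_ke^{i\lambda k}\Big|^2\Big\},\qquad\varphi_\mu=W^\mu\varphi .\tag{1}$$ Let $\nu_\varepsilon P_1$ and $\nu_\varepsilon^+P_1$ be the maxima of $\|D^\mu AW^\mu\varphi\|^2$ over $S$ and over $S^+$. **Theorem 8.1.** (i) Suppose that both maxima exist and that $\nu_\varepsilon P_1=\nu_\varepsilon^+P_1=\|D^\mu AW^\mu\varphi^0\|^2$ for some $\varphi^0\in S$. Then the density $f^0(\lambda)=|\sum_k\varphi^0(k)e^{-i\lambda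 k}|^2$ is least favorable in $D_\varepsilon$ for the optimal estimation of $A\xi$. (ii) Suppose that $\nu_\varepsilon^+P_1$ exists and $\nu_\varepsilon<\nu_\varepsilon^+$, in the sense that $\|D^\mu AW^\mu\varphi\|^2<\nu^+_\varepsilon P_1$ for all $\varphi\in S$ (in particular, if $S$ is empty). Then for every $\varphi\in S^+$ the density $f^0$ given by (1) is least favorable in $D_\varepsilon$. The sequences $\varphi\in S^+$ are exactly the sequences that give a canonical factorization, satisfy $\|\varphi\|^2=P_1$ (that is, $\int f^0\,d\lambda=2\pi\varepsilon+\int v\,d\lambda$), and solve the extremal problem $$\|D^\mu AW^\mu\psi\|^2\to\max,\qquad \psi\in\ell_2,\quad \Big|\sum_k\psi(k)e^{-i\lambda k}\Big|^2\in D_\varepsilon .\tag{2}$$ In both cases, with $\varphi=\varphi^0$ in case (i): - for all sequences with spectral densities in $D_\varepsilon$, the least value of $E|A\xi-\hat A\xi|^2$ is at most its value for any sequence with density $f^0$; - for every sequence with density $f^0$, the increments admit a canonical one-sided moving average representation $\xi^{(n)}(m,\mu)=\sum_{k\ge0}\varphi_\mu(k)\varepsilon_{m-k}$, $\varphi_\mu=W^\mu\varphi$,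 where $\varepsilon_m$ are orthonormal with mean $0$ and for every $t$ the closed span of $\varepsilon_m$, $m\le t$, is that of all $\xi^{(n)}(m,s)$, $m\le t$, $s>0$; - the minimax-robust spectral characteristic for $D_\varepsilon$ is, uniquely up to equality a.e., $$h^0(\lambda)=A(e^{i\lambda})-\Big(\sum_{j\ge0}(D^\mu A\varphi_\mu)_je^{i\lambda j}\Big)\Big(\sum_{k\ge0}\varphi_\mu(k)e^{-i\lambda k}\Big)^{-1}.$$ **Theorem 8.2.** Let $N\ge0$ and let $a(0),\dots,a(N)$ be arbitrary complex numbers, $a(k)=0$ for $k>N$, so that $A\xi$ is $A_N\xi=\sum_{k=0}^Na(k)\xi(k)$. All of the above remains true if only sequences $\varphi$ and $\psi$ with $\varphi(k)=\psi(k)=0$ for $k>N$ are admitted in $S$, in $S^+$ and in (2), and if in the definition of $S$ the equation is replaced by the alternative "$(D^\mu AW^\mu\varphi)_k=\alpha\overline{\varphi(k)}$ for $0\le k\le N$ and some $\alpha\in\mathbb C$, or $(D^\mu AW^\mu\varphi)_{N-k}=\beta\overline{\varphi(k)}$ for $0\le k\le N$ and some $\beta\in\mathbb C$". -/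

import Mathlib

open MeasureTheory Filter Topology
open scoped ENNReal ComplexConjugate

universe u

/-! ## Spectral densities on `[-π, π)` -/

/-- Lebesgue measure on one period (the end point is immaterial). -/
noncomputable def circ : Measure ℝ := volume.restrict (Set.Ioc (-Real.pi) Real.pi)

/-- A spectral density: a (class of a) nonnegative integrable function on one period. -/
def IsSpectralDensity (f : ℝ → ℝ) : Prop :=
  Integrable f circ ∧ ∀ᵐ t ∂circ, 0 ≤ f t

/-- The spectral measure `dF = (2π)⁻¹ f(λ) dλ` of a density `f`. -/
noncomputable def specMeasure (f : ℝ → ℝ) : Measure ℝ :=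
  circ.withDensity fun t => ENNReal.ofReal (f t / (2 * Real.pi))

/-- The `L¹`-neighbourhood `D_ε` of `v`. -/
def classD (v : ℝ → ℝ) (ε : ℝ) : Set (ℝ → ℝ) :=
  {f | IsSpectralDensity f ∧ 1 / (2 * Real.pi) * ∫ t, |f t - v t| ∂circ ≤ ε}

/-- `P₁ = ε + (2π)⁻¹ ∫ v`. -/
noncomputable def powerP (v : ℝ → ℝ) (ε : ℝ) : ℝ :=
  ε + 1 / (2 * Real.pi) * ∫ t, v t ∂circ

/-! ## Sequences and operators -/

/-- The squared norm in `ℓ₂` (`∞` off `ℓ₂`). -/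
noncomputable def sqNorm (x : ℕ → ℂ) : ℝ≥0∞ := ∑' k, ‖x k‖ₑ ^ 2

/-- `∑ₖ x(k) e^{ikλ}`. -/
noncomputable def plusSeries (x : ℕ → ℂ) (t : ℝ) : ℂ :=
  ∑' k : ℕ, x k * Complex.exp (Complex.I * k * t)

/-- `∑ₖ x(k) e^{-ikλ}`. -/
noncomputable def minusSeries (x : ℕ → ℂ) (t : ℝ) : ℂ :=
  ∑' k : ℕ, x k * Complex.exp (-(Complex.I * k * t))

/-- `d_μ(k)`, defined by `∑ₖ d_μ(k) xᵏ = (∑ⱼ x^{μ j})ⁿ`. -/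
noncomputable def dCoeff (n μ k : ℕ) : ℂ :=
  PowerSeries.coeff k ((PowerSeries.mk fun j => if μ ∣ j then (1 : ℂ) else 0) ^ n)

/-- The upper triangular matrix `D^μ`. -/
noncomputable def matD (n μ k j : ℕ) : ℂ := if k ≤ j then dCoeff n μ (j - k) else 0

/-- `b_μ = D^μ a`; the series is the limit of its partial sums. -/
noncomputable def bCoeff (n μ : ℕ) (a : ℕ → ℂ) (k : ℕ) : ℂ :=
  ∑'[SummationFilter.conditional ℕ] m, matD n μ k m * a m

/-- The entries of the matrix product `D^μ A`, where `A_{l,j} = a(l + j)`. -/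
noncomputable def matDA (n μ : ℕ) (a : ℕ → ℂ) (k j : ℕ) : ℂ :=
  ∑'[SummationFilter.conditional ℕ] l, matD n μ k l * a (l + j)

/-- The operator `D^μ A`. -/
noncomputable def opDA (n μ : ℕ) (a x : ℕ → ℂ) (k : ℕ) : ℂ := ∑' j, matDA n μ a k j * x j

/-- `|1 - e^{-iλμ}|^{2n} / λ^{2n}`. -/
noncomputable def weight (n μ : ℕ) (t : ℝ) : ℝ :=
  ‖1 - Complex.exp (-(Complex.I * μ * t))‖ ^ (2 * n) / t ^ (2 * n)

/-- The function `w_μ(z)` of the unit disc whose squared modulus has boundary values `weight`. -/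
noncomputable def wFun (n μ : ℕ) (z : ℂ) : ℂ :=
  Complex.exp (1 / (4 * (Real.pi : ℂ)) *
    ∫ t, (Complex.exp (Complex.I * t) + z) / (Complex.exp (Complex.I * t) - z) *
      ((Real.log (weight n μ t) : ℝ) : ℂ) ∂circ)

/-- The Taylor coefficients `w_μ(k)` of `w_μ(z)` at `0`. -/
noncomputable def wCoeff (n μ k : ℕ) : ℂ := iteratedDeriv k (wFun n μ) 0 / (k.factorial : ℂ)

/-- The operator `W^μ`: `φ_μ(k) = ∑_{j ≤ k} w_μ(k - j) φ(j)`. -/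
noncomputable def opW (n μ : ℕ) (x : ℕ → ℂ) (k : ℕ) : ℂ :=
  ∑ j ∈ Finset.range (k + 1), wCoeff n μ (k - j) * x j

/-- The operator `D^μ A W^μ`. -/
noncomputable def opDAW (n μ : ℕ) (a x : ℕ → ℂ) : ℕ → ℂ := opDA n μ a (opW n μ x)

/-- `φ` gives a canonical factorization `f(λ) = |Φ(e^{-iλ})|²`: the series
`Φ(z) = ∑ₖ φ(k) zᵏ` has convergence radius greater than `1` and no zeros in `|z| ≤ 1`. -/
def IsCanonical (φ : ℕ → ℂ) : Prop :=
  (∃ R : ℝ, 1 < R ∧ Summable fun k => ‖φ k‖ * R ^ k) ∧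
    ∀ z : ℂ, ‖z‖ ≤ 1 → ∑' k, φ k * z ^ k ≠ 0

/-- The density `|∑ₖ φ(k) e^{-ikλ}|²`. -/
noncomputable def densityOf (φ : ℕ → ℂ) (t : ℝ) : ℝ := ‖minusSeries φ t‖ ^ 2

/-- `g` is the sum in `L₂(-π, π)` of the series `∑ₖ ψ(k) e^{-ikλ}`. -/
def IsL2Series (ψ : ℕ → ℂ) (g : ℝ → ℂ) : Prop :=
  MemLp g 2 circ ∧
    Tendsto (fun K : ℕ => eLpNorm
      (fun t : ℝ => ∑ k ∈ Finset.range K, ψ k * Complex.exp (-(Complex.I * k * t)) - g t) 2 circ)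
      atTop (𝓝 0)

/-! ## Estimation in the spectral domain -/

/-- `(1 - e^{-iλμ})ⁿ / (iλ)ⁿ`. -/
noncomputable def incrFactor (n μ : ℕ) (t : ℝ) : ℂ :=
  (1 - Complex.exp (-(Complex.I * μ * t))) ^ n / (Complex.I * t) ^ n

/-- The linear span of the functions `e^{iλk} (1 - e^{-iλμ})ⁿ / (iλ)ⁿ`, `k ≤ -1`. -/
noncomputable def pastSpan (n μ : ℕ) : Submodule ℂ (ℝ → ℂ) :=
  Submodule.span ℂ {g | ∃ k : ℤ, k ≤ -1 ∧
    g = fun t : ℝ => Complex.exp (Complex.I * k * t) * incrFactor n μ t}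

/-- `g` belongs to `L₂^{0-}(f)`, the closed span of the above functions in `L₂(f)`. -/
def MemPast (n μ : ℕ) (f : ℝ → ℝ) (g : ℝ → ℂ) : Prop :=
  MemLp g 2 (specMeasure f) ∧
    ∀ δ : ℝ≥0∞, 0 < δ → ∃ p ∈ pastSpan n μ, eLpNorm (fun t => g t - p t) 2 (specMeasure f) < δ

/-- `h` is the spectral characteristic of a linear estimate when the density is `f`. -/
def IsAdmissible (n μ : ℕ) (f : ℝ → ℝ) (h : ℝ → ℂ) : Prop :=
  MemPast n μ f fun t => h t * incrFactor n μ t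

/-- The mean square error `Δ(h; f)` of the estimate of `Aξ` with spectral characteristic `h`
when the spectral density is `f`. -/
noncomputable def specError (n μ : ℕ) (a : ℕ → ℂ) (h : ℝ → ℂ) (f : ℝ → ℝ) : ℝ≥0∞ :=
  ∫⁻ t, ‖(plusSeries (bCoeff n μ a) t - h t) * incrFactor n μ t‖ₑ ^ 2 ∂specMeasure f

/-- The mean square error `Δ(f) = Δ(h(f); f)` of the optimal linear estimate. -/
noncomputable def minError (n μ : ℕ) (a : ℕ → ℂ) (f : ℝ → ℝ) : ℝ≥0∞ :=
  ⨅ (h : ℝ → ℂ) (_ : IsAdmissible n μ f h), specError n μ a h f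

/-- `f₀` is least favorable in `D`: `Δ(f₀) = max_{f ∈ D} Δ(f)`. -/
def IsLeastFavorable (n μ : ℕ) (a : ℕ → ℂ) (D : Set (ℝ → ℝ)) (f₀ : ℝ → ℝ) : Prop :=
  f₀ ∈ D ∧ ∀ f ∈ D, minError n μ a f ≤ minError n μ a f₀

/-- The class `H_D` of characteristics admissible for every density in `D`. -/
def classH (n μ : ℕ) (D : Set (ℝ → ℝ)) : Set (ℝ → ℂ) :=
  {h | ∀ f ∈ D, IsAdmissible n μ f h}

/-- `h₀` is a minimax-robust spectral characteristic for `D`: the maximum over `f ∈ D` of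
`Δ(h₀; f)` exists, and it is the minimum over `h ∈ H_D` of `sup_{f ∈ D} Δ(h; f)`. -/
def IsMinimaxRobust (n μ : ℕ) (a : ℕ → ℂ) (D : Set (ℝ → ℝ)) (h₀ : ℝ → ℂ) : Prop :=
  h₀ ∈ classH n μ D ∧
    (∃ f ∈ D, ∀ g ∈ D, specError n μ a h₀ g ≤ specError n μ a h₀ f) ∧
    ∀ h ∈ classH n μ D, (⨆ f ∈ D, specError n μ a h₀ f) ≤ ⨆ f ∈ D, specError n μ a h f

/-- The spectral characteristic `A(e^{iλ}) - r(e^{iλ}) / Φ_μ(e^{-iλ})`, where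
`A(e^{iλ}) = ∑ₖ (D^μ a)ₖ e^{ikλ}`, `r(e^{iλ}) = ∑ⱼ (D^μ A φ_μ)ⱼ e^{ijλ}`, `φ_μ = W^μ φ`. -/
noncomputable def optChar (n μ : ℕ) (a φ : ℕ → ℂ) (t : ℝ) : ℂ :=
  plusSeries (bCoeff n μ a) t -
    plusSeries (opDA n μ a (opW n μ φ)) t * (minusSeries (opW n μ φ) t)⁻¹

/-! ## Sequences with stationary increments -/

section Sequences

variable {Ω : Type*} [MeasurableSpace Ω]

/-- The increment `ξ^{(n)}(m, s) = ∑ₗ (-1)ˡ C(n,l) ξ(m - l s)`. -/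
noncomputable def increment (n : ℕ) (s : ℤ) (ξ : ℤ → Ω → ℂ) (m : ℤ) (ω : Ω) : ℂ :=
  ∑ l ∈ Finset.range (n + 1), (-1) ^ l * (n.choose l : ℂ) * ξ (m - l * s) ω

/-- `ξ` has wide sense stationary `n`th increments of mean zero with spectral density `f`. -/
structure HasIncrementDensity (n : ℕ) (P : Measure Ω) (ξ : ℤ → Ω → ℂ) (f : ℝ → ℝ) : Prop where
  memLp : ∀ s m : ℤ, MemLp (increment n s ξ m) 2 P
  mean : ∀ s m : ℤ, ∫ ω, increment n s ξ m ω ∂P = 0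
  structural : ∀ m₀ m s₁ s₂ : ℤ,
    ∫ ω, increment n s₁ ξ (m₀ + m) ω * conj (increment n s₂ ξ m₀ ω) ∂P =
      1 / (2 * (Real.pi : ℂ)) * ∫ t, Complex.exp (Complex.I * m * t) *
        (1 - Complex.exp (-(Complex.I * s₁ * t))) ^ n *
        (1 - Complex.exp (Complex.I * s₂ * t)) ^ n * (1 / (t : ℂ) ^ (2 * n)) * (f t : ℂ) ∂circ

variable {n : ℕ} {P : Measure Ω} {ξ : ℤ → Ω → ℂ} {f : ℝ → ℝ}

/-- The increment as an element of `L₂(P)`. -/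
noncomputable def incrLp (hξ : HasIncrementDensity n P ξ f) (s m : ℤ) : Lp ℂ 2 P :=
  (hξ.memLp s m).toLp

/-- `H^t(ξ^{(n)})`: the closed span of the increments at times `≤ t` with positive steps. -/
noncomputable def pastSpace (hξ : HasIncrementDensity n P ξ f) (t : ℤ) :
    Submodule ℂ (Lp ℂ 2 P) :=
  (Submodule.span ℂ {x | ∃ m s : ℤ, m ≤ t ∧ 0 < s ∧ x = incrLp hξ s m}).topologicalClosure

/-- The canonical one-sided moving average representation
`ξ^{(n)}(m, μ) = ∑_{k ≥ 0} c(k) ε(m - k)`, with an innovation sequence `ε`. -/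
def HasMovingAverage (μ : ℕ) (hξ : HasIncrementDensity n P ξ f) (c : ℕ → ℂ) : Prop :=
  (Summable fun k => ‖c k‖ ^ 2) ∧
    ∃ e : ℤ → Lp ℂ 2 P, Orthonormal ℂ e ∧ (∀ m, ∫ ω, e m ω ∂P = 0) ∧
      (∀ t : ℤ, pastSpace hξ t =
        (Submodule.span ℂ {x | ∃ m : ℤ, m ≤ t ∧ x = e m}).topologicalClosure) ∧
      ∀ m : ℤ, HasSum (fun k : ℕ => c k • e (m - k)) (incrLp hξ μ m)

/-- `Bξ = ∑ₖ b_μ(k) ξ^{(n)}(k, μ)`, a series in `L₂(P)`. -/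
noncomputable def functionalB (μ : ℕ) (a : ℕ → ℂ) (hξ : HasIncrementDensity n P ξ f) :
    Lp ℂ 2 P :=
  ∑' k : ℕ, bCoeff n μ a k • incrLp hξ μ k

/-- `Vξ = ∑_{i=1}^{μn} v_μ(-i) ξ(-i)`, a combination of observed values, where
`v_μ(-i) = ∑_{i/μ ≤ l ≤ n} (-1)ˡ C(n,l) b_μ(lμ - i)`. -/
noncomputable def functionalV (n μ : ℕ) (a : ℕ → ℂ) (ξ : ℤ → Ω → ℂ) (ω : Ω) : ℂ :=
  ∑ i ∈ Finset.Icc 1 (μ * n),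
    (∑ l ∈ (Finset.range (n + 1)).filter fun l => i ≤ l * μ,
      (-1) ^ l * (n.choose l : ℂ) * bCoeff n μ a (l * μ - i)) * ξ (-(i : ℤ)) ω

/-- `Aξ = ∑_{k ≥ 0} a(k) ξ(k)`, understood through its representation `Aξ = Bξ - Vξ`. -/
noncomputable def functionalA (μ : ℕ) (a : ℕ → ℂ) (hξ : HasIncrementDensity n P ξ f)
    (ω : Ω) : ℂ :=
  functionalB μ a hξ ω - functionalV n μ a ξ ω

/-- The least value of `E|Aξ - Âξ|²` over the linear estimates `Âξ = η - Vξ`, where `η` is in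
the closed span of the increments `ξ^{(n)}(m, μ)`, `m ≤ -1`. -/
noncomputable def sequenceError (μ : ℕ) (a : ℕ → ℂ) (hξ : HasIncrementDensity n P ξ f) : ℝ≥0∞ :=
  ⨅ η ∈ (Submodule.span ℂ {x | ∃ m : ℤ, m ≤ -1 ∧ x = incrLp hξ μ m}).topologicalClosure,
    ∫⁻ ω, ‖functionalA μ a hξ ω - ((η : Ω → ℂ) ω - functionalV n μ a ξ ω)‖ₑ ^ 2 ∂P

end Sequences

/-- For stochastic sequences, a density `f₀ ∈ D` gives the largest error `E|Aξ - Âξ|²`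
among all sequences whose density belongs to `D`. -/
def IsLeastFavorableForSequences (n μ : ℕ) (a : ℕ → ℂ) (D : Set (ℝ → ℝ)) (f₀ : ℝ → ℝ) :
    Prop :=
  ∀ (Ω₀ : Type u) [MeasurableSpace Ω₀] (P₀ : Measure Ω₀) [IsProbabilityMeasure P₀]
    (ξ₀ : ℤ → Ω₀ → ℂ) (h₀ : HasIncrementDensity n P₀ ξ₀ f₀),
  ∀ f ∈ D, ∀ (Ω : Type u) [MeasurableSpace Ω] (P : Measure Ω) [IsProbabilityMeasure P]
    (ξ : ℤ → Ω → ℂ) (h : HasIncrementDensity n P ξ f),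
    sequenceError μ a h ≤ sequenceError μ a h₀

/-- Every sequence with stationary `n`th increments and spectral density `densityOf φ` has
increments with a canonical one-sided moving average representation, with coefficients `W^μ φ`. -/
def IsMovingAverageDensity (n μ : ℕ) (φ : ℕ → ℂ) : Prop :=
  ∀ (Ω : Type u) [MeasurableSpace Ω] (P : Measure Ω) [IsProbabilityMeasure P]
    (ξ : ℤ → Ω → ℂ) (h : HasIncrementDensity n P ξ (densityOf φ)),
    HasMovingAverage μ h (opW n μ φ)

/-! ## The extremal problems for `D_ε` -/

/-- Sequences `{φ(k) : 0 ≤ k ≤ N}`, extended by zero. -/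
def seqUpTo (N : ℕ) : Set (ℕ → ℂ) := {φ | ∀ k, N < k → φ k = 0}

/-- The coefficients of `A_N ξ = ∑_{k=0}^N a(k) ξ(k)`. -/
def truncCoeff (N : ℕ) (a : ℕ → ℂ) (k : ℕ) : ℂ := if k ≤ N then a k else 0

/-- `φ` is a solution of `‖D^μ A W^μ ψ‖² → max` over the `ψ ∈ K` for which
`|∑ₖ ψ(k) e^{-ikλ}|²` is in `D`. -/
def SolvesExtremal (n μ : ℕ) (a : ℕ → ℂ) (D : Set (ℝ → ℝ)) (K : Set (ℕ → ℂ)) (φ : ℕ → ℂ) :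
    Prop :=
  φ ∈ K ∧ densityOf φ ∈ D ∧
    ∀ ψ ∈ K, ∀ g : ℝ → ℂ, IsL2Series ψ g → (fun t => ‖g t‖ ^ 2) ∈ D →
      sqNorm (opDAW n μ a ψ) ≤ sqNorm (opDAW n μ a φ)

/-- The sequences that give a canonical factorization and have `‖φ‖² = P₁`. -/
def candidates (v : ℝ → ℝ) (ε : ℝ) : Set (ℕ → ℂ) :=
  {φ | IsCanonical φ ∧ sqNorm φ = ENNReal.ofReal (powerP v ε)}

/-- The candidates with `v ≤ |Φ|²` that solve `D^μ A W^μ φ = α φ̄` for some `α`. -/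
def eigenSet (n μ : ℕ) (a : ℕ → ℂ) (v : ℝ → ℝ) (ε : ℝ) : Set (ℕ → ℂ) :=
  {φ ∈ candidates v ε | (∀ᵐ t ∂circ, v t ≤ densityOf φ t) ∧
    ∃ α : ℂ, ∀ k, opDAW n μ a φ k = α * conj (φ k)}

/-- The candidates of order `N` with `v ≤ |Φ|²` that solve `D_N A_N W_N φ = α φ̄` for some `α`
or the equation `D̂_N A_N W_N φ = β φ̄`, in which the entries of the left side are reversed. -/
def eigenSetN (n μ N : ℕ) (a : ℕ → ℂ) (v : ℝ → ℝ) (ε : ℝ) : Set (ℕ → ℂ) :=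
  {φ ∈ candidates v ε | φ ∈ seqUpTo N ∧ (∀ᵐ t ∂circ, v t ≤ densityOf φ t) ∧
    ((∃ α : ℂ, ∀ k ≤ N, opDAW n μ (truncCoeff N a) φ k = α * conj (φ k)) ∨
      ∃ β : ℂ, ∀ k ≤ N, opDAW n μ (truncCoeff N a) φ (N - k) = β * conj (φ k))}

/-- The candidates that factorize a density of the form
`max {v(λ), |c ∑ₖ (D^μ A φ_μ)ₖ e^{ikλ}|²}`, with `φ_μ = W^μ φ`. -/
def maxSet (n μ : ℕ) (a : ℕ → ℂ) (v : ℝ → ℝ) (ε : ℝ) : Set (ℕ → ℂ) :=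
  {φ ∈ candidates v ε | ∃ c : ℂ, ∀ᵐ t ∂circ,
    densityOf φ t = max (v t) (‖c * plusSeries (opDA n μ a (opW n μ φ)) t‖ ^ 2)}

/-- The values `‖D^μ A W^μ φ‖²`, `φ ∈ S`. -/
noncomputable def valuesOn (n μ : ℕ) (a : ℕ → ℂ) (S : Set (ℕ → ℂ)) : Set ℝ≥0∞ :=
  (fun φ => sqNorm (opDAW n μ a φ)) '' S

/-- `|Φ|²` is least favorable in `D` for the estimation of `Aξ`, its sequences have one-sided
moving average increments, and the minimax-robust spectral characteristic is `optChar`,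
uniquely up to equality almost everywhere. -/
structure GivesMinimaxSolution (n μ : ℕ) (a : ℕ → ℂ) (D : Set (ℝ → ℝ)) (φ : ℕ → ℂ) :
    Prop where
  leastFavorable : IsLeastFavorable n μ a D (densityOf φ)
  leastFavorableForSequences : IsLeastFavorableForSequences.{u} n μ a D (densityOf φ)
  movingAverage : IsMovingAverageDensity.{u} n μ φ
  minimaxRobust : ∀ h : ℝ → ℂ, IsMinimaxRobust n μ a D h ↔ h =ᵐ[circ] optChar n μ a φ

/-! Write r for the series with coefficients D^μ A φ_μ in e^{iλ}, Φ for the series of φ in e^{-iλ},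
Φ_μ for that of φ_μ, and ρ = |r|²/|Φ|². The proof exhibits a saddle point of the error Δ(h; f).

The matrix D^μ A is the Hankel matrix of b_μ (`matDA_eq`), so r is the part of A Φ_μ with
nonnegative frequencies (`plusSeries_mul_minusSeries`). On the circle Φ_μ = w_μ Φ, where w_μ is a
power series in e^{-iλ} and |w_μ| = |u| a.e. (`ae_norm_incrFactor`). Hence h⁰ = A - r/Φ_μ is optimal
for |Φ|²: h⁰u lies in the past of every density (`isAdmissible_optChar`), and (A - h⁰)u is
orthogonal to the past for |Φ|² (`integral_conj_mul_sub_optChar`). By Pythagoras the optimum is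
unique a.e. (`ae_eq_optChar_of_specError_le`). Moreover Δ(h⁰; f) = (2π)⁻¹ ∫ ρ f is linear in f
(`specError_optChar`), with value ‖D^μ A W^μ φ‖² at f = |Φ|².

The equation of `maxSet` says |Φ|² = max {v, |c|² ρ |Φ|²}. For c ≠ 0 this means ρ ≤ |c|⁻², with
equality wherever |Φ|² > v. So for f in D_ε one has ∫ ρ (f - v) ≤ |c|⁻² 2πε = ∫ ρ (|Φ|² - v), which
is the saddle inequality (`isSaddle_of_mem_maxSet`). If c = 0, then ε = 0 and the class is the
single density v. Least favorability, the minimax characteristic and its uniqueness follow formally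
from a saddle point. In case (i), φ⁰ has the same value as a member of S⁺; equal values force equal
optimal characteristics, and the saddle property passes to φ⁰ (`IsSaddle.of_le`).

For the extremal problem, D^μ A W^μ ψ consists of the Fourier coefficients of (r/Φ)g with
nonnegative index, where g is the L₂ sum of the series of ψ. Bessel's inequality bounds its squared
norm by Δ(h⁰; |g|²), hence by the value at φ (`sqNorm_opDAW_le_specError`). Conversely, a candidate
attaining the maximum has the same ρ, and equality in the saddle inequality returns the max form
(`mem_maxSet_of_le`).

Statements on sequences are carried to the spectral domain by an isometry, which exists because the
increments and their spectral images have the same Gram matrix (`exists_spectral_map`). The analytic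
input is that w_μ = (1 + z + ⋯ + z^{μ-1})ⁿ exp(n L) with an absolutely summable series L
(`wFun_eq`). The zeros of the polynomial on the circle are harmless, because the pasts generated by
steps μ contain those of step 1 (`lpMem_incrFactor_one`). -/

/-! ## Absolutely convergent power series on the closed unit disc -/

/-- `g` is on the closed unit disc the sum of a power series whose coefficients have `ℓ¹`-norm at
most `M`. -/
def WienerBound (g : ℂ → ℂ) (M : ℝ) : Prop :=
  ∃ c : ℕ → ℂ, (Summable fun k => ‖c k‖) ∧ ∑' k, ‖c k‖ ≤ M ∧
    ∀ z : ℂ, ‖z‖ ≤ 1 → HasSum (fun k => c k * z ^ k) (g z)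

/-- `g` is on the closed unit disc the sum of a power series with absolutely summable
coefficients. -/
def IsWiener (g : ℂ → ℂ) : Prop :=
  ∃ c : ℕ → ℂ, (Summable fun k => ‖c k‖) ∧
    ∀ z : ℂ, ‖z‖ ≤ 1 → HasSum (fun k => c k * z ^ k) (g z)

lemma summable_mul_pow_norm {c : ℕ → ℂ} (hc : Summable fun k => ‖c k‖) {z : ℂ} (hz : ‖z‖ ≤ 1) :
    Summable fun k => ‖c k * z ^ k‖ := by
  refine Summable.of_nonneg_of_le (fun _ => norm_nonneg _) (fun k => ?_) hc
  rw [norm_mul, norm_pow]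
  exact mul_le_of_le_one_right (norm_nonneg _) (pow_le_one₀ (norm_nonneg _) hz)

lemma summable_mul_pow {c : ℕ → ℂ} (hc : Summable fun k => ‖c k‖) {z : ℂ} (hz : ‖z‖ ≤ 1) :
    Summable fun k => c k * z ^ k :=
  (summable_mul_pow_norm hc hz).of_norm

lemma isWiener_tsum {c : ℕ → ℂ} (hc : Summable fun k => ‖c k‖) :
    IsWiener fun z => ∑' k, c k * z ^ k :=
  ⟨c, hc, fun _ hz => (summable_mul_pow hc hz).hasSum⟩

lemma WienerBound.isWiener {g : ℂ → ℂ} {M : ℝ} (h : WienerBound g M) : IsWiener g := by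
  obtain ⟨c, hc, -, h⟩ := h
  exact ⟨c, hc, h⟩

lemma IsWiener.exists_bound {g : ℂ → ℂ} (h : IsWiener g) : ∃ M, WienerBound g M := by
  obtain ⟨c, hc, h⟩ := h
  exact ⟨_, c, hc, le_rfl, h⟩

lemma IsWiener.congr {g g' : ℂ → ℂ} (h : IsWiener g) (hg : ∀ z, ‖z‖ ≤ 1 → g' z = g z) :
    IsWiener g' := by
  obtain ⟨c, hc, h⟩ := h
  exact ⟨c, hc, fun z hz => hg z hz ▸ h z hz⟩

lemma wienerBound_const (a : ℂ) : WienerBound (fun _ => a) ‖a‖ := by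
  have h : ∀ k : ℕ, k ≠ 0 → (if k = 0 then a else 0) = 0 := fun k hk => if_neg hk
  refine ⟨fun k => if k = 0 then a else 0, ?_, ?_, fun z _ => ?_⟩
  · exact summable_of_ne_finset_zero (s := {0}) fun k hk => by simp at hk; simp [hk]
  · rw [tsum_eq_single 0 (fun k hk => by simp [hk])]; simp
  · convert hasSum_single 0 (fun k hk => ?_) using 1
    · simp
    · simp [hk]

lemma isWiener_const (a : ℂ) : IsWiener fun _ => a := (wienerBound_const a).isWiener

lemma isWiener_id : IsWiener fun z => z := by
  refine ⟨fun k => if k = 1 then 1 else 0, ?_, fun z _ => ?_⟩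
  · exact summable_of_ne_finset_zero (s := {1}) fun k hk => by simp at hk; simp [hk]
  · convert hasSum_single 1 (fun k hk => ?_) using 1
    · simp
    · simp [hk]

lemma tsum_norm_cauchyProduct_le {c d : ℕ → ℂ} (hc : Summable fun k => ‖c k‖)
    (hd : Summable fun k => ‖d k‖) :
    ∑' k, ‖∑ kl ∈ Finset.HasAntidiagonal.antidiagonal k, c kl.1 * d kl.2‖ ≤
      (∑' k, ‖c k‖) * ∑' k, ‖d k‖ := by
  have hp : Summable fun p : ℕ × ℕ => ‖c p.1‖ * ‖d p.2‖ :=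
    Summable.mul_of_nonneg hc hd (fun _ => norm_nonneg _) fun _ => norm_nonneg _
  have hS : Summable fun k => ∑ kl ∈ Finset.HasAntidiagonal.antidiagonal k, ‖c kl.1‖ * ‖d kl.2‖ :=
    summable_sum_mul_antidiagonal_of_summable_mul (f := fun k => ‖c k‖) (g := fun k => ‖d k‖) hp
  have hT := Summable.tsum_mul_tsum_eq_tsum_sum_antidiagonal (f := fun k => ‖c k‖)
    (g := fun k => ‖d k‖) hc hd hp
  rw [hT]
  refine Summable.tsum_le_tsum (fun k => ?_)
    (summable_norm_sum_mul_antidiagonal_of_summable_norm hc hd) hS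
  exact (norm_sum_le _ _).trans (le_of_eq (Finset.sum_congr rfl fun kl _ => norm_mul _ _))

lemma hasSum_cauchyProduct {c d : ℕ → ℂ} (hc : Summable fun k => ‖c k‖)
    (hd : Summable fun k => ‖d k‖) {z g h : ℂ} (hz : ‖z‖ ≤ 1)
    (hg : HasSum (fun k => c k * z ^ k) g) (hh : HasSum (fun k => d k * z ^ k) h) :
    HasSum (fun k => (∑ kl ∈ Finset.HasAntidiagonal.antidiagonal k, c kl.1 * d kl.2) * z ^ k)
      (g * h) := by
  have e : ∀ k, (∑ kl ∈ Finset.HasAntidiagonal.antidiagonal k, c kl.1 * d kl.2) * z ^ k =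
      ∑ kl ∈ Finset.HasAntidiagonal.antidiagonal k, (c kl.1 * z ^ kl.1) * (d kl.2 * z ^ kl.2) := by
    intro k
    rw [Finset.sum_mul]
    refine Finset.sum_congr rfl fun kl hkl => ?_
    rw [← Finset.HasAntidiagonal.mem_antidiagonal.1 hkl, pow_add]; ring
  simp_rw [e]
  rw [← hg.tsum_eq, ← hh.tsum_eq, tsum_mul_tsum_eq_tsum_sum_antidiagonal_of_summable_norm
    (summable_mul_pow_norm hc hz) (summable_mul_pow_norm hd hz)]
  exact (summable_norm_sum_mul_antidiagonal_of_summable_norm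
    (summable_mul_pow_norm hc hz) (summable_mul_pow_norm hd hz)).of_norm.hasSum

lemma WienerBound.mul {g h : ℂ → ℂ} {M N : ℝ} (hg : WienerBound g M) (hh : WienerBound h N) :
    WienerBound (fun z => g z * h z) (M * N) := by
  obtain ⟨c, hc, hM, hg⟩ := hg
  obtain ⟨d, hd, hN, hh⟩ := hh
  refine ⟨fun k => ∑ kl ∈ Finset.HasAntidiagonal.antidiagonal k, c kl.1 * d kl.2,
    summable_norm_sum_mul_antidiagonal_of_summable_norm hc hd,
    (tsum_norm_cauchyProduct_le hc hd).trans ?_,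
    fun z hz => hasSum_cauchyProduct hc hd hz (hg z hz) (hh z hz)⟩
  have h0 : 0 ≤ ∑' k, ‖c k‖ := tsum_nonneg fun _ => norm_nonneg _
  have h1 : 0 ≤ ∑' k, ‖d k‖ := tsum_nonneg fun _ => norm_nonneg _
  exact mul_le_mul hM hN h1 (h0.trans hM)

lemma WienerBound.pow {g : ℂ → ℂ} {M : ℝ} (hg : WienerBound g M) (n : ℕ) :
    WienerBound (fun z => g z ^ n) (M ^ n) := by
  induction n with
  | zero => simpa using wienerBound_const 1
  | succ n ih => simpa [pow_succ] using ih.mul hg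

lemma IsWiener.mul {g h : ℂ → ℂ} (hg : IsWiener g) (hh : IsWiener h) :
    IsWiener fun z => g z * h z := by
  obtain ⟨M, hM⟩ := hg.exists_bound
  obtain ⟨N, hN⟩ := hh.exists_bound
  exact (hM.mul hN).isWiener

lemma IsWiener.pow {g : ℂ → ℂ} (hg : IsWiener g) (n : ℕ) : IsWiener fun z => g z ^ n := by
  obtain ⟨M, hM⟩ := hg.exists_bound
  exact (hM.pow n).isWiener

lemma IsWiener.add {g h : ℂ → ℂ} (hg : IsWiener g) (hh : IsWiener h) :
    IsWiener fun z => g z + h z := by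
  obtain ⟨c, hc, hg⟩ := hg
  obtain ⟨d, hd, hh⟩ := hh
  refine ⟨fun k => c k + d k, Summable.of_nonneg_of_le (fun _ => norm_nonneg _)
    (fun k => norm_add_le _ _) (hc.add hd), fun z hz => ?_⟩
  simpa [add_mul] using (hg z hz).add (hh z hz)

lemma IsWiener.finset_sum {ι : Type*} (s : Finset ι) {g : ι → ℂ → ℂ}
    (hg : ∀ i ∈ s, IsWiener (g i)) : IsWiener fun z => ∑ i ∈ s, g i z := by
  classical
  induction s using Finset.induction_on with
  | empty => simpa using isWiener_const 0
  | insert a s ha ih =>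
    simp_rw [Finset.sum_insert ha]
    exact (hg a (Finset.mem_insert_self _ _)).add
      (ih fun i hi => hg i (Finset.mem_insert_of_mem hi))

/-- The double family of coefficients is absolutely summable, so it may be summed by powers of z
instead of by m. This is completeness of the Wiener algebra on the disc. -/
lemma isWiener_of_hasSum {g : ℕ → ℂ → ℂ} {M : ℕ → ℝ} (hg : ∀ m, WienerBound (g m) (M m))
    (hM : Summable M) {G : ℂ → ℂ} (hG : ∀ z, ‖z‖ ≤ 1 → HasSum (fun m => g m z) (G z)) :
    IsWiener G := by
  choose c hc hcM hcg using hg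
  have hs : Summable fun p : ℕ × ℕ => ‖c p.1 p.2‖ := by
    rw [summable_prod_of_nonneg fun _ => norm_nonneg _]
    exact ⟨hc, Summable.of_nonneg_of_le (fun m => tsum_nonneg fun _ => norm_nonneg _) hcM hM⟩
  have hs2 : Summable fun p : ℕ × ℕ => ‖c p.2 p.1‖ := hs.prod_symm
  have hk : ∀ k, Summable fun m => ‖c m k‖ := hs2.prod_factor
  refine ⟨fun k => ∑' m, c m k, ?_, fun z hz => ?_⟩
  · refine Summable.of_nonneg_of_le (fun _ => norm_nonneg _) (fun k => ?_) hs2.prod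
    exact norm_tsum_le_tsum_norm (hk k)
  · have hsz : Summable fun p : ℕ × ℕ => c p.1 p.2 * z ^ p.2 := by
      refine Summable.of_norm_bounded hs fun p => ?_
      rw [norm_mul, norm_pow]
      exact mul_le_of_le_one_right (norm_nonneg _) (pow_le_one₀ (norm_nonneg _) hz)
    have h1 := hsz.hasSum.prod_fiberwise fun m => hcg m z hz
    have h2 : HasSum (fun k => ∑' m, c m k * z ^ k) (∑' p : ℕ × ℕ, c p.1 p.2 * z ^ p.2) := by
      have h3 := (Equiv.prodComm ℕ ℕ).hasSum_iff.2 hsz.hasSum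
      exact h3.prod_fiberwise fun k => ((hk k).of_norm.mul_right (z ^ k)).hasSum
    rw [(hG z hz).unique h1]
    simpa [tsum_mul_right] using h2

/-- The exponential series converges in the algebra: its mth term has ℓ¹-norm at most M^m/m!. The
quantitative `WienerBound` exists for such sums. -/
lemma IsWiener.exp {g : ℂ → ℂ} (hg : IsWiener g) : IsWiener fun z => Complex.exp (g z) := by
  obtain ⟨M, hM⟩ := hg.exists_bound
  refine isWiener_of_hasSum (g := fun m z => (m.factorial : ℂ)⁻¹ * g z ^ m)
    (fun m => (wienerBound_const ((m.factorial : ℂ)⁻¹)).mul (hM.pow m)) ?_ fun z _ => ?_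
  · have := Real.summable_pow_div_factorial M
    refine this.congr fun m => ?_
    simp [div_eq_inv_mul]
  · have := NormedSpace.expSeries_div_hasSum_exp (g z)
    rw [← Complex.exp_eq_exp_ℂ] at this
    simpa [div_eq_inv_mul] using this

/-- The Cauchy power series on a circle of radius r with 1 < r < R converges absolutely at 1. -/
lemma isWiener_of_differentiableOn {g : ℂ → ℂ} {R : ℝ} (hR : 1 < R)
    (hg : DifferentiableOn ℂ g (Metric.ball 0 R)) : IsWiener g := by
  obtain ⟨r, hr1, hrR⟩ := exists_between hR
  lift r to NNReal using by linarith
  have hr0 : (0 : NNReal) < r := by exact_mod_cast (zero_lt_one.trans hr1)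
  have h := (hg.mono (Metric.closedBall_subset_ball hrR)).hasFPowerSeriesOnBall hr0
  set p := cauchyPowerSeries g 0 r
  have hsum : Summable fun k => ‖p.coeff k‖ := by
    have : Summable fun k => ‖p k‖ * (1 : NNReal) ^ k := by
      refine p.summable_norm_mul_pow (lt_of_lt_of_le ?_ h.r_le)
      exact_mod_cast hr1
    simpa [FormalMultilinearSeries.norm_apply_eq_norm_coef] using this
  refine ⟨p.coeff, hsum, fun z hz => ?_⟩
  have hz' : z ∈ Metric.eball (0 : ℂ) r := by
    simp only [Metric.mem_eball, edist_zero_right]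
    have h1 : ‖z‖ < r := lt_of_le_of_lt hz hr1
    rw [enorm_eq_nnnorm]
    exact_mod_cast h1
  have := h.hasSum hz'
  simpa [FormalMultilinearSeries.apply_eq_pow_smul_coeff, mul_comm] using this

/-- By compactness a series analytic beyond the closed disc and without zeros on it stays free of
zeros on a larger disc, where its reciprocal is holomorphic. The radius condition in `IsCanonical`
thus replaces Wiener's lemma. -/
lemma isWiener_inv_of_ne_zero {φ : ℕ → ℂ} (hφ : IsCanonical φ) :
    IsWiener fun z => (∑' k, φ k * z ^ k)⁻¹ := by
  obtain ⟨⟨R, hR, hs⟩, h0⟩ := hφ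
  set F : ℂ → ℂ := fun z => ∑' k, φ k * z ^ k
  have hd : DifferentiableOn ℂ F (Metric.ball 0 R) := by
    refine DifferentiableOn.mono (t := Metric.ball (0:ℂ) R) ?_ subset_rfl
    refine Complex.differentiableOn_tsum_of_summable_norm hs
      (fun k => by fun_prop) Metric.isOpen_ball fun k z hz => ?_
    rw [norm_mul, norm_pow]
    have : ‖z‖ ≤ R := by simpa using (Metric.mem_ball.1 hz).le
    gcongr
  have hcont : ContinuousOn F (Metric.ball 0 R) := hd.continuousOn
  have hopen : IsOpen (Metric.ball (0:ℂ) R ∩ F ⁻¹' {0}ᶜ) :=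
    hcont.isOpen_inter_preimage Metric.isOpen_ball isOpen_compl_singleton
  have hsub : Metric.closedBall (0:ℂ) 1 ⊆ Metric.ball (0:ℂ) R ∩ F ⁻¹' {0}ᶜ := fun z hz =>
    ⟨Metric.closedBall_subset_ball hR hz, h0 z (by simpa using hz)⟩
  obtain ⟨δ, hδ, hsub'⟩ := (isCompact_closedBall (0:ℂ) 1).exists_thickening_subset_open hopen hsub
  rw [thickening_closedBall hδ zero_le_one] at hsub'
  refine isWiener_of_differentiableOn (R := δ + 1) (by linarith) ?_
  exact (hd.mono fun z hz => (hsub' hz).1).inv fun z hz => (hsub' hz).2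

/-- Identifies `wCoeff`, defined through derivatives at 0, with the coefficients of an explicit
series. -/
lemma taylorCoeff_of_hasSum {g : ℂ → ℂ} {c : ℕ → ℂ} (hc : Summable fun k => ‖c k‖)
    (h : ∀ z : ℂ, ‖z‖ < 1 → HasSum (fun k => c k * z ^ k) (g z)) (k : ℕ) :
    iteratedDeriv k g 0 / (k.factorial : ℂ) = c k := by
  have hp : HasFPowerSeriesOnBall g (FormalMultilinearSeries.ofScalars ℂ c) 0 1 := by
    refine ⟨?_, one_pos, fun {y} hy => ?_⟩
    · have : Summable fun k => ‖(FormalMultilinearSeries.ofScalars ℂ c : FormalMultilinearSeries ℂ ℂ ℂ) k‖ * (1 : NNReal) ^ k := by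
        simpa [FormalMultilinearSeries.ofScalars_norm] using hc
      exact_mod_cast FormalMultilinearSeries.le_radius_of_summable _ this
    · have hy' : ‖y‖ < 1 := by
        simp only [Metric.mem_eball, edist_zero_right] at hy
        rw [enorm_eq_nnnorm] at hy
        exact_mod_cast hy
      simpa [FormalMultilinearSeries.ofScalars_apply_eq, mul_comm] using h y hy'
  have h2 := hp.factorial_smul (1 : ℂ) k
  have h3 : iteratedDeriv k g 0 = (k.factorial : ℂ) * c k := by
    rw [iteratedDeriv_eq_iteratedFDeriv, ← h2]
    simp
  rw [h3, mul_div_cancel_left₀]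
  exact_mod_cast k.factorial_ne_zero

/-! ## Fourier coefficients on one period -/

lemma neg_pi_lt_pi : -Real.pi < Real.pi := by linarith [Real.pi_pos]

instance isFiniteMeasure_circ : IsFiniteMeasure circ := by
  unfold circ; infer_instance

lemma integral_circ (F : ℝ → ℂ) : ∫ t, F t ∂circ = ∫ t in (-Real.pi)..Real.pi, F t := by
  rw [intervalIntegral.integral_of_le neg_pi_lt_pi.le, circ]

lemma ae_circ_of_ae {p : ℝ → Prop} (h : ∀ᵐ t ∂(volume : Measure ℝ), p t) : ∀ᵐ t ∂circ, p t :=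
  ae_restrict_of_ae h

lemma ae_circ_mem : ∀ᵐ t ∂circ, t ∈ Set.Ioc (-Real.pi) Real.pi :=
  ae_restrict_mem measurableSet_Ioc

lemma ae_circ_of_countable {p : ℝ → Prop} (h : {t | ¬ p t}.Countable) : ∀ᵐ t ∂circ, p t :=
  ae_circ_of_ae (h.measure_zero _)

/-- The Fourier coefficients `(2π)⁻¹ ∫ F(t) e^{-ikt} dt`. -/
noncomputable def fc (F : ℝ → ℂ) (k : ℤ) : ℂ :=
  1 / (2 * (Real.pi : ℂ)) * ∫ t, F t * Complex.exp (-(Complex.I * k * t)) ∂circ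

lemma norm_exp_I_int (k : ℤ) (t : ℝ) : ‖Complex.exp (Complex.I * k * t)‖ = 1 := by
  have : Complex.I * k * t = ((k * t : ℝ) : ℂ) * Complex.I := by push_cast; ring
  rw [this, Complex.norm_exp_ofReal_mul_I]

lemma norm_exp_neg_I_int (k : ℤ) (t : ℝ) : ‖Complex.exp (-(Complex.I * k * t))‖ = 1 := by
  have := norm_exp_I_int (-k) t
  push_cast at this
  rw [← this]; ring_nf

lemma integral_exp_circ (k : ℤ) :
    ∫ t, Complex.exp (Complex.I * k * t) ∂circ = if k = 0 then 2 * (Real.pi : ℂ) else 0 := by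
  rw [integral_circ]
  split_ifs with h
  · simp [h]; ring
  · have hk : Complex.I * (k : ℂ) ≠ 0 := mul_ne_zero Complex.I_ne_zero (by exact_mod_cast h)
    rw [integral_exp_mul_complex hk]
    have : Complex.exp (Complex.I * k * (Real.pi : ℝ)) =
        Complex.exp (Complex.I * k * ((-Real.pi : ℝ) : ℂ)) := by
      rw [Complex.exp_eq_exp_iff_exists_int]
      exact ⟨k, by push_cast; ring⟩
    rw [this, sub_self, zero_div]

lemma integrable_mul_exp {F : ℝ → ℂ} (hF : Integrable F circ) (k : ℤ) :
    Integrable (fun t => F t * Complex.exp (-(Complex.I * k * t))) circ := by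
  refine hF.mul_bdd (c := 1) (by fun_prop) (Eventually.of_forall fun t => ?_)
  rw [norm_exp_neg_I_int]

lemma fc_add {F G : ℝ → ℂ} (hF : Integrable F circ) (hG : Integrable G circ) (k : ℤ) :
    fc (fun t => F t + G t) k = fc F k + fc G k := by
  unfold fc
  rw [← mul_add, ← integral_add (integrable_mul_exp hF k) (integrable_mul_exp hG k)]
  simp_rw [add_mul]

lemma fc_const_mul (a : ℂ) (F : ℝ → ℂ) (k : ℤ) : fc (fun t => a * F t) k = a * fc F k := by
  unfold fc
  simp_rw [mul_assoc]
  rw [integral_const_mul]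
  ring

lemma fc_congr {F G : ℝ → ℂ} (h : F =ᵐ[circ] G) (k : ℤ) : fc F k = fc G k := by
  unfold fc
  congr 1
  refine integral_congr_ae ?_
  filter_upwards [h] with t ht
  rw [ht]

lemma fc_exp (m k : ℤ) :
    fc (fun t => Complex.exp (Complex.I * m * t)) k = if m = k then 1 else 0 := by
  have : ∀ t : ℝ, Complex.exp (Complex.I * m * t) * Complex.exp (-(Complex.I * k * t)) =
      Complex.exp (Complex.I * (m - k : ℤ) * t) := fun t => by
    rw [← Complex.exp_add]; congr 1; push_cast; ring
  unfold fc
  simp_rw [this]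
  rw [integral_exp_circ]
  have hpi : (Real.pi : ℂ) ≠ 0 := by exact_mod_cast Real.pi_ne_zero
  by_cases h : m = k
  · simp [h]; field_simp
  · simp [h, sub_eq_zero]

lemma hasSum_fc {ι : Type*} [Countable ι] {F : ι → ℝ → ℂ} {G : ℝ → ℂ} {M : ι → ℝ}
    (hF : ∀ i, AEStronglyMeasurable (F i) circ) (hM : Summable M)
    (hb : ∀ i, ∀ᵐ t ∂circ, ‖F i t‖ ≤ M i)
    (hG : ∀ᵐ t ∂circ, HasSum (fun i => F i t) (G t)) (k : ℤ) :
    HasSum (fun i => fc (F i) k) (fc G k) := by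
  unfold fc
  refine HasSum.mul_left _ ?_
  refine hasSum_integral_of_dominated_convergence (fun i _ => M i)
    (fun i => (hF i).mul (by fun_prop)) (fun i => ?_) (Eventually.of_forall fun _ => hM)
    (integrable_const _) ?_
  · filter_upwards [hb i] with t ht
    rw [norm_mul, norm_exp_neg_I_int, mul_one]; exact ht
  · filter_upwards [hG] with t ht using ht.mul_right _

/-- The frequencies `m i` may repeat; the coefficient at k then collects all indices with `m i = k`.
-/
lemma hasSum_fc_exp {ι : Type*} [Countable ι] {c : ι → ℂ} (hc : Summable fun i => ‖c i‖)
    (m : ι → ℤ) {G : ℝ → ℂ}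
    (hG : ∀ᵐ t : ℝ ∂circ, HasSum (fun i => c i * Complex.exp (Complex.I * m i * (t : ℝ))) (G t)) (k : ℤ) :
    HasSum (fun i => if m i = k then c i else 0) (fc G k) := by
  have := hasSum_fc (F := fun i t => c i * Complex.exp (Complex.I * m i * t)) (M := fun i => ‖c i‖)
    (fun i => by fun_prop) hc
    (fun i => Eventually.of_forall fun t => by rw [norm_mul, norm_exp_I_int, mul_one]) hG k
  simpa [fc_const_mul, fc_exp] using this

lemma fourier_coe_two_pi {T : ℝ} (hT : T = 2 * Real.pi) (k : ℤ) (t : ℝ) :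
    fourier k (t : AddCircle T) = Complex.exp (Complex.I * k * t) := by
  have hpi : (Real.pi : ℂ) ≠ 0 := by exact_mod_cast Real.pi_ne_zero
  rw [fourier_coe_apply, hT]
  congr 1
  push_cast
  field_simp

lemma fourierCoeffOn_eq_fc {b : ℝ} (hb : -Real.pi < b) (hb' : b = Real.pi) (F : ℝ → ℂ) (k : ℤ) :
    fourierCoeffOn hb F k = fc F k := by
  subst hb'
  rw [fourierCoeffOn_eq_integral, fc, integral_circ]
  have : ∀ t : ℝ, fourier (-k) (t : AddCircle (Real.pi - -Real.pi)) • F t =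
      F t * Complex.exp (-(Complex.I * k * t)) := fun t => by
    rw [fourier_coe_two_pi (by ring), smul_eq_mul, mul_comm]
    push_cast
    ring_nf
  simp_rw [this]
  rw [Complex.real_smul]
  push_cast
  ring_nf

lemma hasSum_sq_fc {F : ℝ → ℂ} (hF : MemLp F 2 circ) :
    HasSum (fun k : ℤ => ‖fc F k‖ ^ 2) (1 / (2 * Real.pi) * ∫ t, ‖F t‖ ^ 2 ∂circ) := by
  have := hasSum_sq_fourierCoeffOn neg_pi_lt_pi hF
  simp_rw [fourierCoeffOn_eq_fc neg_pi_lt_pi rfl] at this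
  convert this using 1
  rw [intervalIntegral.integral_of_le neg_pi_lt_pi.le, circ, smul_eq_mul]
  congr 1
  field_simp
  ring

lemma hasSum_fc_mul_exp {F : ℝ → ℂ} (hF : ContinuousOn F (Set.Icc (-Real.pi) Real.pi))
    (hF' : F (-Real.pi) = F Real.pi) (hs : Summable fun k => fc F k) {t : ℝ}
    (ht : t ∈ Set.Icc (-Real.pi) Real.pi) :
    HasSum (fun k : ℤ => fc F k * Complex.exp (Complex.I * k * t)) (F t) := by
  have : Fact (0 < 2 * Real.pi) := ⟨by positivity⟩
  have hpi : -Real.pi + 2 * Real.pi = Real.pi := by ring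
  let f : C(AddCircle (2 * Real.pi), ℂ) := ⟨AddCircle.liftIco (2 * Real.pi) (-Real.pi) F,
    AddCircle.liftIco_continuous (by rw [hpi, hF']) (by rwa [hpi])⟩
  have hfc : ∀ k, fourierCoeff f k = fc F k := fun k => by
    change fourierCoeff (AddCircle.liftIco (2 * Real.pi) (-Real.pi) F) k = _
    rw [fourierCoeff_liftIco_eq, fourierCoeffOn_eq_fc _ hpi]
  have key : ∀ s ∈ Set.Ico (-Real.pi) Real.pi,
      HasSum (fun k : ℤ => fc F k * Complex.exp (Complex.I * k * s)) (F s) := by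
    intro s hs'
    have h := has_pointwise_sum_fourier_series_of_summable (f := f)
      (by rw [show fourierCoeff f = fc F from funext hfc]; exact hs) (s : AddCircle (2 * Real.pi))
    have e : f (s : AddCircle (2 * Real.pi)) = F s :=
      AddCircle.liftIco_coe_apply (by rwa [hpi])
    rw [e] at h
    simpa only [hfc, fourier_coe_two_pi rfl, smul_eq_mul] using h
  -- The lift to the circle reads F on [-π, π) only; the value at π is taken from -π.
  rcases eq_or_lt_of_le ht.2 with h | h
  · have h1 := key (-Real.pi) ⟨le_rfl, neg_pi_lt_pi⟩
    rw [hF', ← h] at h1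
    convert h1 using 3 with k
    rw [h, Complex.exp_eq_exp_iff_exists_int]
    exact ⟨k, by push_cast; ring⟩
  · exact key t ⟨ht.1, h⟩

/-! ## The factorization of the weight -/

/-- The entire function `sin z / z`. -/
noncomputable def csinc : ℂ → ℂ := dslope Complex.sin 0

lemma differentiable_csinc : Differentiable ℂ csinc := by
  rw [← differentiableOn_univ]
  exact (Complex.differentiableOn_dslope univ_mem).2 Complex.differentiable_sin.differentiableOn

lemma csinc_ofReal (t : ℝ) : csinc t = (Real.sinc t : ℂ) := by
  by_cases h : t = 0
  · simp [h, csinc]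
  · have h' : (t : ℂ) ≠ 0 := by exact_mod_cast h
    rw [csinc, dslope_of_ne _ h', slope_def_field, Real.sinc_of_ne_zero h]
    simp

/-- Differentiability at 0 and continuity of the derivative are inherited from the entire function
`csinc`. -/
lemma hasDerivAt_sinc (t : ℝ) : HasDerivAt Real.sinc (deriv csinc t).re t := by
  have h := (differentiable_csinc (t : ℂ)).hasDerivAt.real_of_complex
  simpa [csinc_ofReal] using h

lemma continuous_deriv_csinc : Continuous fun t : ℝ => (deriv csinc t).re := by
  have h : Differentiable ℂ (deriv csinc) := by
    rw [← differentiableOn_univ]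
    exact differentiable_csinc.differentiableOn.deriv isOpen_univ
  exact Complex.continuous_re.comp (h.continuous.comp Complex.continuous_ofReal)

lemma sinc_half_pos {t : ℝ} (ht : t ∈ Set.Icc (-Real.pi) Real.pi) : 0 < Real.sinc (t / 2) := by
  have hpi := Real.pi_pos
  rcases lt_trichotomy t 0 with h | h | h
  · rw [← Real.sinc_neg, Real.sinc_of_ne_zero (by linarith)]
    exact div_pos (Real.sin_pos_of_pos_of_lt_pi (by linarith) (by linarith [ht.1])) (by linarith)
  · simp [h]
  · rw [Real.sinc_of_ne_zero (by linarith)]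
    exact div_pos (Real.sin_pos_of_pos_of_lt_pi (by linarith) (by linarith [ht.2])) (by linarith)

/-- `ln (|1 - e^{-it}|² / t²)`. -/
noncomputable def logSinc (t : ℝ) : ℝ := 2 * Real.log (Real.sinc (t / 2))

lemma logSinc_neg (t : ℝ) : logSinc (-t) = logSinc t := by
  rw [logSinc, neg_div, Real.sinc_neg, logSinc]

lemma hasDerivAt_logSinc {t : ℝ} (ht : t ∈ Set.Icc (-Real.pi) Real.pi) :
    HasDerivAt logSinc ((deriv csinc (t / 2 : ℝ)).re / Real.sinc (t / 2)) t := by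
  have h1 : HasDerivAt (fun s : ℝ => Real.sinc (s / 2)) ((deriv csinc (t / 2 : ℝ)).re * (1 / 2)) t :=
    HasDerivAt.comp (h₂ := Real.sinc) (h := fun s : ℝ => s / 2) t (hasDerivAt_sinc (t / 2))
      ((hasDerivAt_id t).div_const 2)
  refine ((h1.log (sinc_half_pos ht).ne').const_mul 2).congr_deriv ?_
  ring

lemma continuousOn_deriv_logSinc :
    ContinuousOn (fun t : ℝ => (deriv csinc (t / 2 : ℝ)).re / Real.sinc (t / 2))
      (Set.Icc (-Real.pi) Real.pi) :=
  ContinuousOn.div (continuous_deriv_csinc.comp (by fun_prop)).continuousOn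
    (Real.continuous_sinc.comp (by fun_prop)).continuousOn fun _ ht => (sinc_half_pos ht).ne'

lemma continuousOn_logSinc : ContinuousOn logSinc (Set.Icc (-Real.pi) Real.pi) :=
  fun _ ht => (hasDerivAt_logSinc ht).continuousAt.continuousWithinAt

lemma memLp_circ_of_continuousOn {F : ℝ → ℂ} (hF : ContinuousOn F (Set.Icc (-Real.pi) Real.pi))
    (p : ℝ≥0∞) : MemLp F p circ := by
  obtain ⟨C, hC⟩ := isCompact_Icc.exists_bound_of_continuousOn hF
  refine MemLp.of_bound ?_ C ?_
  · exact (hF.mono Set.Ioc_subset_Icc_self).aestronglyMeasurable measurableSet_Ioc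
  · filter_upwards [ae_circ_mem] with t ht using hC t (Set.Ioc_subset_Icc_self ht)

lemma integrable_circ_of_continuousOn {F : ℝ → ℂ}
    (hF : ContinuousOn F (Set.Icc (-Real.pi) Real.pi)) : Integrable F circ :=
  memLp_one_iff_integrable.1 (memLp_circ_of_continuousOn hF 1)

/-- A continuously differentiable function on a period with equal end values has absolutely
summable Fourier coefficients. -/
lemma summable_fc_of_hasDerivAt {F F' : ℝ → ℂ}
    (hF : ∀ t ∈ Set.Icc (-Real.pi) Real.pi, HasDerivAt F (F' t) t)
    (hF' : ContinuousOn F' (Set.Icc (-Real.pi) Real.pi)) (hpi : F (-Real.pi) = F Real.pi) :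
    Summable fun k : ℤ => ‖fc F k‖ := by
  have hL2 := (hasSum_sq_fc (memLp_circ_of_continuousOn hF' 2)).summable
  have h1 : ∀ k : ℤ, k ≠ 0 → ‖fc F k‖ ≤ 1 / |(k : ℝ)| ^ 2 + ‖fc F' k‖ ^ 2 := by
    intro k hk
    have h := fourierCoeffOn_of_hasDerivAt (f := F) (f' := F') neg_pi_lt_pi hk
      (by rwa [Set.uIcc_of_le neg_pi_lt_pi.le])
      (ContinuousOn.intervalIntegrable (by rwa [Set.uIcc_of_le neg_pi_lt_pi.le]))
    rw [fourierCoeffOn_eq_fc _ rfl, fourierCoeffOn_eq_fc _ rfl, hpi] at h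
    have hk' : (k : ℂ) ≠ 0 := by exact_mod_cast hk
    have hpi0 : (Real.pi : ℂ) ≠ 0 := by exact_mod_cast Real.pi_ne_zero
    -- Integration by parts; the boundary term vanishes because the end values agree.
    have h2 : fc F k = (1 / (Complex.I * k)) * fc F' k := by
      rw [h]
      have := Complex.I_ne_zero
      push_cast
      field_simp
      ring
    have h3 : ‖fc F k‖ = (1 / |(k : ℝ)|) * ‖fc F' k‖ := by
      rw [h2]; simp
    rw [h3]
    have : (1 / |(k : ℝ)|) ^ 2 = 1 / |(k : ℝ)| ^ 2 := by rw [div_pow, one_pow]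
    rw [← this]
    -- A product is at most the sum of the squares: one is summable as 1/k², the other by Parseval
    -- for F'.
    nlinarith [sq_nonneg (1 / |(k : ℝ)| - ‖fc F' k‖), sq_nonneg (1 / |(k : ℝ)|),
      sq_nonneg ‖fc F' k‖]
  have hs : Summable fun k : ℤ => 1 / |(k : ℝ)| ^ 2 + ‖fc F' k‖ ^ 2 := by
    refine Summable.add ?_ hL2
    simpa using Real.summable_one_div_int_pow (p := 2) |>.2 (by norm_num)
  refine Summable.of_norm_bounded_eventually hs ?_
  rw [Filter.eventually_cofinite]
  refine (Set.finite_singleton (0 : ℤ)).subset fun k hk => ?_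
  by_contra hk'
  exact hk (by rw [norm_norm]; exact h1 k hk')

lemma summable_fc_logSinc : Summable fun k : ℤ => ‖fc (fun t => (logSinc t : ℂ)) k‖ := by
  refine summable_fc_of_hasDerivAt
    (F' := fun t : ℝ => (((deriv csinc (t / 2 : ℝ)).re / Real.sinc (t / 2) : ℝ) : ℂ))
    (fun t ht => (hasDerivAt_logSinc ht).ofReal_comp)
    (Complex.continuous_ofReal.comp_continuousOn continuousOn_deriv_logSinc) ?_
  rw [logSinc_neg]

lemma fc_neg_of_real (L : ℝ → ℝ) (k : ℤ) :
    fc (fun t => (L t : ℂ)) (-k) = conj (fc (fun t => (L t : ℂ)) k) := by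
  unfold fc
  rw [map_mul, ← integral_conj]
  have : ∀ t : ℝ, conj ((L t : ℂ) * Complex.exp (-(Complex.I * k * t))) =
      (L t : ℂ) * Complex.exp (-(Complex.I * ((-k : ℤ) : ℂ) * t)) := fun t => by
    rw [map_mul, Complex.conj_ofReal, ← Complex.exp_conj]
    congr 2
    simp
  simp_rw [this]
  simp [Complex.conj_ofNat]

/-- The Taylor coefficients of the analytic function in the disc with real part `logSinc / 2`. -/
noncomputable def logSincCoeff (k : ℕ) : ℂ :=
  fc (fun t => (logSinc t : ℂ)) k - if k = 0 then fc (fun t => (logSinc t : ℂ)) 0 / 2 else 0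

lemma summable_logSincCoeff : Summable fun k => ‖logSincCoeff k‖ := by
  have h1 : Summable fun k : ℕ => ‖fc (fun t => (logSinc t : ℂ)) k‖ :=
    summable_fc_logSinc.comp_injective Nat.cast_injective
  have h2 : Summable fun k : ℕ => ‖if k = 0 then fc (fun t => (logSinc t : ℂ)) 0 / 2 else 0‖ :=
    summable_of_ne_finset_zero (s := {0}) fun k hk => by simp at hk; simp [hk]
  exact Summable.of_nonneg_of_le (fun _ => norm_nonneg _) (fun k => norm_sub_le _ _) (h1.add h2)

/-- `∑ₖ logSincCoeff(k) zᵏ`. -/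
noncomputable def logSincSeries (z : ℂ) : ℂ := ∑' k, logSincCoeff k * z ^ k

lemma exp_neg_I_nat (k : ℕ) (t : ℝ) :
    Complex.exp (-(Complex.I * t)) ^ k = Complex.exp (-(Complex.I * k * t)) := by
  rw [← Complex.exp_nat_mul]; ring_nf

lemma norm_exp_neg_I (t : ℝ) : ‖Complex.exp (-(Complex.I * t))‖ = 1 := by
  simpa using norm_exp_neg_I_int 1 t

/-- Adding the series to its conjugate pairs the frequencies k and -k and doubles the constant term,
which is why `logSincCoeff` halves it. Since `logSinc` is even, its Fourier series may be read at
-t, as the argument e^{-it} requires. -/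
lemma two_mul_re_logSincSeries {t : ℝ} (ht : t ∈ Set.Icc (-Real.pi) Real.pi) :
    2 * (logSincSeries (Complex.exp (-(Complex.I * t)))).re = logSinc t := by
  set e := fc (fun t => (logSinc t : ℂ)) with he
  have hq := (summable_mul_pow summable_logSincCoeff (norm_exp_neg_I t).le).hasSum
  change HasSum _ (logSincSeries _) at hq
  have hF := hasSum_fc_mul_exp (F := fun t => (logSinc t : ℂ))
    (Complex.continuous_ofReal.comp_continuousOn continuousOn_logSinc) (by rw [logSinc_neg])
    summable_fc_logSinc.of_norm (t := -t) ⟨by linarith [ht.2], by linarith [ht.1]⟩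
  have h1 := hF.nat_add_neg
  have h2 := hq.add (Complex.hasSum_conj'.2 hq)
  have h3 : HasSum (fun k : ℕ => if k = 0 then e 0 else 0) (e 0) := hasSum_ite_eq 0 (e 0)
  have h4 := h1.sub h3
  have hconj : ∀ k : ℤ, e (-k) = conj (e k) := fc_neg_of_real logSinc
  have hz : ∀ k : ℕ, conj (Complex.exp (-(Complex.I * t)) ^ k) = Complex.exp (Complex.I * k * t) := by
    intro k
    rw [exp_neg_I_nat, ← Complex.exp_conj]
    simp
  have h5 : ∀ k : ℕ, logSincCoeff k * Complex.exp (-(Complex.I * t)) ^ k +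
      conj (logSincCoeff k * Complex.exp (-(Complex.I * t)) ^ k) =
      (e k * Complex.exp (Complex.I * (k : ℤ) * (-t : ℝ)) +
        e (-k) * Complex.exp (Complex.I * (-k : ℤ) * (-t : ℝ))) - if k = 0 then e 0 else 0 := by
    intro k
    rw [map_mul, hz, exp_neg_I_nat, hconj]
    have e1 : Complex.exp (Complex.I * (k : ℤ) * (-t : ℝ)) = Complex.exp (-(Complex.I * k * t)) := by
      push_cast; ring_nf
    have e2 : Complex.exp (Complex.I * (-k : ℤ) * (-t : ℝ)) = Complex.exp (Complex.I * k * t) := by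
      push_cast; ring_nf
    rw [e1, e2]
    by_cases hk : k = 0
    · subst hk
      have h0 : conj (e 0) = e 0 := by simpa using (hconj 0).symm
      simp only [logSincCoeff, if_true, Nat.cast_zero, mul_zero, zero_mul, neg_zero, Complex.exp_zero,
        mul_one, ← he, map_sub, h0, map_div₀, Complex.conj_ofNat]
      ring
    · simp [logSincCoeff, hk, he]
  simp_rw [h5] at h2
  have h6 := h2.unique h4
  rw [Complex.add_conj, logSinc_neg] at h6
  have h7 : ((2 * (logSincSeries (Complex.exp (-(Complex.I * t)))).re : ℝ) : ℂ) = logSinc t := by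
    rw [h6]; simp [he]
  exact_mod_cast h7

/-! ### Fourier coefficients of the logarithm of the weight -/

lemma norm_exp_nat_eq_one (μ : ℕ) (t : ℝ) : ‖Complex.exp (-(Complex.I * μ * t))‖ = 1 := by
  simpa using norm_exp_neg_I_int μ t

lemma countable_exp_eq_one {μ : ℕ} (hμ : 1 ≤ μ) :
    {t : ℝ | Complex.exp (-(Complex.I * μ * t)) = 1}.Countable := by
  refine (Set.countable_range fun k : ℤ => -(k * (2 * Real.pi) / μ : ℝ)).mono fun t ht => ?_
  obtain ⟨k, hk⟩ := Complex.exp_eq_one_iff.1 ht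
  refine ⟨k, ?_⟩
  have hμ' : (μ : ℝ) ≠ 0 := by positivity
  have h2 : Complex.I * (-(μ * t : ℝ) : ℂ) = Complex.I * ((k * (2 * Real.pi) : ℝ) : ℂ) := by
    push_cast; linear_combination hk
  have h3 : -(μ * t : ℝ) = k * (2 * Real.pi) := by
    have := mul_left_cancel₀ Complex.I_ne_zero h2
    exact_mod_cast this
  change -(k * (2 * Real.pi) / μ : ℝ) = t
  rw [← h3]
  field_simp

lemma ae_one_sub_exp_ne_zero {μ : ℕ} (hμ : 1 ≤ μ) :
    ∀ᵐ t : ℝ ∂circ, 1 - Complex.exp (-(Complex.I * μ * t)) ≠ 0 := by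
  refine ae_circ_of_countable ((countable_exp_eq_one hμ).mono fun t ht => ?_)
  simp only [ne_eq, not_not, Set.mem_ofPred_eq, sub_eq_zero] at ht
  exact ht.symm

lemma integrable_log_norm_one_sub (μ : ℕ) :
    Integrable (fun t : ℝ => ((Real.log ‖1 - Complex.exp (-(Complex.I * μ * t))‖ : ℝ) : ℂ)) circ := by
  have h : IntervalIntegrable (fun t : ℝ => Real.log ‖1 - Complex.exp (-(Complex.I * μ * t))‖)
      volume (-Real.pi) Real.pi := by
    refine MeromorphicOn.intervalIntegrable_log_norm fun t _ => ?_
    have : AnalyticAt ℝ (fun t : ℝ => 1 - Complex.exp (-(Complex.I * μ * t))) t := by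
      have h1 : AnalyticAt ℝ (fun t : ℝ => -(Complex.I * μ * t)) t :=
        (analyticAt_const.mul (Complex.ofRealCLM.analyticAt t)).neg
      exact analyticAt_const.sub ((analyticAt_cexp.restrictScalars (𝕜 := ℝ)).comp h1)
    exact this.meromorphicAt
  rw [intervalIntegrable_iff, Set.uIoc_of_le neg_pi_lt_pi.le] at h
  exact h.ofReal

/-- The Fourier coefficients of `2 log |1 - r e^{-iμt}|` with nonnegative index. -/
lemma fc_log_norm_one_sub_of_lt_one {μ : ℕ} (hμ : 1 ≤ μ) {r : ℝ} (hr0 : 0 ≤ r) (hr : r < 1)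
    (k : ℕ) :
    fc (fun t => ((2 * Real.log ‖1 - r * Complex.exp (-(Complex.I * μ * t))‖ : ℝ) : ℂ)) k =
      -(if μ ∣ k then (r : ℂ) ^ (k / μ) * (μ / k) else 0) := by
  set w : ℝ → ℂ := fun t => r * Complex.exp (-(Complex.I * μ * t)) with hw
  have hwn : ∀ t, ‖w t‖ = r := fun t => by
    rw [hw, norm_mul, norm_exp_nat_eq_one, mul_one, Complex.norm_real, Real.norm_of_nonneg hr0]
  have hcont : Continuous fun t => Complex.log (1 - w t) := by
    refine Continuous.clog (by fun_prop) fun t => ?_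
    left
    have : (w t).re ≤ r := (Complex.re_le_norm _).trans (hwn t).le
    simp only [Complex.sub_re, Complex.one_re]
    linarith
  set c : ℕ → ℂ := fun j => -((r : ℂ) ^ j / j)
  have hc : Summable fun j => ‖c j‖ := by
    refine Summable.of_nonneg_of_le (fun _ => norm_nonneg _) (fun j => ?_)
      (summable_geometric_of_lt_one hr0 hr)
    simp only [c, norm_neg, norm_div, norm_pow, Complex.norm_real, Complex.norm_natCast,
      Real.norm_of_nonneg hr0]
    rcases Nat.eq_zero_or_pos j with h | h
    · simp [h]
    · exact div_le_self (by positivity) (by exact_mod_cast h)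
  have hA : ∀ t : ℝ, HasSum (fun j => c j * Complex.exp (Complex.I * (-(j * μ : ℕ) : ℤ) * t))
      (Complex.log (1 - w t)) := fun t => by
    have h := (Complex.hasSum_taylorSeries_neg_log (z := w t) (by rw [hwn]; exact hr)).neg
    rw [neg_neg] at h
    refine Eq.mpr (congrArg (HasSum · _) (funext fun j => ?_)) h
    have : Complex.exp (Complex.I * (-(j * μ : ℕ) : ℤ) * t) = Complex.exp (-(Complex.I * μ * t)) ^ j := by
      rw [← Complex.exp_nat_mul]; congr 1; push_cast; ring
    rw [this]
    simp only [c, hw, mul_pow]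
    ring
  have hB : ∀ t : ℝ, HasSum (fun j => c j * Complex.exp (Complex.I * (j * μ : ℕ) * t))
      (conj (Complex.log (1 - w t))) := fun t => by
    have h := Complex.hasSum_conj'.2 (hA t)
    refine Eq.mpr (congrArg (HasSum · _) (funext fun j => ?_)) h
    rw [map_mul, ← Complex.exp_conj]
    simp [c]
  have hsum : ∀ t, ((2 * Real.log ‖1 - w t‖ : ℝ) : ℂ) =
      Complex.log (1 - w t) + conj (Complex.log (1 - w t)) := fun t => by
    rw [Complex.add_conj, Complex.log_re]
  change fc (fun t => ((2 * Real.log ‖1 - w t‖ : ℝ) : ℂ)) k = _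
  simp_rw [hsum]
  have hconj : Integrable (fun t => conj (Complex.log (1 - w t))) circ :=
    integrable_circ_of_continuousOn (Complex.continuous_conj.comp hcont).continuousOn
  rw [fc_add (integrable_circ_of_continuousOn hcont.continuousOn) hconj]
  have h1 := hasSum_fc_exp hc (fun j => (-(j * μ : ℕ) : ℤ)) (Eventually.of_forall hA) k
  have h2 := hasSum_fc_exp hc (fun j => ((j * μ : ℕ) : ℤ))
    (Eventually.of_forall fun t => by simpa using hB t) k
  have hc0 : c 0 = 0 := by simp [c]
  -- This logarithm has nonpositive frequencies only, so it could contribute just at k = 0, where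
  -- its constant term vanishes.
  have h1' : fc (fun t => Complex.log (1 - w t)) k = 0 := by
    refine h1.unique ?_
    convert hasSum_zero using 2 with j
    split_ifs with h
    · have : j * μ = 0 := by omega
      rcases Nat.mul_eq_zero.1 this with h | h
      · rw [h, hc0]
      · omega
    · rfl
  rw [h1', zero_add]
  refine h2.unique ?_
  split_ifs with h
  · obtain ⟨m, rfl⟩ := h
    convert hasSum_single m fun j hj => ?_ using 1
    · rw [if_pos (by rw [mul_comm]), Nat.mul_div_cancel_left _ (by omega)]
      simp only [c]
      have : (μ : ℂ) ≠ 0 := by exact_mod_cast (show μ ≠ 0 by omega)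
      rcases Nat.eq_zero_or_pos m with hm | hm
      · simp [hm]
      · have : (m : ℂ) ≠ 0 := by exact_mod_cast hm.ne'
        push_cast
        field_simp
    · refine if_neg fun h => hj ?_
      have : μ * j = μ * m := by rw [mul_comm]; exact_mod_cast h
      exact Nat.eq_of_mul_eq_mul_left (by omega) this
  · convert hasSum_zero using 2 with j
    · refine if_neg fun h' => h ⟨j, ?_⟩
      rw [mul_comm]; exact_mod_cast h'.symm
    · simp

/-- An integrable majorant for the limit r → 1, uniform in r: |1 - w| ≤ 2|1 - rw| bounds the
logarithm from below, |1 - rw| ≤ 2 from above. -/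
lemma abs_log_norm_one_sub_le {w : ℂ} (hw : ‖w‖ = 1) (hw1 : 1 - w ≠ 0) {r : ℝ} (hr0 : 0 ≤ r)
    (hr : r < 1) :
    |Real.log ‖1 - r * w‖| ≤ Real.log 2 + |Real.log ‖1 - w‖| := by
  have hrw : ‖(r : ℂ) * w‖ = r := by rw [norm_mul, hw, mul_one, Complex.norm_real, Real.norm_of_nonneg hr0]
  have h1 : ‖1 - r * w‖ ≤ 2 := (norm_sub_le _ _).trans (by rw [hrw, norm_one]; linarith)
  have h3 : 1 - r ≤ ‖1 - r * w‖ := by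
    have := norm_sub_norm_le 1 (r * w)
    rwa [hrw, norm_one] at this
  have h2 : ‖1 - w‖ ≤ 2 * ‖1 - r * w‖ := by
    have e : 1 - w = (1 - r * w) - (1 - r : ℝ) * w := by push_cast; ring
    rw [e]
    refine (norm_sub_le _ _).trans ?_
    rw [norm_mul, hw, mul_one, Complex.norm_real, Real.norm_of_nonneg (by linarith)]
    linarith
  have hp : 0 < ‖1 - w‖ := norm_pos_iff.2 hw1
  have hp2 : 0 < ‖1 - r * w‖ := by linarith
  have h4 : Real.log ‖1 - r * w‖ ≤ Real.log 2 := Real.log_le_log hp2 h1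
  have h5 : Real.log ‖1 - w‖ ≤ Real.log 2 + Real.log ‖1 - r * w‖ := by
    rw [← Real.log_mul two_ne_zero hp2.ne']
    exact Real.log_le_log hp h2
  have := neg_abs_le (Real.log ‖1 - w‖)
  have h0 : 0 ≤ |Real.log ‖1 - w‖| := abs_nonneg _
  rw [abs_le]
  constructor <;> linarith

/-- The limit r → 1 of `fc_log_norm_one_sub_of_lt_one`. At k = 0 the quotient μ/0 has the value 0,
which is the true mean of log |1 - e^{-iμt}|. -/
lemma fc_log_norm_one_sub {μ : ℕ} (hμ : 1 ≤ μ) (k : ℕ) :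
    fc (fun t => ((2 * Real.log ‖1 - Complex.exp (-(Complex.I * μ * t))‖ : ℝ) : ℂ)) k =
      -(if μ ∣ k then (μ : ℂ) / k else 0) := by
  set r : ℕ → ℝ := fun m => (m : ℝ) / (m + 1) with hr
  have hr0 : ∀ m, 0 ≤ r m := fun m => by positivity
  have hr1 : ∀ m, r m < 1 := fun m => by
    rw [hr, div_lt_one (by positivity)]; linarith
  have hrt : Tendsto r atTop (𝓝 1) := tendsto_natCast_div_add_atTop 1
  have hrc : Tendsto (fun m => (r m : ℂ)) atTop (𝓝 1) := by
    exact_mod_cast (Complex.continuous_ofReal.tendsto 1).comp hrt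
  have h1 : Tendsto (fun m => fc (fun t =>
      ((2 * Real.log ‖1 - r m * Complex.exp (-(Complex.I * μ * t))‖ : ℝ) : ℂ)) k) atTop
      (𝓝 (fc (fun t => ((2 * Real.log ‖1 - Complex.exp (-(Complex.I * μ * t))‖ : ℝ) : ℂ)) k)) := by
    unfold fc
    refine Tendsto.const_mul _ ?_
    refine tendsto_integral_of_dominated_convergence
      (fun t => 2 * (Real.log 2 + |Real.log ‖1 - Complex.exp (-(Complex.I * μ * t))‖|)) (fun m => ?_)
      ?_ (fun m => ?_) ?_
    · refine Measurable.aestronglyMeasurable ?_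
      fun_prop
    · refine ((integrable_const _).add ?_).const_mul 2
      simpa using (integrable_log_norm_one_sub μ).norm
    · filter_upwards [ae_one_sub_exp_ne_zero hμ] with t ht
      rw [norm_mul, norm_exp_neg_I_int, mul_one, Complex.norm_real, Real.norm_eq_abs, abs_mul, abs_two]
      gcongr
      exact abs_log_norm_one_sub_le (norm_exp_nat_eq_one μ t) ht (hr0 m) (hr1 m)
    · filter_upwards [ae_one_sub_exp_ne_zero hμ] with t ht
      refine Tendsto.mul_const _ ((Complex.continuous_ofReal.tendsto _).comp (Tendsto.const_mul 2 ?_))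
      refine Tendsto.log ?_ (norm_ne_zero_iff.2 ht)
      refine Tendsto.norm (Tendsto.const_sub 1 ?_)
      simpa using hrc.mul_const (Complex.exp (-(Complex.I * μ * t)))
  refine tendsto_nhds_unique h1 ?_
  simp_rw [fun m => fc_log_norm_one_sub_of_lt_one hμ (hr0 m) (hr1 m) k]
  refine Tendsto.neg ?_
  split_ifs with h
  · simpa using (hrc.pow (k / μ)).mul_const ((μ : ℂ) / k)
  · exact tendsto_const_nhds

/-- |1 - e^{-it}| = 2|sin(t/2)| = |t| sinc(t/2). -/
lemma logSinc_eq {t : ℝ} (ht0 : t ≠ 0) (ht : t ∈ Set.Icc (-Real.pi) Real.pi) :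
    logSinc t = 2 * Real.log ‖1 - Complex.exp (-(Complex.I * t))‖ - 2 * Real.log |t| := by
  have h1 : ‖1 - Complex.exp (-(Complex.I * t))‖ = |t| * Real.sinc (t / 2) := by
    have := Complex.norm_exp_I_mul_ofReal_sub_one (-t)
    push_cast at this
    rw [mul_neg] at this
    rw [norm_sub_rev, this, ← abs_of_pos (sinc_half_pos ht), ← abs_mul, Real.norm_eq_abs,
      Real.sinc_of_ne_zero (div_ne_zero ht0 two_ne_zero), neg_div, Real.sin_neg, mul_neg, abs_neg]
    congr 1
    field_simp
  rw [h1, Real.log_mul (abs_ne_zero.2 ht0) (sinc_half_pos ht).ne', logSinc]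
  ring

/-- Separates the logarithmic singularities, which the factor 1 + z + ⋯ + z^{μ-1} will account for,
from the remainder `logSinc`, which is continuously differentiable on the period. -/
lemma ae_log_weight {n μ : ℕ} (hμ : 1 ≤ μ) : ∀ᵐ t : ℝ ∂circ, Real.log (weight n μ t) =
    n * (2 * Real.log ‖1 - Complex.exp (-(Complex.I * μ * t))‖ -
      2 * Real.log ‖1 - Complex.exp (-(Complex.I * t))‖ + logSinc t) := by
  filter_upwards [ae_one_sub_exp_ne_zero hμ, ae_circ_mem,
    ae_circ_of_countable (p := fun t => t ≠ 0) (by simp)] with t h1 h2 h3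
  rw [logSinc_eq h3 (Set.Ioc_subset_Icc_self h2), weight,
    Real.log_div (pow_ne_zero _ (norm_ne_zero_iff.2 h1)) (pow_ne_zero _ h3), Real.log_pow,
    Real.log_pow, Real.log_abs]
  push_cast
  ring

/-- The Fourier coefficients of `log weight` with nonnegative index. -/
lemma fc_log_weight {n μ : ℕ} (hμ : 1 ≤ μ) (k : ℕ) :
    fc (fun t => (Real.log (weight n μ t) : ℂ)) k =
      n * (-(if μ ∣ k then (μ : ℂ) / k else 0) + 1 / k + fc (fun t => (logSinc t : ℂ)) k) := by
  have hi : ∀ ν : ℕ, Integrable (fun t : ℝ =>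
      ((2 * Real.log ‖1 - Complex.exp (-(Complex.I * ν * t))‖ : ℝ) : ℂ)) circ := fun ν => by
    simpa using (integrable_log_norm_one_sub ν).const_mul 2
  have e : (fun t : ℝ => (Real.log (weight n μ t) : ℂ)) =ᵐ[circ] fun t : ℝ => (n : ℂ) *
      ((((2 * Real.log ‖1 - Complex.exp (-(Complex.I * μ * t))‖ : ℝ) : ℂ) +
      (-1) * ((2 * Real.log ‖1 - Complex.exp (-(Complex.I * (1 : ℕ) * t))‖ : ℝ) : ℂ)) +
      (logSinc t : ℂ)) := by
    filter_upwards [ae_log_weight (n := n) hμ] with t ht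
    rw [ht]
    push_cast
    ring_nf
  have hl : Integrable (fun t : ℝ => (logSinc t : ℂ)) circ := integrable_circ_of_continuousOn
    (Complex.continuous_ofReal.comp_continuousOn continuousOn_logSinc)
  have hd : Integrable (fun t : ℝ =>
      ((2 * Real.log ‖1 - Complex.exp (-(Complex.I * μ * t))‖ : ℝ) : ℂ) +
      (-1) * ((2 * Real.log ‖1 - Complex.exp (-(Complex.I * (1 : ℕ) * t))‖ : ℝ) : ℂ)) circ :=
    (hi μ).add ((hi 1).const_mul _)
  rw [fc_congr e, fc_const_mul, fc_add hd hl, fc_add (hi μ) ((hi 1).const_mul _), fc_const_mul, fc_log_norm_one_sub hμ,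
    fc_log_norm_one_sub le_rfl]
  simp

/-! ### The function `wFun` -/

lemma hasSum_herglotzKernel {ζ z : ℂ} (hζ : ‖ζ‖ = 1) (hz : ‖z‖ < 1) :
    HasSum (fun j : ℕ => (2 + if j = 0 then (-1 : ℂ) else 0) * (z * ζ⁻¹) ^ j)
      ((ζ + z) / (ζ - z)) := by
  have hζ0 : ζ ≠ 0 := norm_ne_zero_iff.1 (by rw [hζ]; exact one_ne_zero)
  have hq : ‖z * ζ⁻¹‖ < 1 := by rw [norm_mul, norm_inv, hζ, inv_one, mul_one]; exact hz
  have hne : ζ - z ≠ 0 := fun h => by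
    rw [sub_eq_zero] at h
    rw [← h, hζ] at hz
    exact lt_irrefl _ hz
  have h1 := (hasSum_geometric_of_norm_lt_one hq).mul_left 2
  have h2 : HasSum (fun j : ℕ => if j = 0 then (-1 : ℂ) else 0) (-1) := hasSum_ite_eq 0 (-1)
  have h3 := h1.add h2
  have e : (ζ + z) / (ζ - z) = 2 * (1 - z * ζ⁻¹)⁻¹ + -1 := by
    have : 1 - z * ζ⁻¹ = (ζ - z) / ζ := by field_simp
    rw [this]
    field_simp
    ring
  rw [e]
  refine Eq.mpr (congrArg (HasSum · _) (funext fun j => ?_)) h3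
  split_ifs with h
  · norm_num [h]
  · simp

lemma norm_herglotzCoeff_le (j : ℕ) : ‖(2 + if j = 0 then (-1 : ℂ) else 0)‖ ≤ 2 := by
  split_ifs <;> norm_num

/-- The kernel is 1 + 2 ∑_{j ≥ 1} (z/ζ)^j, so the Herglotz integral involves only Fourier
coefficients with nonnegative index, the constant one once and the others twice. -/
lemma hasSum_herglotz {L : ℝ → ℂ} (hL : Integrable L circ) {z : ℂ} (hz : ‖z‖ < 1) :
    HasSum (fun j : ℕ => (2 + if j = 0 then (-1 : ℂ) else 0) * z ^ j * fc L j)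
      (1 / (2 * (Real.pi : ℂ)) * ∫ t, (Complex.exp (Complex.I * t) + z) /
        (Complex.exp (Complex.I * t) - z) * L t ∂circ) := by
  have h := hasSum_integral_of_dominated_convergence (μ := circ)
    (F := fun (j : ℕ) (t : ℝ) => (2 + if j = 0 then (-1 : ℂ) else 0) * z ^ j *
      (L t * Complex.exp (-(Complex.I * j * t))))
    (f := fun t : ℝ => (Complex.exp (Complex.I * t) + z) / (Complex.exp (Complex.I * t) - z) * L t)
    (fun j t => 2 * ‖z‖ ^ j * ‖L t‖)
    (fun j => by
      have := (integrable_mul_exp hL j).aestronglyMeasurable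
      exact (by simpa using this : AEStronglyMeasurable (fun t : ℝ => L t *
        Complex.exp (-(Complex.I * (j : ℂ) * t))) circ).const_mul _)
    (fun j => Eventually.of_forall fun t => by
      have := norm_exp_neg_I_int j t
      simp only [Int.cast_natCast] at this
      rw [norm_mul, norm_mul, norm_mul, this, mul_one, norm_pow]
      gcongr
      exact norm_herglotzCoeff_le j)
    (Eventually.of_forall fun t => ((summable_geometric_of_lt_one (norm_nonneg _) hz).mul_left 2).mul_right _)
    (by
      simp_rw [tsum_mul_right]
      exact hL.norm.const_mul _)
    (Eventually.of_forall fun t => by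
      have hk := (hasSum_herglotzKernel (Complex.norm_exp_I_mul_ofReal t) hz).mul_right (L t)
      refine Eq.mpr (congrArg (HasSum · _) (funext fun j => ?_)) hk
      rw [mul_pow, ← Complex.exp_neg, exp_neg_I_nat]
      ring)
  have h2 := h.mul_left (1 / (2 * (Real.pi : ℂ)))
  refine Eq.mpr (congrArg (HasSum · _) (funext fun j => ?_)) h2
  rw [integral_const_mul]
  simp only [fc, Int.cast_natCast]
  ring

/-- These are the coefficients found in `fc_log_norm_one_sub`, which makes this logarithm the
analytic completion of log |1 - e^{-iμt}|. -/
lemma hasSum_log_one_sub_pow {μ : ℕ} (hμ : 1 ≤ μ) {z : ℂ} (hz : ‖z‖ < 1) :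
    HasSum (fun k : ℕ => -(if μ ∣ k then (μ : ℂ) / k else 0) * z ^ k) (Complex.log (1 - z ^ μ)) := by
  have hzμ : ‖z ^ μ‖ < 1 := by
    rw [norm_pow]; exact pow_lt_one₀ (norm_nonneg _) hz (by omega)
  have h := (Complex.hasSum_taylorSeries_neg_log hzμ).neg
  rw [neg_neg] at h
  have hinj : Function.Injective fun m : ℕ => μ * m := fun a b hab =>
    Nat.eq_of_mul_eq_mul_left (by omega) hab
  refine (hinj.hasSum_iff ?_).1 ?_
  · intro k hk
    rw [if_neg]; · simp
    rintro ⟨m, rfl⟩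
    exact hk ⟨m, rfl⟩
  · refine Eq.mpr (congrArg (HasSum · _) (funext fun m => ?_)) h
    have hμ0 : (μ : ℂ) ≠ 0 := by exact_mod_cast (show μ ≠ 0 by omega)
    simp only [Function.comp_apply, dvd_mul_right, if_true, Nat.cast_mul, pow_mul]
    rcases Nat.eq_zero_or_pos m with hm | hm
    · simp [hm]
    · have : (m : ℂ) ≠ 0 := by exact_mod_cast hm.ne'
      field_simp

/-- `1 + z + ⋯ + z^{μ-1}`. -/
noncomputable def geomPoly (μ : ℕ) (z : ℂ) : ℂ := ∑ i ∈ Finset.range μ, z ^ i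

/-- The invertible factor of `wFun`. -/
noncomputable def regFactor (n : ℕ) (z : ℂ) : ℂ := Complex.exp (n * logSincSeries z)

lemma integrable_log_weight {n μ : ℕ} (hμ : 1 ≤ μ) :
    Integrable (fun t => (Real.log (weight n μ t) : ℂ)) circ := by
  have hi : ∀ ν : ℕ, Integrable (fun t : ℝ =>
      ((2 * Real.log ‖1 - Complex.exp (-(Complex.I * ν * t))‖ : ℝ) : ℂ)) circ := fun ν => by
    simpa using (integrable_log_norm_one_sub ν).const_mul 2
  have hl : Integrable (fun t : ℝ => (logSinc t : ℂ)) circ := integrable_circ_of_continuousOn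
    (Complex.continuous_ofReal.comp_continuousOn continuousOn_logSinc)
  refine ((((hi μ).sub (hi 1)).add hl).const_mul (n : ℂ)).congr ?_
  filter_upwards [ae_log_weight (n := n) hμ] with t ht
  rw [ht]
  simp

/-- Both exponents have the same Taylor coefficients. On exponentiating, (1 - z^μ)/(1 - z) becomes
`geomPoly`; all zeros are in this polynomial, and `regFactor` is invertible in the Wiener algebra.
-/
lemma wFun_eq {n μ : ℕ} (hμ : 1 ≤ μ) {z : ℂ} (hz : ‖z‖ < 1) :
    wFun n μ z = geomPoly μ z ^ n * regFactor n z := by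
  have h1 := hasSum_herglotz (integrable_log_weight (n := n) hμ) hz
  have hq : HasSum (fun j => logSincCoeff j * z ^ j) (logSincSeries z) :=
    (summable_mul_pow summable_logSincCoeff hz.le).hasSum
  have h2 := (((hasSum_log_one_sub_pow hμ hz).sub (hasSum_log_one_sub_pow le_rfl hz)).add hq).mul_left
    (2 * (n : ℂ))
  have e : 1 / (2 * (Real.pi : ℂ)) * (∫ t, (Complex.exp (Complex.I * t) + z) /
        (Complex.exp (Complex.I * t) - z) * ((Real.log (weight n μ t) : ℝ) : ℂ) ∂circ) =
      2 * n * (Complex.log (1 - z ^ μ) - Complex.log (1 - z ^ 1) + logSincSeries z) := by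
    refine h1.unique ?_
    refine Eq.mpr (congrArg (HasSum · _) (funext fun j => ?_)) h2
    rw [fc_log_weight hμ, logSincCoeff]
    by_cases hj : j = 0
    · simp [hj]; ring
    · by_cases hd : μ ∣ j
      · simp [hj, hd]; ring
      · simp [hj, hd]; ring
  have hne : ∀ ν : ℕ, 1 ≤ ν → 1 - z ^ ν ≠ 0 := fun ν hν h => by
    have : ‖z ^ ν‖ = 1 := by rw [← sub_eq_zero.1 h, norm_one]
    rw [norm_pow] at this
    exact absurd this (pow_lt_one₀ (norm_nonneg _) hz (by omega)).ne
  have hg : geomPoly μ z = (1 - z ^ μ) / (1 - z ^ 1) := by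
    rw [eq_div_iff (hne 1 le_rfl), pow_one]
    exact geom_sum_mul_neg z μ
  have e2 : wFun n μ z = Complex.exp (n * (Complex.log (1 - z ^ μ) - Complex.log (1 - z ^ 1) +
      logSincSeries z)) := by
    rw [wFun]
    congr 1
    -- The exponent of `wFun` carries 1/(4π), half the Herglotz normalization, because the weight is
    -- a squared modulus.
    linear_combination (1 / 2) * e
  rw [e2, regFactor, mul_add, Complex.exp_add, Complex.exp_nat_mul, Complex.exp_sub,
    Complex.exp_log (hne μ hμ), Complex.exp_log (hne 1 le_rfl), hg]

lemma isWiener_logSincSeries : IsWiener logSincSeries := isWiener_tsum summable_logSincCoeff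

lemma isWiener_regFactor (n : ℕ) : IsWiener (regFactor n) :=
  ((isWiener_const n).mul isWiener_logSincSeries).exp

lemma isWiener_regFactor_inv (n : ℕ) : IsWiener fun z => (regFactor n z)⁻¹ := by
  refine (((isWiener_const (-n)).mul isWiener_logSincSeries).exp).congr fun z _ => ?_
  rw [regFactor, ← Complex.exp_neg, neg_mul]

lemma regFactor_ne_zero (n : ℕ) (z : ℂ) : regFactor n z ≠ 0 := Complex.exp_ne_zero _

lemma isWiener_geomPoly (μ : ℕ) : IsWiener (geomPoly μ) :=
  IsWiener.finset_sum _ fun i _ => isWiener_id.pow i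

/-- The product formula holds in the open disc and determines the Taylor coefficients; their
absolute summability carries the expansion to the circle. -/
lemma summable_wCoeff_and_hasSum (n : ℕ) {μ : ℕ} (hμ : 1 ≤ μ) :
    (Summable fun k => ‖wCoeff n μ k‖) ∧ ∀ z : ℂ, ‖z‖ ≤ 1 →
      HasSum (fun k => wCoeff n μ k * z ^ k) (geomPoly μ z ^ n * regFactor n z) := by
  obtain ⟨c, hc, h⟩ := ((isWiener_geomPoly μ).pow n).mul (isWiener_regFactor n)
  have e : wCoeff n μ = c := funext fun k => taylorCoeff_of_hasSum hc
    (fun z hz => by rw [wFun_eq hμ hz]; exact h z hz.le) k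
  rw [e]
  exact ⟨hc, h⟩

lemma summable_wCoeff (n : ℕ) {μ : ℕ} (hμ : 1 ≤ μ) : Summable fun k => ‖wCoeff n μ k‖ :=
  (summable_wCoeff_and_hasSum n hμ).1

/-! ### Boundary values of the outer factor and the increment factor -/

lemma minusSeries_eq (x : ℕ → ℂ) (t : ℝ) :
    minusSeries x t = ∑' k, x k * Complex.exp (-(Complex.I * t)) ^ k := by
  simp_rw [exp_neg_I_nat]; rfl

lemma minusSeries_wCoeff (n : ℕ) {μ : ℕ} (hμ : 1 ≤ μ) (t : ℝ) :
    minusSeries (wCoeff n μ) t = geomPoly μ (Complex.exp (-(Complex.I * t))) ^ n *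
      regFactor n (Complex.exp (-(Complex.I * t))) := by
  rw [minusSeries_eq]
  exact ((summable_wCoeff_and_hasSum n hμ).2 _ (norm_exp_neg_I t).le).tsum_eq

lemma geomPoly_exp_mul (μ : ℕ) (t : ℝ) :
    geomPoly μ (Complex.exp (-(Complex.I * t))) * (1 - Complex.exp (-(Complex.I * t))) =
      1 - Complex.exp (-(Complex.I * μ * t)) := by
  rw [← exp_neg_I_nat]
  exact geom_sum_mul_neg _ μ

lemma ae_incrFactor_ne_zero (n : ℕ) {μ : ℕ} (hμ : 1 ≤ μ) : ∀ᵐ t : ℝ ∂circ, incrFactor n μ t ≠ 0 := by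
  filter_upwards [ae_one_sub_exp_ne_zero hμ,
    ae_circ_of_countable (p := fun t : ℝ => t ≠ 0) (by simp)] with t h1 h2
  refine div_ne_zero (pow_ne_zero _ h1) (pow_ne_zero _ (mul_ne_zero Complex.I_ne_zero ?_))
  exact_mod_cast h2

/-- On the circle w_μ has the modulus of u, because the real part of `logSincSeries` restores |1 -
e^{-it}|/|t|. In every squared error u may thus be traded for a power series in e^{-iλ}. -/
lemma ae_norm_incrFactor (n : ℕ) {μ : ℕ} (hμ : 1 ≤ μ) :
    ∀ᵐ t : ℝ ∂circ, ‖incrFactor n μ t‖ = ‖minusSeries (wCoeff n μ) t‖ := by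
  filter_upwards [ae_circ_mem, ae_one_sub_exp_ne_zero le_rfl,
    ae_circ_of_countable (p := fun t : ℝ => t ≠ 0) (by simp)] with t ht h1 h0
  have h1' : 1 - Complex.exp (-(Complex.I * t)) ≠ 0 := by simpa using h1
  have ht' := Set.Ioc_subset_Icc_self ht
  have hE : ‖regFactor 1 (Complex.exp (-(Complex.I * t)))‖ =
      ‖1 - Complex.exp (-(Complex.I * t))‖ / |t| := by
    rw [regFactor, Nat.cast_one, one_mul, Complex.norm_exp]
    have h2 : (logSincSeries (Complex.exp (-(Complex.I * t)))).re =
        Real.log ‖1 - Complex.exp (-(Complex.I * t))‖ - Real.log |t| := by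
      have := two_mul_re_logSincSeries ht'
      rw [logSinc_eq h0 ht'] at this
      linarith
    rw [h2, Real.exp_sub, Real.exp_log (norm_pos_iff.2 h1'), Real.exp_log (abs_pos.2 h0)]
  have hEn : regFactor n (Complex.exp (-(Complex.I * t))) =
      regFactor 1 (Complex.exp (-(Complex.I * t))) ^ n := by
    rw [regFactor, regFactor, ← Complex.exp_nat_mul, Nat.cast_one, one_mul]
  rw [minusSeries_wCoeff n hμ, hEn, ← mul_pow, incrFactor, ← div_pow, norm_pow, norm_pow]
  congr 1
  rw [norm_mul, hE, norm_div, norm_mul, Complex.norm_I, one_mul, Complex.norm_real, Real.norm_eq_abs,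
    ← mul_div_assoc, ← norm_mul, geomPoly_exp_mul]

lemma norm_incrFactor_le (n μ : ℕ) (t : ℝ) : ‖incrFactor n μ t‖ ≤ (μ : ℝ) ^ n := by
  rw [incrFactor, ← div_pow, norm_pow]
  refine pow_le_pow_left₀ (norm_nonneg _) ?_ n
  by_cases h : t = 0
  · simp [h]
  · rw [norm_div, norm_mul, Complex.norm_I, one_mul, Complex.norm_real, Real.norm_eq_abs,
      div_le_iff₀ (abs_pos.2 h)]
    have := Real.norm_exp_I_mul_ofReal_sub_one_le (x := -(μ * t))
    rw [norm_sub_rev]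
    have e : Complex.I * ((-(μ * t) : ℝ) : ℂ) = -(Complex.I * μ * t) := by push_cast; ring
    rwa [e, norm_neg, norm_mul, Real.norm_natCast, Real.norm_eq_abs] at this

/-! ## Hankel operators and products of Fourier series -/

lemma hasSum_conditional_iff {f : ℕ → ℂ} {a : ℂ} :
    HasSum f a (SummationFilter.conditional ℕ) ↔
      Tendsto (fun N => ∑ m ∈ Finset.range N, f m) atTop (𝓝 a) := by
  rw [HasSum, SummationFilter.conditional_filter_eq_map_range, tendsto_map'_iff]
  rfl

/-- `D^μ A` is the Hankel matrix of `b_μ`. -/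
lemma matDA_eq {n μ : ℕ} {a : ℕ → ℂ}
    (ha : ∀ k, Summable (fun m => matD n μ k m * a m) (SummationFilter.conditional ℕ)) (k j : ℕ) :
    matDA n μ a k j = bCoeff n μ a (k + j) := by
  have h := hasSum_conditional_iff.1 (ha (k + j)).hasSum
  have h2 : HasSum (fun l => matD n μ k l * a (l + j)) (bCoeff n μ a (k + j))
      (SummationFilter.conditional ℕ) := by
    rw [hasSum_conditional_iff]
    refine (h.comp (tendsto_add_atTop_nat j)).congr fun N => ?_
    -- Substituting m = l + j: the j initial terms lie below the diagonal of D^μ, and the rest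
    -- depends on m - (k + j) = l - k only.
    rw [Function.comp_apply, add_comm N j, Finset.sum_range_add]
    rw [Finset.sum_eq_zero fun m hm => ?_, zero_add]
    · refine Finset.sum_congr rfl fun l _ => ?_
      have e1 : k + j ≤ j + l ↔ k ≤ l := by omega
      have e2 : j + l - (k + j) = l - k := by omega
      simp only [matD, e1, e2, add_comm l j]
    · rw [matD, if_neg (by have := Finset.mem_range.1 hm; omega), zero_mul]
  exact h2.tsum_eq

/-- The Hankel operator with symbol sequence `b`. -/
noncomputable def hankel (b x : ℕ → ℂ) (k : ℕ) : ℂ := ∑' j, b (k + j) * x j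

lemma opDA_eq_hankel {n μ : ℕ} {a : ℕ → ℂ}
    (ha : ∀ k, Summable (fun m => matD n μ k m * a m) (SummationFilter.conditional ℕ))
    (x : ℕ → ℂ) : opDA n μ a x = hankel (bCoeff n μ a) x := by
  funext k
  simp only [opDA, hankel, matDA_eq ha]

lemma summable_norm_prod {b c : ℕ → ℂ} (hb : Summable fun k => ‖b k‖)
    (hc : Summable fun k => ‖c k‖) : Summable fun p : ℕ × ℕ => ‖b p.1 * c p.2‖ := by
  simpa [norm_mul] using Summable.mul_of_nonneg hb hc (fun _ => norm_nonneg _) fun _ => norm_nonneg _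

lemma injective_lower : Function.Injective fun p : ℕ × ℕ => (p.1 + p.2, p.2) := by
  rintro ⟨a, b⟩ ⟨c, d⟩ h
  simp only [Prod.mk.injEq] at h ⊢
  omega

lemma injective_upper : Function.Injective fun p : ℕ × ℕ => (p.2, p.2 + p.1 + 1) := by
  rintro ⟨a, b⟩ ⟨c, d⟩ h
  simp only [Prod.mk.injEq] at h ⊢
  omega

lemma summable_hankel {b c : ℕ → ℂ} (hb : Summable fun k => ‖b k‖)
    (hc : Summable fun k => ‖c k‖) : Summable fun k => ‖hankel b c k‖ := by
  have h := (summable_norm_prod hb hc).comp_injective injective_lower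
  refine Summable.of_nonneg_of_le (fun _ => norm_nonneg _) (fun k => ?_) h.prod
  exact norm_tsum_le_tsum_norm (h.prod_factor k)

/-- The coefficients with negative index of the product of `∑ b(k) e^{ikt}` and
`∑ c(k) e^{-ikt}`. -/
noncomputable def coHankel (b c : ℕ → ℂ) (k : ℕ) : ℂ := ∑' j, b j * c (j + k + 1)

lemma summable_coHankel {b c : ℕ → ℂ} (hb : Summable fun k => ‖b k‖)
    (hc : Summable fun k => ‖c k‖) : Summable fun k => ‖coHankel b c k‖ := by
  have h := (summable_norm_prod hb hc).comp_injective injective_upper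
  refine Summable.of_nonneg_of_le (fun _ => norm_nonneg _) (fun k => ?_) h.prod
  exact norm_tsum_le_tsum_norm (h.prod_factor k)

/-- Splitting of `ℕ × ℕ` along the diagonal. -/
lemma tsum_prod_split {F : ℕ × ℕ → ℂ} (hF : Summable F) :
    ∑' p, F p = (∑' p : ℕ × ℕ, F (p.1 + p.2, p.2)) + ∑' p : ℕ × ℕ, F (p.2, p.2 + p.1 + 1) := by
  have h := hF.tsum_subtype_add_tsum_subtype_compl (Set.range fun p : ℕ × ℕ => (p.1 + p.2, p.2))
  rw [← h]
  congr 1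
  · exact tsum_range F injective_lower
  · rw [← tsum_range (g := fun p : ℕ × ℕ => (p.2, p.2 + p.1 + 1)) F injective_upper]
    congr 2
    all_goals
      have : (Set.range fun p : ℕ × ℕ => (p.1 + p.2, p.2))ᶜ =
          Set.range fun p : ℕ × ℕ => (p.2, p.2 + p.1 + 1) := by
        ext ⟨x, y⟩
        simp only [Set.mem_compl_iff, Set.mem_range, Prod.mk.injEq, Prod.exists, not_exists]
        constructor
        · intro h
          have := h (x - y) y
          exact ⟨y - x - 1, x, by omega⟩
        · rintro ⟨a, b, h1, h2⟩ c d
          omega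
      rw [this]

lemma summable_plusSeries {x : ℕ → ℂ} (hx : Summable fun k => ‖x k‖) (t : ℝ) :
    Summable fun k : ℕ => ‖x k * Complex.exp (Complex.I * k * t)‖ := by
  refine hx.congr fun k => ?_
  have := norm_exp_I_int k t
  simp only [Int.cast_natCast] at this
  rw [norm_mul, this, mul_one]

lemma hasSum_plusSeries {x : ℕ → ℂ} (hx : Summable fun k => ‖x k‖) (t : ℝ) :
    HasSum (fun k : ℕ => x k * Complex.exp (Complex.I * k * t)) (plusSeries x t) :=
  (summable_plusSeries hx t).of_norm.hasSum

lemma summable_minusSeries {x : ℕ → ℂ} (hx : Summable fun k => ‖x k‖) (t : ℝ) :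
    Summable fun k : ℕ => ‖x k * Complex.exp (-(Complex.I * k * t))‖ := by
  refine hx.congr fun k => ?_
  have := norm_exp_neg_I_int k t
  simp only [Int.cast_natCast] at this
  rw [norm_mul, this, mul_one]

lemma hasSum_minusSeries {x : ℕ → ℂ} (hx : Summable fun k => ‖x k‖) (t : ℝ) :
    HasSum (fun k : ℕ => x k * Complex.exp (-(Complex.I * k * t))) (minusSeries x t) :=
  (summable_minusSeries hx t).of_norm.hasSum

lemma continuous_plusSeries {x : ℕ → ℂ} (hx : Summable fun k => ‖x k‖) :
    Continuous (plusSeries x) := by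
  refine continuous_tsum (fun k => by fun_prop) hx fun k t => ?_
  have := norm_exp_I_int k t
  simp only [Int.cast_natCast] at this
  rw [norm_mul, this, mul_one]

lemma continuous_minusSeries {x : ℕ → ℂ} (hx : Summable fun k => ‖x k‖) :
    Continuous (minusSeries x) := by
  refine continuous_tsum (fun k => by fun_prop) hx fun k t => ?_
  have := norm_exp_neg_I_int k t
  simp only [Int.cast_natCast] at this
  rw [norm_mul, this, mul_one]

lemma norm_plusSeries_le {x : ℕ → ℂ} (hx : Summable fun k => ‖x k‖) (t : ℝ) :
    ‖plusSeries x t‖ ≤ ∑' k, ‖x k‖ := by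
  refine (norm_tsum_le_tsum_norm (summable_plusSeries hx t)).trans (le_of_eq (tsum_congr fun k => ?_))
  have := norm_exp_I_int k t
  simp only [Int.cast_natCast] at this
  rw [norm_mul, this, mul_one]

/-- The terms of the double series are grouped by the sign of the frequency: the pairs (k + j, j)
give frequency k, the pairs (j, j + k + 1) give -(k + 1). The nonnegative part is the Hankel
operator, which is how D^μ A enters the estimation problem. -/
lemma plusSeries_mul_minusSeries {b c : ℕ → ℂ} (hb : Summable fun k => ‖b k‖)
    (hc : Summable fun k => ‖c k‖) (t : ℝ) :
    plusSeries b t * minusSeries c t = plusSeries (hankel b c) t +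
      Complex.exp (-(Complex.I * t)) * minusSeries (coHankel b c) t := by
  have h1 := summable_plusSeries hb t
  have h2 := summable_minusSeries hc t
  set F : ℕ × ℕ → ℂ := fun p => (b p.1 * Complex.exp (Complex.I * p.1 * t)) *
    (c p.2 * Complex.exp (-(Complex.I * p.2 * t)))
  have hF : Summable F := (summable_norm_prod h1 h2).of_norm
  have hFl : Summable fun p : ℕ × ℕ => F (p.1 + p.2, p.2) := hF.comp_injective injective_lower
  have hFu : Summable fun p : ℕ × ℕ => F (p.2, p.2 + p.1 + 1) := hF.comp_injective injective_upper
  rw [plusSeries, minusSeries, tsum_mul_tsum_of_summable_norm h1 h2]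
  change ∑' p, F p = _
  rw [tsum_prod_split hF, hFl.tsum_prod, hFu.tsum_prod]
  congr 1
  · refine tsum_congr fun k => ?_
    rw [hankel, ← tsum_mul_right]
    refine tsum_congr fun j => ?_
    have : Complex.exp (Complex.I * k * t) = Complex.exp (Complex.I * (k + j : ℕ) * t) *
        Complex.exp (-(Complex.I * j * t)) := by
      rw [← Complex.exp_add]; push_cast; ring_nf
    rw [this]
    simp only [F]
    ring
  · rw [minusSeries, ← tsum_mul_left]
    refine tsum_congr fun k => ?_
    rw [coHankel, ← tsum_mul_right, ← tsum_mul_left]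
    refine tsum_congr fun j => ?_
    have : Complex.exp (-(Complex.I * t)) * Complex.exp (-(Complex.I * k * t)) =
        Complex.exp (Complex.I * j * t) * Complex.exp (-(Complex.I * (j + k + 1 : ℕ) * t)) := by
      rw [← Complex.exp_add, ← Complex.exp_add]; push_cast; ring_nf
    linear_combination (b j * c (j + k + 1)) * this.symm

lemma opW_eq (n μ : ℕ) (x : ℕ → ℂ) (k : ℕ) :
    opW n μ x k = ∑ kl ∈ Finset.HasAntidiagonal.antidiagonal k, wCoeff n μ kl.1 * x kl.2 := by
  rw [opW, Finset.Nat.sum_antidiagonal_eq_sum_range_succ (f := fun i j => wCoeff n μ i * x j),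
    ← Finset.sum_range_reflect]
  refine Finset.sum_congr rfl fun j hj => ?_
  have := Finset.mem_range.1 hj
  have e1 : k - (k + 1 - 1 - j) = j := by omega
  have e2 : k + 1 - 1 - j = k - j := by omega
  rw [e1, e2]

lemma summable_opW (n : ℕ) {μ : ℕ} (hμ : 1 ≤ μ) {x : ℕ → ℂ} (hx : Summable fun k => ‖x k‖) :
    Summable fun k => ‖opW n μ x k‖ := by
  simp_rw [opW_eq]
  exact summable_norm_sum_mul_antidiagonal_of_summable_norm (summable_wCoeff n hμ) hx

lemma minusSeries_opW (n : ℕ) {μ : ℕ} (hμ : 1 ≤ μ) {x : ℕ → ℂ} (hx : Summable fun k => ‖x k‖)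
    (t : ℝ) : minusSeries (opW n μ x) t = minusSeries (wCoeff n μ) t * minusSeries x t := by
  simp_rw [minusSeries_eq]
  have hz := (norm_exp_neg_I t).le
  have hw := summable_wCoeff n hμ
  have h := (hasSum_cauchyProduct hw hx hz (summable_mul_pow hw hz).hasSum
    (summable_mul_pow hx hz).hasSum).tsum_eq
  rw [← h]
  exact tsum_congr fun k => by rw [opW_eq]

/-! ### Fourier coefficients of series -/

lemma fc_plusSeries {x : ℕ → ℂ} (hx : Summable fun k => ‖x k‖) (k : ℕ) :
    fc (plusSeries x) k = x k := by
  have h := hasSum_fc_exp hx (fun j => (j : ℤ))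
    (Eventually.of_forall fun t => by simpa using hasSum_plusSeries hx t) k
  refine h.unique ?_
  convert hasSum_single k fun j hj => ?_ using 1
  · simp
  · exact if_neg fun h => hj (by exact_mod_cast h)

lemma fc_plusSeries_neg {x : ℕ → ℂ} (hx : Summable fun k => ‖x k‖) {k : ℤ} (hk : k < 0) :
    fc (plusSeries x) k = 0 := by
  have h := hasSum_fc_exp hx (fun j => (j : ℤ))
    (Eventually.of_forall fun t => by simpa using hasSum_plusSeries hx t) k
  refine h.unique ?_
  refine Eq.mpr (congrArg (HasSum · _) (funext fun j => ?_)) hasSum_zero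
  exact if_neg (by omega)

lemma fc_exp_mul_minusSeries {x : ℕ → ℂ} (hx : Summable fun k => ‖x k‖) {m k : ℤ} (hk : m < k) :
    fc (fun t => Complex.exp (Complex.I * m * t) * minusSeries x t) k = 0 := by
  have h := hasSum_fc_exp hx (fun j => m - (j : ℤ)) (G := fun t =>
    Complex.exp (Complex.I * m * t) * minusSeries x t) (Eventually.of_forall fun t => by
      refine Eq.mpr (congrArg (HasSum · _) (funext fun j => ?_))
        ((hasSum_minusSeries hx t).mul_left (Complex.exp (Complex.I * m * t)))
      have : Complex.exp (Complex.I * (m - j : ℤ) * t) = Complex.exp (Complex.I * m * t) *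
          Complex.exp (-(Complex.I * j * t)) := by
        rw [← Complex.exp_add]; push_cast; ring_nf
      rw [this]; ring) k
  refine h.unique ?_
  refine Eq.mpr (congrArg (HasSum · _) (funext fun j => ?_)) hasSum_zero
  exact if_neg (by omega)

lemma tsum_enorm_sq_fc {F : ℝ → ℂ} (hF : MemLp F 2 circ) :
    ∑' k : ℤ, ‖fc F k‖ₑ ^ 2 = ∫⁻ t, ‖F t‖ₑ ^ 2 * ENNReal.ofReal (1 / (2 * Real.pi)) ∂circ := by
  have h := hasSum_sq_fc hF
  have e : ∀ x : ℂ, ‖x‖ₑ ^ 2 = ENNReal.ofReal (‖x‖ ^ 2) := fun x => by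
    rw [ENNReal.ofReal_pow (norm_nonneg _), ofReal_norm]
  simp_rw [e]
  rw [← ENNReal.ofReal_tsum_of_nonneg (fun _ => by positivity) h.summable, h.tsum_eq,
    ENNReal.ofReal_mul (by positivity), ofReal_integral_eq_lintegral_ofReal
      hF.norm.integrable_sq (Eventually.of_forall fun _ => by positivity),
    lintegral_mul_const'' _ (hF.norm.integrable_sq.aestronglyMeasurable.aemeasurable.ennreal_ofReal),
    mul_comm]

/-- Bessel's inequality: the negative frequencies are dropped from Parseval's identity. -/
lemma sqNorm_fc_le {F : ℝ → ℂ} (hF : MemLp F 2 circ) :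
    sqNorm (fun k => fc F k) ≤ ∫⁻ t, ‖F t‖ₑ ^ 2 * ENNReal.ofReal (1 / (2 * Real.pi)) ∂circ := by
  rw [← tsum_enorm_sq_fc hF, sqNorm]
  exact ENNReal.tsum_comp_le_tsum_of_injective (f := fun k : ℕ => (k : ℤ)) Nat.cast_injective
    fun k : ℤ => ‖fc F k‖ₑ ^ 2

lemma memLp_plusSeries {x : ℕ → ℂ} (hx : Summable fun k => ‖x k‖) (p : ℝ≥0∞) :
    MemLp (plusSeries x) p circ :=
  memLp_circ_of_continuousOn (continuous_plusSeries hx).continuousOn p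

lemma lintegral_plusSeries {x : ℕ → ℂ} (hx : Summable fun k => ‖x k‖) :
    ∫⁻ t, ‖plusSeries x t‖ₑ ^ 2 * ENNReal.ofReal (1 / (2 * Real.pi)) ∂circ = sqNorm x := by
  rw [← tsum_enorm_sq_fc (memLp_plusSeries hx 2), sqNorm]
  have h : Function.Injective fun k : ℕ => (k : ℤ) := Nat.cast_injective
  rw [← h.tsum_eq]
  · simp_rw [fc_plusSeries hx]
  · intro k hk
    by_contra hk'
    have hneg : k < 0 := by
      by_contra hk0
      exact hk' ⟨k.toNat, by simp only [Int.natCast_toNat_eq_self]; omega⟩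
    exact hk (by simp [fc_plusSeries_neg hx hneg])

/-! ## Shift invariant spaces -/

section ShiftSpaces

variable {ν : Measure ℝ}

lemma eLpNorm_two_sq {α : Type*} [MeasurableSpace α] (ν : Measure α) (F : α → ℂ) :
    eLpNorm F 2 ν ^ 2 = ∫⁻ t, ‖F t‖ₑ ^ 2 ∂ν := by
  have := eLpNorm_nnreal_pow_eq_lintegral (p := 2) (f := F) (μ := ν) two_ne_zero
  simpa using this

lemma tendsto_eLpNorm_of_bounded [IsFiniteMeasure ν] {F : ℕ → ℝ → ℂ} {G : ℝ → ℂ} {C : ℝ}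
    (hF : ∀ N, AEStronglyMeasurable (F N) ν) (hb : ∀ N, ∀ᵐ t ∂ν, ‖F N t‖ ≤ C)
    (hG : ∀ᵐ t ∂ν, Tendsto (fun N => F N t) atTop (𝓝 (G t))) :
    Tendsto (fun N => eLpNorm (fun t => F N t - G t) 2 ν) atTop (𝓝 0) := by
  have hGm : AEStronglyMeasurable G ν := aestronglyMeasurable_of_tendsto_ae atTop hF hG
  have hGb : ∀ᵐ t ∂ν, ‖G t‖ ≤ C := by
    filter_upwards [hG, ae_all_iff.2 hb] with t h1 h2
    exact le_of_tendsto' h1.norm h2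
  have key : Tendsto (fun N => ∫⁻ t, ‖F N t - G t‖ₑ ^ 2 ∂ν) atTop (𝓝 0) := by
    have h := tendsto_lintegral_of_dominated_convergence' (μ := ν)
      (F := fun N t => ‖F N t - G t‖ₑ ^ 2) (f := fun _ => 0) (fun _ => ENNReal.ofReal (2 * C) ^ 2)
      (fun N => ((hF N).sub hGm).enorm.pow_const 2) (fun N => ?_) ?_ ?_
    · simpa using h
    · filter_upwards [hb N, hGb] with t h1 h2
      gcongr
      rw [← ofReal_norm]
      refine ENNReal.ofReal_le_ofReal ((norm_sub_le _ _).trans ?_)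
      linarith
    · rw [lintegral_const]
      exact ENNReal.mul_ne_top (ENNReal.pow_ne_top ENNReal.ofReal_ne_top) (measure_ne_top _ _)
    · filter_upwards [hG] with t ht
      have : Tendsto (fun N => F N t - G t) atTop (𝓝 0) := by
        simpa using ht.sub_const (G t)
      have := ((ENNReal.continuous_pow 2).tendsto _).comp this.enorm
      simpa [Function.comp_def] using this
  have h2 := key.ennrpow_const (1 / 2 : ℝ)
  simp_rw [← eLpNorm_two_sq] at h2
  rw [ENNReal.zero_rpow_of_pos (by norm_num)] at h2
  refine h2.congr fun N => ?_
  rw [← ENNReal.rpow_natCast, ← ENNReal.rpow_mul]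
  norm_num

/-- The class of `F` in `L₂(ν)` belongs to `S`. -/
def LpMem (S : Submodule ℂ (Lp ℂ 2 ν)) (F : ℝ → ℂ) : Prop := ∃ h : MemLp F 2 ν, h.toLp F ∈ S

lemma LpMem.congr {S : Submodule ℂ (Lp ℂ 2 ν)} {F G : ℝ → ℂ} (h : LpMem S F) (e : F =ᵐ[ν] G) :
    LpMem S G := by
  obtain ⟨hF, hS⟩ := h
  refine ⟨hF.ae_eq e, ?_⟩
  rwa [← MemLp.toLp_congr hF (hF.ae_eq e) e]

lemma LpMem.const_mul {S : Submodule ℂ (Lp ℂ 2 ν)} {F : ℝ → ℂ} (h : LpMem S F) (c : ℂ) :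
    LpMem S fun t => c * F t := by
  obtain ⟨hF, hS⟩ := h
  exact ⟨hF.const_smul c, S.smul_mem c hS⟩

lemma LpMem.finset_sum {ι : Type*} {S : Submodule ℂ (Lp ℂ 2 ν)} {F : ι → ℝ → ℂ} (s : Finset ι)
    (h : ∀ i ∈ s, LpMem S (F i)) : LpMem S fun t => ∑ i ∈ s, F i t := by
  classical
  induction s using Finset.induction_on with
  | empty =>
    refine ⟨by simp, ?_⟩
    convert S.zero_mem
    simp only [Finset.sum_empty]
    exact MemLp.toLp_zero _
  | insert a s ha ih =>
    simp_rw [Finset.sum_insert ha]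
    obtain ⟨h1, h1'⟩ := h a (Finset.mem_insert_self _ _)
    obtain ⟨h2, h2'⟩ := ih fun i hi => h i (Finset.mem_insert_of_mem hi)
    exact ⟨h1.add h2, S.add_mem h1' h2'⟩

lemma LpMem.mono {S T : Submodule ℂ (Lp ℂ 2 ν)} {F : ℝ → ℂ} (h : LpMem S F) (hST : S ≤ T) :
    LpMem T F := by
  obtain ⟨hF, hS⟩ := h
  exact ⟨hF, hST hS⟩

lemma LpMem.of_tendsto [IsFiniteMeasure ν] {S : Submodule ℂ (Lp ℂ 2 ν)}
    (hS : IsClosed (S : Set (Lp ℂ 2 ν))) {F : ℕ → ℝ → ℂ} {G : ℝ → ℂ} {C : ℝ}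
    (hF : ∀ N, LpMem S (F N)) (hb : ∀ N, ∀ᵐ t ∂ν, ‖F N t‖ ≤ C)
    (hG : ∀ᵐ t ∂ν, Tendsto (fun N => F N t) atTop (𝓝 (G t))) : LpMem S G := by
  choose h1 h2 using hF
  have hGm : AEStronglyMeasurable G ν := aestronglyMeasurable_of_tendsto_ae atTop (fun N => (h1 N).1) hG
  have hGb : ∀ᵐ t ∂ν, ‖G t‖ ≤ C := by
    filter_upwards [hG, ae_all_iff.2 hb] with t h1 h2
    exact le_of_tendsto' h1.norm h2
  have hGL : MemLp G 2 ν := MemLp.of_bound hGm C hGb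
  refine ⟨hGL, hS.mem_of_tendsto (b := atTop) (f := fun N => (h1 N).toLp (F N)) ?_
    (Eventually.of_forall h2)⟩
  rw [Lp.tendsto_Lp_iff_tendsto_eLpNorm'' F h1 G hGL]
  exact tendsto_eLpNorm_of_bounded (fun N => (h1 N).1) hb hG

/-- The shifts `e^{ikt} g`, `k ≤ m`, as elements of `L₂(ν)`. -/
def shiftGen (ν : Measure ℝ) (g : ℝ → ℂ) (m : ℤ) : Set (Lp ℂ 2 ν) :=
  {x | ∃ k : ℤ, k ≤ m ∧ ∃ h : MemLp (fun t : ℝ => Complex.exp (Complex.I * k * t) * g t) 2 ν,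
    x = h.toLp}

/-- The closed span of the shifts `e^{ikt} g`, `k ≤ m`, in `L₂(ν)`. -/
noncomputable def shiftSpace (ν : Measure ℝ) (g : ℝ → ℂ) (m : ℤ) : Submodule ℂ (Lp ℂ 2 ν) :=
  (Submodule.span ℂ (shiftGen ν g m)).topologicalClosure

lemma isClosed_shiftSpace (g : ℝ → ℂ) (m : ℤ) :
    IsClosed (shiftSpace ν g m : Set (Lp ℂ 2 ν)) :=
  Submodule.isClosed_topologicalClosure _

lemma shiftSpace_le {g : ℝ → ℂ} {m : ℤ} {S : Submodule ℂ (Lp ℂ 2 ν)}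
    (hS : IsClosed (S : Set (Lp ℂ 2 ν)))
    (h : ∀ k : ℤ, k ≤ m → LpMem S fun t : ℝ => Complex.exp (Complex.I * k * t) * g t) :
    shiftSpace ν g m ≤ S := by
  refine Submodule.topologicalClosure_minimal _ (Submodule.span_le.2 ?_) hS
  rintro x ⟨k, hk, h', rfl⟩
  exact (h k hk).2

lemma lpMem_shift {g : ℝ → ℂ} {k m : ℤ} (hk : k ≤ m)
    (h : MemLp (fun t : ℝ => Complex.exp (Complex.I * k * t) * g t) 2 ν) :
    LpMem (shiftSpace ν g m) fun t : ℝ => Complex.exp (Complex.I * k * t) * g t :=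
  ⟨h, Submodule.le_topologicalClosure _ (Submodule.subset_span ⟨k, hk, h, rfl⟩)⟩

lemma memLp_shift [IsFiniteMeasure ν] {g : ℝ → ℂ} (hg : AEStronglyMeasurable g ν) {C : ℝ}
    (hC : ∀ᵐ t ∂ν, ‖g t‖ ≤ C) (k : ℤ) :
    MemLp (fun t : ℝ => Complex.exp (Complex.I * k * t) * g t) 2 ν := by
  refine MemLp.of_bound (AEStronglyMeasurable.mul (by fun_prop) hg) C ?_
  filter_upwards [hC] with t ht
  rwa [norm_mul, norm_exp_I_int, one_mul]

lemma IsWiener.continuous_exp {q : ℂ → ℂ} (hq : IsWiener q) :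
    Continuous fun t : ℝ => q (Complex.exp (-(Complex.I * t))) := by
  obtain ⟨c, hc, h⟩ := hq
  convert continuous_minusSeries hc using 1
  funext t
  rw [minusSeries_eq]
  exact (h _ (norm_exp_neg_I t).le).tsum_eq.symm

/-- A power series in e^{-it} only lowers frequencies. Its partial sums are bounded by the ℓ¹-norm
of the coefficients, so they converge in L₂(ν) for every finite ν, whatever the density. -/
lemma lpMem_shift_wiener [IsFiniteMeasure ν] {g : ℝ → ℂ} (hg : AEStronglyMeasurable g ν) {C : ℝ}
    (hC : ∀ᵐ t ∂ν, ‖g t‖ ≤ C) {q : ℂ → ℂ} (hq : IsWiener q) (m : ℤ) :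
    LpMem (shiftSpace ν g m) fun t : ℝ => Complex.exp (Complex.I * m * t) *
      (q (Complex.exp (-(Complex.I * t))) * g t) := by
  obtain ⟨c, hc, h⟩ := hq
  refine LpMem.of_tendsto (isClosed_shiftSpace g m) (C := (∑' k, ‖c k‖) * C)
    (F := fun N t => ∑ k ∈ Finset.range N, c k *
      (Complex.exp (Complex.I * (m - k : ℤ) * t) * g t)) (fun N => ?_) (fun N => ?_) ?_
  · refine LpMem.finset_sum _ fun k _ => LpMem.const_mul ?_ _
    exact lpMem_shift (by omega) (memLp_shift hg hC _)
  · filter_upwards [hC] with t ht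
    refine (norm_sum_le _ _).trans ?_
    calc ∑ k ∈ Finset.range N, ‖c k * (Complex.exp (Complex.I * (m - k : ℤ) * t) * g t)‖
        = (∑ k ∈ Finset.range N, ‖c k‖) * ‖g t‖ := by
          rw [Finset.sum_mul]
          refine Finset.sum_congr rfl fun k _ => ?_
          rw [norm_mul, norm_mul, norm_exp_I_int, one_mul]
      _ ≤ (∑' k, ‖c k‖) * C := by
          refine mul_le_mul (hc.sum_le_tsum _ fun _ _ => norm_nonneg _) ht (norm_nonneg _)
            (tsum_nonneg fun _ => norm_nonneg _)
  · refine Eventually.of_forall fun t => ?_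
    have h1 := ((h _ (norm_exp_neg_I t).le).mul_left (Complex.exp (Complex.I * m * t))).mul_right (g t)
    have h2 := h1.tendsto_sum_nat
    rw [mul_assoc (Complex.exp (Complex.I * m * t))] at h2
    refine h2.congr fun N => Finset.sum_congr rfl fun k _ => ?_
    have : Complex.exp (Complex.I * (m - k : ℤ) * t) = Complex.exp (Complex.I * m * t) *
        Complex.exp (-(Complex.I * t)) ^ k := by
      rw [exp_neg_I_nat, ← Complex.exp_add]; push_cast; ring_nf
    rw [this]; ring

/-! ### Pasts generated by increments of different steps -/

lemma aestronglyMeasurable_incrFactor (n μ : ℕ) : AEStronglyMeasurable (incrFactor n μ) ν := by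
  refine Measurable.aestronglyMeasurable ?_
  unfold incrFactor
  fun_prop

lemma isWiener_inv_one_sub_pow {ρ : ℝ} (h0 : 0 ≤ ρ) (h1 : ρ < 1) (μ : ℕ) :
    IsWiener fun z => (1 - ρ * z ^ μ)⁻¹ := by
  have hz : WienerBound (fun z => z) 1 := by
    refine ⟨fun k => if k = 1 then 1 else 0, ?_, ?_, fun z _ => ?_⟩
    · exact summable_of_ne_finset_zero (s := {1}) fun k hk => by simp at hk; simp [hk]
    · rw [tsum_eq_single 1 (fun k hk => by simp [hk])]; simp
    · convert hasSum_single 1 (fun k hk => ?_) using 1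
      · simp
      · simp [hk]
  refine isWiener_of_hasSum (g := fun j z => (ρ : ℂ) ^ j * (z ^ μ) ^ j)
    (fun j => (wienerBound_const ((ρ : ℂ) ^ j)).mul ((hz.pow μ).pow j)) ?_ fun z hz => ?_
  · simpa [abs_of_nonneg h0] using summable_geometric_of_lt_one h0 h1
  · simp_rw [← mul_pow]
    refine hasSum_geometric_of_norm_lt_one ?_
    rw [norm_mul, norm_pow, Complex.norm_real, Real.norm_of_nonneg h0]
    exact (mul_le_of_le_one_right h0 (pow_le_one₀ (norm_nonneg _) hz)).trans_lt h1

lemma norm_one_sub_le_two_mul {w : ℂ} (hw : ‖w‖ ≤ 1) {r : ℝ} (hr0 : 0 ≤ r) (hr : r < 1) :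
    ‖1 - w‖ ≤ 2 * ‖1 - r * w‖ := by
  have hrw : ‖(r : ℂ) * w‖ ≤ r := by
    rw [norm_mul, Complex.norm_real, Real.norm_of_nonneg hr0]
    exact mul_le_of_le_one_right hr0 hw
  have h3 : 1 - r ≤ ‖1 - r * w‖ := by
    have := norm_sub_norm_le 1 (r * w)
    rw [norm_one] at this
    linarith
  have e : 1 - w = (1 - r * w) - (1 - r : ℝ) * w := by push_cast; ring
  rw [e]
  refine (norm_sub_le _ _).trans ?_
  rw [norm_mul, Complex.norm_real, Real.norm_of_nonneg (by linarith)]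
  have : (1 - r) * ‖w‖ ≤ 1 - r := mul_le_of_le_one_right (by linarith) hw
  linarith

/-- The one step increment factor is in the space of every increment factor. -/
lemma lpMem_incrFactor_one [IsFiniteMeasure ν] (hν : ν ≪ circ) (n : ℕ) {μ : ℕ} (hμ : 1 ≤ μ) (m : ℤ) :
    LpMem (shiftSpace ν (incrFactor n μ) m) fun t : ℝ =>
      Complex.exp (Complex.I * m * t) * incrFactor n 1 t := by
  -- Dividing u_μ by `geomPoly`ⁿ is blocked by zeros on the circle. The multiplier ((1 - z)/(1 - ρ
  -- z^μ))ⁿ with ρ < 1 is in the Wiener algebra and tends to the reciprocal of `geomPoly`ⁿ as ρ → 1.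
  set ρ : ℕ → ℝ := fun N => (N : ℝ) / (N + 1) with hρ
  have hρ0 : ∀ N, 0 ≤ ρ N := fun N => by positivity
  have hρ1 : ∀ N, ρ N < 1 := fun N => by
    rw [hρ, div_lt_one (by positivity)]; linarith
  have hρt : Tendsto (fun N => (ρ N : ℂ)) atTop (𝓝 1) := by
    have h : Tendsto ρ atTop (𝓝 1) := tendsto_natCast_div_add_atTop 1
    exact_mod_cast (Complex.continuous_ofReal.tendsto 1).comp h
  have hq : ∀ N, IsWiener fun z => ((1 + (-1) * z) * (1 - ρ N * z ^ μ)⁻¹) ^ n := fun N =>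
    (((isWiener_const 1).add ((isWiener_const (-1)).mul isWiener_id)).mul
      (isWiener_inv_one_sub_pow (hρ0 N) (hρ1 N) μ)).pow n
  have e : ∀ (N : ℕ) (t : ℝ), 1 - Complex.exp (-(Complex.I * μ * t)) ≠ 0 →
      Complex.exp (Complex.I * m * t) * (((1 + (-1) * Complex.exp (-(Complex.I * t))) *
        (1 - ρ N * Complex.exp (-(Complex.I * t)) ^ μ)⁻¹) ^ n * incrFactor n μ t) =
      ((1 - Complex.exp (-(Complex.I * μ * t))) *
        (1 - ρ N * Complex.exp (-(Complex.I * μ * t)))⁻¹) ^ n *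
        (Complex.exp (Complex.I * m * t) * incrFactor n 1 t) := by
    intro N t _
    rw [exp_neg_I_nat, incrFactor, incrFactor, ← div_pow, ← div_pow, Nat.cast_one, mul_one]
    rw [← mul_pow, mul_left_comm, ← mul_pow]
    congr 2
    ring
  -- The bound 2ⁿ, uniform in ρ, comes from |1 - w| ≤ 2|1 - ρw|.
  refine LpMem.of_tendsto (isClosed_shiftSpace _ m) (C := 2 ^ n * ((1 : ℕ) : ℝ) ^ n)
    (fun N => lpMem_shift_wiener (aestronglyMeasurable_incrFactor n μ)
      (Eventually.of_forall (norm_incrFactor_le n μ)) (hq N) m) (fun N => ?_) ?_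
  · filter_upwards [hν.ae_le (ae_one_sub_exp_ne_zero hμ)] with t ht
    rw [e N t ht, norm_mul, norm_mul, norm_exp_I_int, one_mul, norm_pow]
    refine mul_le_mul (pow_le_pow_left₀ (norm_nonneg _) ?_ n) (norm_incrFactor_le n 1 t)
      (norm_nonneg _) (by positivity)
    have h2 := norm_one_sub_le_two_mul (norm_exp_nat_eq_one μ t).le (hρ0 N) (hρ1 N)
    have h3 : 0 < ‖1 - ρ N * Complex.exp (-(Complex.I * μ * t))‖ := by
      have := norm_pos_iff.2 ht
      linarith
    rw [norm_mul, norm_inv, ← div_eq_mul_inv, div_le_iff₀ h3]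
    exact h2
  · filter_upwards [hν.ae_le (ae_one_sub_exp_ne_zero hμ)] with t ht
    simp_rw [e _ t ht]
    have h1 : Tendsto (fun N => 1 - (ρ N : ℂ) * Complex.exp (-(Complex.I * μ * t))) atTop
        (𝓝 (1 - Complex.exp (-(Complex.I * μ * t)))) := by
      simpa using (hρt.mul_const (Complex.exp (-(Complex.I * μ * t)))).const_sub 1
    have h2 := (((h1.inv₀ ht).const_mul (1 - Complex.exp (-(Complex.I * μ * t)))).pow n).mul_const
      (Complex.exp (Complex.I * m * t) * incrFactor n 1 t)
    simpa [mul_inv_cancel₀ ht] using h2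

/-- Since ν is arbitrary among finite measures absolutely continuous to `circ`, this places one
function in the past of all spectral densities at once. -/
lemma lpMem_wiener_mul_incrFactor_one [IsFiniteMeasure ν] (hν : ν ≪ circ) (n : ℕ) {μ : ℕ}
    (hμ : 1 ≤ μ) (m : ℤ) {q : ℂ → ℂ} (hq : IsWiener q) :
    LpMem (shiftSpace ν (incrFactor n μ) m) fun t : ℝ => Complex.exp (Complex.I * m * t) *
      (q (Complex.exp (-(Complex.I * t))) * incrFactor n 1 t) := by
  refine (lpMem_shift_wiener (aestronglyMeasurable_incrFactor n 1)
    (Eventually.of_forall (norm_incrFactor_le n 1)) hq m).mono ?_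
  refine shiftSpace_le (isClosed_shiftSpace _ m) fun k hk => ?_
  refine (lpMem_incrFactor_one hν n hμ k).mono ?_
  refine Submodule.topologicalClosure_mono (Submodule.span_mono ?_)
  rintro x ⟨j, hj, h⟩
  exact ⟨j, hj.trans hk, h⟩

end ShiftSpaces

/-! ## Spectral densities and the optimal characteristic -/

lemma isFiniteMeasure_specMeasure {f : ℝ → ℝ} (hf : IsSpectralDensity f) :
    IsFiniteMeasure (specMeasure f) :=
  isFiniteMeasure_withDensity_ofReal (hf.1.div_const _).2

lemma specMeasure_ac (f : ℝ → ℝ) : specMeasure f ≪ circ := withDensity_absolutelyContinuous _ _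

lemma aemeasurable_density {f : ℝ → ℝ} (hf : IsSpectralDensity f) :
    AEMeasurable (fun t => ENNReal.ofReal (f t / (2 * Real.pi))) circ :=
  (hf.1.div_const _).1.aemeasurable.ennreal_ofReal

lemma lintegral_specMeasure {f : ℝ → ℝ} (hf : IsSpectralDensity f) (g : ℝ → ℝ≥0∞) :
    ∫⁻ t, g t ∂specMeasure f = ∫⁻ t, g t * ENNReal.ofReal (f t / (2 * Real.pi)) ∂circ := by
  rw [specMeasure, lintegral_withDensity_eq_lintegral_mul_non_measurable₀ _ (aemeasurable_density hf)
    (Eventually.of_forall fun _ => ENNReal.ofReal_lt_top)]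
  simp_rw [Pi.mul_apply, mul_comm]

lemma ac_specMeasure {f : ℝ → ℝ} (hf : IsSpectralDensity f) (h : ∀ᵐ t ∂circ, 0 < f t) :
    circ ≪ specMeasure f := by
  refine withDensity_absolutelyContinuous' (aemeasurable_density hf) ?_
  filter_upwards [h] with t ht
  have : 0 < f t / (2 * Real.pi) := by positivity
  simpa using this

lemma integral_specMeasure {f : ℝ → ℝ} (hf : IsSpectralDensity f) (g : ℝ → ℂ) :
    ∫ t, g t ∂specMeasure f = 1 / (2 * (Real.pi : ℂ)) * ∫ t, g t * (f t : ℂ) ∂circ := by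
  rw [specMeasure, integral_withDensity_eq_integral_toReal_smul₀ (aemeasurable_density hf)
    (Eventually.of_forall fun _ => ENNReal.ofReal_lt_top), ← integral_const_mul]
  refine integral_congr_ae ?_
  filter_upwards [hf.2] with t ht
  rw [ENNReal.toReal_ofReal (by positivity), Complex.real_smul]
  push_cast
  ring

/-! ### The past of the spectral representation -/

lemma exists_pastSpan {n μ : ℕ} {ν : Measure ℝ} [IsFiniteMeasure ν] {y : Lp ℂ 2 ν}
    (hy : y ∈ Submodule.span ℂ (shiftGen ν (incrFactor n μ) (-1))) :
    ∃ p ∈ pastSpan n μ, y =ᵐ[ν] p := by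
  induction hy using Submodule.span_induction with
  | mem x hx =>
    obtain ⟨k, hk, h, rfl⟩ := hx
    exact ⟨_, Submodule.subset_span ⟨k, hk, rfl⟩, h.coeFn_toLp⟩
  | zero => exact ⟨0, Submodule.zero_mem _, Lp.coeFn_zero _ _ _⟩
  | add x y _ _ hx hy =>
    obtain ⟨p, hp, h⟩ := hx
    obtain ⟨q, hq, h'⟩ := hy
    exact ⟨p + q, Submodule.add_mem _ hp hq, (Lp.coeFn_add x y).trans (h.add h')⟩
  | smul c x _ hx =>
    obtain ⟨p, hp, h⟩ := hx
    exact ⟨c • p, Submodule.smul_mem _ _ hp, (Lp.coeFn_smul c x).trans (h.const_smul c)⟩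

lemma memLp_incr_shift {ν : Measure ℝ} [IsFiniteMeasure ν] (n μ : ℕ) (k : ℤ) :
    MemLp (fun t : ℝ => Complex.exp (Complex.I * k * t) * incrFactor n μ t) 2 ν :=
  memLp_shift (aestronglyMeasurable_incrFactor n μ) (Eventually.of_forall (norm_incrFactor_le n μ)) k

lemma pastSpan_toLp {n μ : ℕ} {ν : Measure ℝ} [IsFiniteMeasure ν] {p : ℝ → ℂ}
    (hp : p ∈ pastSpan n μ) :
    ∃ h : MemLp p 2 ν, h.toLp p ∈ Submodule.span ℂ (shiftGen ν (incrFactor n μ) (-1)) := by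
  induction hp using Submodule.span_induction with
  | mem x hx =>
    obtain ⟨k, hk, rfl⟩ := hx
    exact ⟨memLp_incr_shift n μ k, Submodule.subset_span ⟨k, hk, memLp_incr_shift n μ k, rfl⟩⟩
  | zero => exact ⟨MemLp.zero, by rw [MemLp.toLp_zero]; exact Submodule.zero_mem _⟩
  | add x y _ _ hx hy =>
    obtain ⟨p, hp⟩ := hx
    obtain ⟨q, hq⟩ := hy
    exact ⟨p.add q, Submodule.add_mem _ hp hq⟩
  | smul c x _ hx =>
    obtain ⟨p, hp⟩ := hx
    exact ⟨p.const_smul c, Submodule.smul_mem _ c hp⟩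

/-- Turns approximation by functions of `pastSpan` into membership in a closed subspace of L₂, so
that orthogonality can be used. -/
lemma memPast_iff {n μ : ℕ} {f : ℝ → ℝ} (hf : IsSpectralDensity f) (g : ℝ → ℂ) :
    MemPast n μ f g ↔ LpMem (shiftSpace (specMeasure f) (incrFactor n μ) (-1)) g := by
  have := isFiniteMeasure_specMeasure hf
  constructor
  · rintro ⟨hg, h⟩
    refine ⟨hg, ?_⟩
    rw [shiftSpace, ← SetLike.mem_coe, Submodule.topologicalClosure_coe, EMetric.mem_closure_iff]
    intro δ hδ
    obtain ⟨p, hp, hpd⟩ := h δ hδ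
    obtain ⟨hpL, hpS⟩ := pastSpan_toLp (ν := specMeasure f) hp
    refine ⟨_, hpS, ?_⟩
    rw [Lp.edist_toLp_toLp]
    exact hpd
  · rintro ⟨hg, h⟩
    refine ⟨hg, fun δ hδ => ?_⟩
    rw [shiftSpace, ← SetLike.mem_coe, Submodule.topologicalClosure_coe, EMetric.mem_closure_iff] at h
    obtain ⟨y, hy, hd⟩ := h δ hδ
    obtain ⟨p, hp, hyp⟩ := exists_pastSpan hy
    refine ⟨p, hp, ?_⟩
    rw [Lp.edist_def] at hd
    refine lt_of_eq_of_lt (eLpNorm_congr_ae ?_) hd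
    filter_upwards [hg.coeFn_toLp, hyp] with t h1 h2
    simp [h1, h2]

lemma isAdmissible_congr {n μ : ℕ} {f : ℝ → ℝ} (hf : IsSpectralDensity f) {h h' : ℝ → ℂ}
    (e : h =ᵐ[circ] h') (hh : IsAdmissible n μ f h) : IsAdmissible n μ f h' := by
  rw [IsAdmissible, memPast_iff hf] at hh ⊢
  refine hh.congr ?_
  filter_upwards [(specMeasure_ac f).ae_le e] with t ht
  rw [ht]

lemma specError_congr {n μ : ℕ} {a : ℕ → ℂ} {f : ℝ → ℝ} {h h' : ℝ → ℂ} (e : h =ᵐ[circ] h') :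
    specError n μ a h f = specError n μ a h' f := by
  refine lintegral_congr_ae ?_
  filter_upwards [(specMeasure_ac f).ae_le e] with t ht
  rw [ht]

/-! ### Canonical factors -/

lemma IsCanonical.summable {φ : ℕ → ℂ} (hφ : IsCanonical φ) : Summable fun k => ‖φ k‖ := by
  obtain ⟨⟨R, hR, hs⟩, -⟩ := hφ
  refine Summable.of_nonneg_of_le (fun _ => norm_nonneg _) (fun k => ?_) hs
  exact le_mul_of_one_le_right (norm_nonneg _) (one_le_pow₀ hR.le)

lemma IsCanonical.minusSeries_ne_zero {φ : ℕ → ℂ} (hφ : IsCanonical φ) (t : ℝ) :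
    minusSeries φ t ≠ 0 := by
  rw [minusSeries_eq]
  exact hφ.2 _ (norm_exp_neg_I t).le

lemma densityOf_pos {φ : ℕ → ℂ} (hφ : IsCanonical φ) (t : ℝ) : 0 < densityOf φ t :=
  pow_pos (norm_pos_iff.2 (hφ.minusSeries_ne_zero t)) 2

lemma continuous_densityOf {φ : ℕ → ℂ} (hφ : Summable fun k => ‖φ k‖) :
    Continuous (densityOf φ) := (continuous_minusSeries hφ).norm.pow 2

lemma integrable_circ_real {F : ℝ → ℝ} (hF : Continuous F) : Integrable F circ := by
  have h := integrable_circ_of_continuousOn (F := fun t => (F t : ℂ))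
    (Complex.continuous_ofReal.comp hF).continuousOn
  exact h.re

lemma isSpectralDensity_densityOf {φ : ℕ → ℂ} (hφ : Summable fun k => ‖φ k‖) :
    IsSpectralDensity (densityOf φ) :=
  ⟨integrable_circ_real (continuous_densityOf hφ), Eventually.of_forall fun _ => sq_nonneg _⟩

lemma incrFactor_eq_geomPoly (n μ : ℕ) (t : ℝ) :
    incrFactor n μ t = geomPoly μ (Complex.exp (-(Complex.I * t))) ^ n * incrFactor n 1 t := by
  rw [incrFactor, incrFactor, ← geomPoly_exp_mul, mul_pow, mul_div_assoc, Nat.cast_one, mul_one]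

lemma conj_minusSeries (x : ℕ → ℂ) (t : ℝ) :
    conj (minusSeries x t) = plusSeries (fun k => conj (x k)) t := by
  rw [minusSeries, plusSeries, Complex.conj_tsum]
  refine tsum_congr fun k => ?_
  rw [map_mul, ← Complex.exp_conj]
  simp

lemma exists_plusSeries_mul {x y : ℕ → ℂ} (hx : Summable fun k => ‖x k‖)
    (hy : Summable fun k => ‖y k‖) :
    ∃ z : ℕ → ℂ, (Summable fun k => ‖z k‖) ∧ ∀ t, plusSeries x t * plusSeries y t = plusSeries z t := by
  refine ⟨_, summable_norm_sum_mul_antidiagonal_of_summable_norm hx hy, fun t => ?_⟩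
  have e : ∀ (w : ℕ → ℂ), plusSeries w t = ∑' k, w k * Complex.exp (Complex.I * t) ^ k := fun w => by
    refine tsum_congr fun k => ?_
    rw [← Complex.exp_nat_mul]; ring_nf
  have hz : ‖Complex.exp (Complex.I * t)‖ ≤ 1 := (Complex.norm_exp_I_mul_ofReal t).le
  rw [e, e, e]
  exact (hasSum_cauchyProduct hx hy hz (summable_mul_pow hx hz).hasSum
    (summable_mul_pow hy hz).hasSum).tsum_eq.symm

lemma sqNorm_conj (x : ℕ → ℂ) : sqNorm (fun k => conj (x k)) = sqNorm x := by
  simp [sqNorm]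

lemma lintegral_densityOf {φ : ℕ → ℂ} (hφ : Summable fun k => ‖φ k‖) :
    ENNReal.ofReal (1 / (2 * Real.pi) * ∫ t, densityOf φ t ∂circ) = sqNorm φ := by
  have hc : Summable fun k => ‖conj (φ k)‖ := by simpa using hφ
  have hi := (isSpectralDensity_densityOf hφ).1
  rw [← sqNorm_conj, ← lintegral_plusSeries hc, ENNReal.ofReal_mul (by positivity),
    ofReal_integral_eq_lintegral_ofReal hi (Eventually.of_forall fun _ => sq_nonneg _), mul_comm,
    ← lintegral_mul_const'' _ hi.1.aemeasurable.ennreal_ofReal]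
  refine lintegral_congr fun t => ?_
  rw [← conj_minusSeries, densityOf, ENNReal.ofReal_pow (norm_nonneg _), ofReal_norm]
  congr 2
  rw [← ofReal_norm, ← ofReal_norm, RCLike.norm_conj]

/-! ### The optimal characteristic of a canonically factorized density and its error -/

section OptimalCharacteristic

variable {n μ : ℕ} {a φ : ℕ → ℂ}

lemma summable_opDA (hμ : 1 ≤ μ) (hH : opDA n μ a = hankel (bCoeff n μ a))
    (hb : Summable fun k => ‖bCoeff n μ a k‖) (hφ : Summable fun k => ‖φ k‖) :
    Summable fun k => ‖opDA n μ a (opW n μ φ) k‖ := by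
  rw [hH]
  exact summable_hankel hb (summable_opW n hμ hφ)

/-- Only almost everywhere: Φ does not vanish on the circle, but the factor w_μ may. -/
lemma ae_minusSeries_opW_ne_zero (hμ : 1 ≤ μ) (hφ : IsCanonical φ) :
    ∀ᵐ t ∂circ, minusSeries (opW n μ φ) t ≠ 0 := by
  filter_upwards [ae_norm_incrFactor n hμ, ae_incrFactor_ne_zero n hμ] with t h1 h2
  rw [minusSeries_opW n hμ hφ.summable]
  refine mul_ne_zero ?_ (hφ.minusSeries_ne_zero t)
  rw [← norm_ne_zero_iff, ← h1]
  exact norm_ne_zero_iff.2 h2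

/-- The analytic part of the optimal characteristic. -/
lemma exists_optChar_mul_incrFactor (hμ : 1 ≤ μ) (hH : opDA n μ a = hankel (bCoeff n μ a))
    (hb : Summable fun k => ‖bCoeff n μ a k‖) (hφ : IsCanonical φ) :
    ∃ q : ℂ → ℂ, IsWiener q ∧ ∀ᵐ t : ℝ ∂circ, optChar n μ a φ t * incrFactor n μ t =
      Complex.exp (Complex.I * (-1 : ℤ) * t) *
        (q (Complex.exp (-(Complex.I * t))) * incrFactor n 1 t) := by
  have hW := summable_opW n hμ hφ.summable
  refine ⟨fun z => (∑' k, coHankel (bCoeff n μ a) (opW n μ φ) k * z ^ k) *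
    ((regFactor n z)⁻¹ * (∑' k, φ k * z ^ k)⁻¹), (isWiener_tsum (summable_coHankel hb hW)).mul
      ((isWiener_regFactor_inv n).mul (isWiener_inv_of_ne_zero hφ)), ?_⟩
  filter_upwards [ae_minusSeries_opW_ne_zero (n := n) hμ hφ] with t ht
  have h1 := plusSeries_mul_minusSeries hb hW t
  have h2 := minusSeries_opW n hμ hφ.summable t
  rw [minusSeries_wCoeff n hμ] at h2
  have e1 : Complex.exp (Complex.I * (-1 : ℤ) * t) = Complex.exp (-(Complex.I * t)) := by
    push_cast; ring_nf
  rw [e1, ← minusSeries_eq, ← minusSeries_eq, incrFactor_eq_geomPoly n μ, optChar, hH]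
  have h0 := ht
  rw [h2] at h0
  have hp := left_ne_zero_of_mul (left_ne_zero_of_mul h0)
  have hr := right_ne_zero_of_mul (left_ne_zero_of_mul h0)
  have hf := right_ne_zero_of_mul h0
  -- A Φ_μ - r is the part of A Φ_μ with negative frequencies.
  have e2 : plusSeries (bCoeff n μ a) t - plusSeries (hankel (bCoeff n μ a) (opW n μ φ)) t *
      (minusSeries (opW n μ φ) t)⁻¹ = Complex.exp (-(Complex.I * t)) *
      minusSeries (coHankel (bCoeff n μ a) (opW n μ φ)) t * (minusSeries (opW n μ φ) t)⁻¹ := by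
    rw [eq_sub_of_add_eq' h1.symm, sub_mul, mul_inv_cancel_right₀ ht]
  rw [e2, h2]
  -- The factor `geomPoly`ⁿ of Φ_μ cancels against that of u_μ; the remaining divisors are
  -- invertible in the Wiener algebra.
  field_simp

/-- The multiplier q depends on φ alone, so one characteristic serves every f. This gives membership
in `classH`. -/
lemma isAdmissible_optChar (hμ : 1 ≤ μ) (hH : opDA n μ a = hankel (bCoeff n μ a))
    (hb : Summable fun k => ‖bCoeff n μ a k‖) (hφ : IsCanonical φ) {f : ℝ → ℝ}
    (hf : IsSpectralDensity f) : IsAdmissible n μ f (optChar n μ a φ) := by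
  have := isFiniteMeasure_specMeasure hf
  obtain ⟨q, hq, h⟩ := exists_optChar_mul_incrFactor hμ hH hb hφ
  rw [IsAdmissible, memPast_iff hf]
  refine (lpMem_wiener_mul_incrFactor_one (specMeasure_ac f) n hμ (-1) hq).congr ?_
  filter_upwards [(specMeasure_ac f).ae_le h] with t ht
  exact ht.symm

/-- The function `|r|² / |Φ|²` that determines the error of the optimal characteristic. -/
noncomputable def errorDensity (n μ : ℕ) (a φ : ℕ → ℂ) (t : ℝ) : ℝ :=
  ‖plusSeries (opDA n μ a (opW n μ φ)) t‖ ^ 2 / densityOf φ t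

lemma sub_optChar_mul (t : ℝ) :
    (plusSeries (bCoeff n μ a) t - optChar n μ a φ t) * incrFactor n μ t =
      plusSeries (opDA n μ a (opW n μ φ)) t *
        (incrFactor n μ t * (minusSeries (opW n μ φ) t)⁻¹) := by
  rw [optChar]; ring

lemma ae_norm_sub_optChar (hμ : 1 ≤ μ) (hφ : IsCanonical φ) :
    ∀ᵐ t ∂circ, ‖(plusSeries (bCoeff n μ a) t - optChar n μ a φ t) * incrFactor n μ t‖ ^ 2 =
      errorDensity n μ a φ t := by
  filter_upwards [ae_norm_incrFactor n hμ, ae_incrFactor_ne_zero n hμ] with t h1 h2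
  have h3 : ‖incrFactor n μ t‖ ≠ 0 := norm_ne_zero_iff.2 h2
  rw [sub_optChar_mul, minusSeries_opW n hμ hφ.summable, norm_mul, norm_mul, norm_inv, norm_mul, ← h1,
    mul_inv, mul_inv_cancel_left₀ h3, mul_pow, inv_pow, errorDensity, densityOf,
    div_eq_mul_inv]

lemma continuous_errorDensity (hμ : 1 ≤ μ) (hH : opDA n μ a = hankel (bCoeff n μ a))
    (hb : Summable fun k => ‖bCoeff n μ a k‖) (hφ : IsCanonical φ) :
    Continuous (errorDensity n μ a φ) :=
  ((continuous_plusSeries (summable_opDA hμ hH hb hφ.summable)).norm.pow 2).div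
    (continuous_densityOf hφ.summable) fun t => (densityOf_pos hφ t).ne'

lemma errorDensity_nonneg (t : ℝ) : 0 ≤ errorDensity n μ a φ t :=
  div_nonneg (sq_nonneg _) (sq_nonneg _)

lemma integrable_errorDensity_mul (hμ : 1 ≤ μ) (hH : opDA n μ a = hankel (bCoeff n μ a))
    (hb : Summable fun k => ‖bCoeff n μ a k‖) (hφ : IsCanonical φ) {f : ℝ → ℝ}
    (hf : Integrable f circ) : Integrable (fun t => errorDensity n μ a φ t * f t) circ := by
  have hc := continuous_errorDensity hμ hH hb hφ
  obtain ⟨C, hC⟩ := (isCompact_Icc (a := -Real.pi) (b := Real.pi)).exists_bound_of_continuousOn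
    hc.continuousOn
  refine hf.bdd_mul (c := C) hc.aestronglyMeasurable ?_
  filter_upwards [ae_circ_mem] with t ht using hC t (Set.Ioc_subset_Icc_self ht)

/-- With the characteristic fixed the error is linear in f; its maximization over the class is a
linear problem with bounded weight ρ. -/
lemma specError_optChar (hμ : 1 ≤ μ) (hH : opDA n μ a = hankel (bCoeff n μ a))
    (hb : Summable fun k => ‖bCoeff n μ a k‖) (hφ : IsCanonical φ) {f : ℝ → ℝ}
    (hf : IsSpectralDensity f) : specError n μ a (optChar n μ a φ) f =
      ENNReal.ofReal (1 / (2 * Real.pi) * ∫ t, errorDensity n μ a φ t * f t ∂circ) := by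
  have hi := integrable_errorDensity_mul hμ hH hb hφ hf.1
  have h0 : 0 ≤ᵐ[circ] fun t => 1 / (2 * Real.pi) * (errorDensity n μ a φ t * f t) := by
    filter_upwards [hf.2] with t ht
    have := errorDensity_nonneg (n := n) (μ := μ) (a := a) (φ := φ) t
    simp only [Pi.zero_apply]
    positivity
  rw [specError, lintegral_specMeasure hf, ← integral_const_mul,
    ofReal_integral_eq_lintegral_ofReal (hi.const_mul _) h0]
  refine lintegral_congr_ae ?_
  filter_upwards [ae_norm_sub_optChar (n := n) (a := a) hμ hφ] with t ht
  rw [← ofReal_norm, ← ENNReal.ofReal_pow (norm_nonneg _), ht,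
    ← ENNReal.ofReal_mul (errorDensity_nonneg t)]
  congr 1
  ring

/-- The denominator of ρ cancels against the density |Φ|², and Parseval applies to r. -/
lemma specError_optChar_self (hμ : 1 ≤ μ) (hH : opDA n μ a = hankel (bCoeff n μ a))
    (hb : Summable fun k => ‖bCoeff n μ a k‖) (hφ : IsCanonical φ) :
    specError n μ a (optChar n μ a φ) (densityOf φ) = sqNorm (opDAW n μ a φ) := by
  have hs := summable_opDA hμ hH hb hφ.summable
  rw [specError, lintegral_specMeasure (isSpectralDensity_densityOf hφ.summable), opDAW,
    ← lintegral_plusSeries hs]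
  refine lintegral_congr_ae ?_
  filter_upwards [ae_norm_sub_optChar (n := n) (a := a) hμ hφ] with t ht
  have h0 := densityOf_pos hφ t
  rw [← ofReal_norm, ← ENNReal.ofReal_pow (norm_nonneg _), ht,
    ← ENNReal.ofReal_mul (errorDensity_nonneg t), ← ofReal_norm, ← ENNReal.ofReal_pow (norm_nonneg _),
    ← ENNReal.ofReal_mul (by positivity), errorDensity]
  congr 1
  field_simp

/-- The error of the optimal characteristic is orthogonal to the past. -/
lemma integral_conj_mul_sub_optChar (hμ : 1 ≤ μ) (hH : opDA n μ a = hankel (bCoeff n μ a))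
    (hb : Summable fun k => ‖bCoeff n μ a k‖) (hφ : IsCanonical φ) {k : ℤ} (hk : k ≤ -1) :
    ∫ t, ((plusSeries (bCoeff n μ a) t - optChar n μ a φ t) * incrFactor n μ t) *
      conj (Complex.exp (Complex.I * k * t) * incrFactor n μ t) ∂specMeasure (densityOf φ) = 0 := by
  have hs := summable_opDA hμ hH hb hφ.summable
  have hW : Summable fun k => ‖conj (opW n μ φ k)‖ := by
    simpa using summable_opW n hμ hφ.summable
  -- After multiplication by |Φ|² the integrand is r times the conjugate of Φ_μ times e^{-ikt}. The
  -- first two factors have nonnegative frequencies only, while k < 0.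
  obtain ⟨z, hz, hzm⟩ := exists_plusSeries_mul hs hW
  rw [integral_specMeasure (isSpectralDensity_densityOf hφ.summable)]
  have h := fc_plusSeries_neg hz (k := k) (by omega)
  rw [fc] at h
  rw [← h]
  congr 1
  refine integral_congr_ae ?_
  filter_upwards [ae_norm_incrFactor n hμ, ae_incrFactor_ne_zero n hμ] with t h1 h2
  rw [sub_optChar_mul, ← hzm, ← conj_minusSeries, minusSeries_opW n hμ hφ.summable]
  have hw0 : minusSeries (wCoeff n μ) t ≠ 0 := by
    rw [← norm_ne_zero_iff, ← h1]; exact norm_ne_zero_iff.2 h2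
  have hφ0 := hφ.minusSeries_ne_zero t
  have e1 : incrFactor n μ t * conj (incrFactor n μ t) =
      minusSeries (wCoeff n μ) t * conj (minusSeries (wCoeff n μ) t) := by
    rw [Complex.mul_conj, Complex.mul_conj, Complex.normSq_eq_norm_sq, Complex.normSq_eq_norm_sq, h1]
  have e2 : (densityOf φ t : ℂ) = minusSeries φ t * conj (minusSeries φ t) := by
    rw [Complex.mul_conj, Complex.normSq_eq_norm_sq, densityOf]
  have e3 : conj (Complex.exp (Complex.I * k * t)) = Complex.exp (-(Complex.I * k * t)) := by
    rw [← Complex.exp_conj]; simp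
  rw [map_mul, e3, e2, map_mul]
  field_simp
  linear_combination (plusSeries (opDA n μ a (opW n μ φ)) t * conj (minusSeries φ t)) * e1

end OptimalCharacteristic

/-! ### Optimality, uniqueness and saddle points -/

section Minimax

variable {n μ : ℕ} {a φ : ℕ → ℂ}

lemma memLp_sub_optChar (hμ : 1 ≤ μ) (hH : opDA n μ a = hankel (bCoeff n μ a))
    (hb : Summable fun k => ‖bCoeff n μ a k‖) (hφ : IsCanonical φ) {f : ℝ → ℝ}
    (hf : IsSpectralDensity f) :
    MemLp (fun t => (plusSeries (bCoeff n μ a) t - optChar n μ a φ t) * incrFactor n μ t) 2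
      (specMeasure f) := by
  have := isFiniteMeasure_specMeasure hf
  have hB : MemLp (fun t => plusSeries (bCoeff n μ a) t * incrFactor n μ t) 2 (specMeasure f) := by
    refine MemLp.of_bound ((continuous_plusSeries hb).aestronglyMeasurable.mul
      (aestronglyMeasurable_incrFactor n μ)) ((∑' k, ‖bCoeff n μ a k‖) * (μ : ℝ) ^ n)
      (Eventually.of_forall fun t => ?_)
    rw [norm_mul]
    exact mul_le_mul (norm_plusSeries_le hb t) (norm_incrFactor_le n μ t) (norm_nonneg _)
      (tsum_nonneg fun _ => norm_nonneg _)
  have h := hB.sub (isAdmissible_optChar hμ hH hb hφ hf).1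
  refine h.ae_eq (Eventually.of_forall fun t => ?_)
  simp [sub_mul]

lemma enorm_sq_toLp {ν : Measure ℝ} {F : ℝ → ℂ} (hF : MemLp F 2 ν) :
    ENNReal.ofReal (‖hF.toLp F‖ ^ 2) = ∫⁻ t, ‖F t‖ₑ ^ 2 ∂ν := by
  rw [← eLpNorm_two_sq, ENNReal.ofReal_pow (norm_nonneg _), ofReal_norm, Lp.enorm_toLp]

/-- Decomposition of the error of an admissible characteristic for the density `|Φ|²`. -/
lemma specError_eq_add (hμ : 1 ≤ μ) (hH : opDA n μ a = hankel (bCoeff n μ a))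
    (hb : Summable fun k => ‖bCoeff n μ a k‖) (hφ : IsCanonical φ) {h : ℝ → ℂ}
    (hh : IsAdmissible n μ (densityOf φ) h) :
    specError n μ a h (densityOf φ) = specError n μ a (optChar n μ a φ) (densityOf φ) +
      ∫⁻ t, ‖(optChar n μ a φ t - h t) * incrFactor n μ t‖ₑ ^ 2 ∂specMeasure (densityOf φ) := by
  have hf := isSpectralDensity_densityOf hφ.summable
  have := isFiniteMeasure_specMeasure hf
  set ν := specMeasure (densityOf φ)
  have hD := memLp_sub_optChar hμ hH hb hφ hf
  obtain ⟨h1, h1S⟩ := (memPast_iff hf _).1 (isAdmissible_optChar hμ hH hb hφ hf)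
  obtain ⟨h2, h2S⟩ := (memPast_iff hf _).1 hh
  have hE : MemLp (fun t => (optChar n μ a φ t - h t) * incrFactor n μ t) 2 ν := by
    refine (h1.sub h2).ae_eq (Eventually.of_forall fun t => ?_)
    simp [sub_mul]
  have hES : hE.toLp _ ∈ shiftSpace ν (incrFactor n μ) (-1) := by
    have e : hE.toLp _ = h1.toLp _ - h2.toLp _ := by
      rw [← MemLp.toLp_sub]
      refine MemLp.toLp_congr _ _ (Eventually.of_forall fun t => ?_)
      simp [sub_mul]
    rw [e]
    exact Submodule.sub_mem _ h1S h2S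
  -- Orthogonality on the generators passes to the closed span, because an orthogonal complement is
  -- closed.
  have horth : shiftSpace ν (incrFactor n μ) (-1) ≤ (Submodule.span ℂ {hD.toLp _})ᗮ := by
    refine Submodule.topologicalClosure_minimal _ (Submodule.span_le.2 ?_)
      (Submodule.isClosed_orthogonal _)
    rintro x ⟨k, hk, hx, rfl⟩
    rw [SetLike.mem_coe, Submodule.mem_orthogonal_singleton_iff_inner_left, L2.inner_def]
    rw [← integral_conj_mul_sub_optChar hμ hH hb hφ hk]
    refine integral_congr_ae ?_
    filter_upwards [hx.coeFn_toLp, hD.coeFn_toLp] with t e1 e2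
    rw [e1, e2, RCLike.inner_apply]
  have h0 := Submodule.mem_orthogonal_singleton_iff_inner_right.1 (horth hES)
  have hsum : MemLp (fun t => (plusSeries (bCoeff n μ a) t - h t) * incrFactor n μ t) 2 ν := by
    refine (hD.add hE).ae_eq (Eventually.of_forall fun t => ?_)
    simp only [Pi.add_apply]
    ring
  have e : hsum.toLp _ = hD.toLp _ + hE.toLp _ := by
    rw [← MemLp.toLp_add]
    refine MemLp.toLp_congr _ _ (Eventually.of_forall fun t => ?_)
    simp only [Pi.add_apply]
    ring
  rw [specError, specError, ← enorm_sq_toLp hsum, ← enorm_sq_toLp hD, ← enorm_sq_toLp hE, e,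
    ← ENNReal.ofReal_add (sq_nonneg _) (sq_nonneg _)]
  congr 1
  have := norm_add_sq_eq_norm_sq_add_norm_sq_of_inner_eq_zero _ _ h0
  rw [sq, sq, sq, this]

lemma specError_optChar_le (hμ : 1 ≤ μ) (hH : opDA n μ a = hankel (bCoeff n μ a))
    (hb : Summable fun k => ‖bCoeff n μ a k‖) (hφ : IsCanonical φ) {h : ℝ → ℂ}
    (hh : IsAdmissible n μ (densityOf φ) h) :
    specError n μ a (optChar n μ a φ) (densityOf φ) ≤ specError n μ a h (densityOf φ) := by
  rw [specError_eq_add hμ hH hb hφ hh]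
  exact le_self_add

/-- The optimal error is finite and cancels, so the second term of `specError_eq_add` is zero.
Positivity of |Φ|² and u ≠ 0 a.e. turn this into equality almost everywhere on the circle. -/
lemma ae_eq_optChar_of_specError_le (hμ : 1 ≤ μ) (hH : opDA n μ a = hankel (bCoeff n μ a))
    (hb : Summable fun k => ‖bCoeff n μ a k‖) (hφ : IsCanonical φ) {h : ℝ → ℂ}
    (hh : IsAdmissible n μ (densityOf φ) h)
    (hle : specError n μ a h (densityOf φ) ≤ specError n μ a (optChar n μ a φ) (densityOf φ)) :
    h =ᵐ[circ] optChar n μ a φ := by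
  have hf := isSpectralDensity_densityOf hφ.summable
  have hfin : specError n μ a (optChar n μ a φ) (densityOf φ) ≠ ∞ := by
    rw [specError_optChar hμ hH hb hφ hf]; exact ENNReal.ofReal_ne_top
  rw [specError_eq_add hμ hH hb hφ hh] at hle
  have h0 : ∫⁻ t, ‖(optChar n μ a φ t - h t) * incrFactor n μ t‖ₑ ^ 2
      ∂specMeasure (densityOf φ) = 0 := by
    have := ENNReal.le_sub_of_add_le_left hfin hle
    rw [tsub_self] at this
    exact le_antisymm this bot_le
  have hm : AEStronglyMeasurable (fun t => (optChar n μ a φ t - h t) * incrFactor n μ t)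
      (specMeasure (densityOf φ)) := by
    refine ((isAdmissible_optChar hμ hH hb hφ hf).1.sub hh.1).1.congr
      (Eventually.of_forall fun t => ?_)
    simp [sub_mul]
  rw [lintegral_eq_zero_iff' (hm.enorm.pow_const 2)] at h0
  filter_upwards [(ac_specMeasure hf (Eventually.of_forall (densityOf_pos hφ))).ae_le h0,
    ae_incrFactor_ne_zero n hμ] with t h1 h2
  simp only [Pi.zero_apply] at h1
  have h3 : (optChar n μ a φ t - h t) * incrFactor n μ t = 0 := by
    simpa using h1
  exact (sub_eq_zero.1 ((mul_eq_zero.1 h3).resolve_right h2)).symm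

lemma minError_densityOf (hμ : 1 ≤ μ) (hH : opDA n μ a = hankel (bCoeff n μ a))
    (hb : Summable fun k => ‖bCoeff n μ a k‖) (hφ : IsCanonical φ) :
    minError n μ a (densityOf φ) = specError n μ a (optChar n μ a φ) (densityOf φ) := by
  refine le_antisymm ?_ ?_
  · exact iInf₂_le _ (isAdmissible_optChar hμ hH hb hφ (isSpectralDensity_densityOf hφ.summable))
  · exact le_iInf₂ fun h hh => specError_optChar_le hμ hH hb hφ hh

/-- `|Φ|²` and its optimal characteristic form a saddle point of the error on `D`. -/
structure IsSaddle (n μ : ℕ) (a : ℕ → ℂ) (D : Set (ℝ → ℝ)) (φ : ℕ → ℂ) : Prop where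
  canonical : IsCanonical φ
  mem : densityOf φ ∈ D
  le : ∀ f ∈ D, specError n μ a (optChar n μ a φ) f ≤
    specError n μ a (optChar n μ a φ) (densityOf φ)

variable {D : Set (ℝ → ℝ)}

/-- Δ(f) ≤ Δ(h⁰; f) ≤ Δ(h⁰; |Φ|²) = Δ(|Φ|²). -/
lemma IsSaddle.leastFavorable (hμ : 1 ≤ μ) (hH : opDA n μ a = hankel (bCoeff n μ a))
    (hb : Summable fun k => ‖bCoeff n μ a k‖) (hD : ∀ f ∈ D, IsSpectralDensity f)
    (h : IsSaddle n μ a D φ) : IsLeastFavorable n μ a D (densityOf φ) := by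
  refine ⟨h.mem, fun f hf => ?_⟩
  rw [minError_densityOf hμ hH hb h.canonical]
  exact (iInf₂_le _ (isAdmissible_optChar hμ hH hb h.canonical (hD f hf))).trans (h.le f hf)

/-- For uniqueness, a minimax h satisfies Δ(h; |Φ|²) ≤ sup Δ(h; ·) ≤ sup Δ(h⁰; ·) = Δ(h⁰; |Φ|²). It
is therefore optimal for |Φ|², and the optimum is unique. -/
lemma IsSaddle.isMinimaxRobust_iff (hμ : 1 ≤ μ) (hH : opDA n μ a = hankel (bCoeff n μ a))
    (hb : Summable fun k => ‖bCoeff n μ a k‖) (hD : ∀ f ∈ D, IsSpectralDensity f)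
    (hs : IsSaddle n μ a D φ) (h : ℝ → ℂ) :
    IsMinimaxRobust n μ a D h ↔ h =ᵐ[circ] optChar n μ a φ := by
  have hadm : optChar n μ a φ ∈ classH n μ D := fun f hf =>
    isAdmissible_optChar hμ hH hb hs.canonical (hD f hf)
  have hsup : (⨆ f ∈ D, specError n μ a (optChar n μ a φ) f) =
      specError n μ a (optChar n μ a φ) (densityOf φ) :=
    le_antisymm (iSup₂_le hs.le)
      (le_iSup₂ (f := fun f _ => specError n μ a (optChar n μ a φ) f) _ hs.mem)
  constructor
  · rintro ⟨h1, -, h3⟩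
    refine ae_eq_optChar_of_specError_le hμ hH hb hs.canonical (h1 _ hs.mem) ?_
    rw [← hsup]
    exact (le_iSup₂ (f := fun f _ => specError n μ a h f) _ hs.mem).trans (h3 _ hadm)
  · intro e
    refine ⟨fun f hf => isAdmissible_congr (hD f hf) e.symm (hadm f hf), ⟨_, hs.mem, ?_⟩, ?_⟩
    · intro g hg
      rw [specError_congr e, specError_congr e]
      exact hs.le g hg
    · intro h' hh'
      simp_rw [specError_congr e]
      rw [hsup]
      exact (specError_optChar_le hμ hH hb hs.canonical (hh' _ hs.mem)).trans
        (le_iSup₂ (f := fun f _ => specError n μ a h' f) _ hs.mem)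

/-- Two least favorable densities have the same optimal characteristic. -/
lemma IsSaddle.optChar_ae_eq (hμ : 1 ≤ μ) (hH : opDA n μ a = hankel (bCoeff n μ a))
    (hb : Summable fun k => ‖bCoeff n μ a k‖) (hD : ∀ f ∈ D, IsSpectralDensity f)
    (hs : IsSaddle n μ a D φ) {ψ : ℕ → ℂ} (hψ : IsCanonical ψ) (hψD : densityOf ψ ∈ D)
    (hle : sqNorm (opDAW n μ a φ) ≤ sqNorm (opDAW n μ a ψ)) :
    optChar n μ a φ =ᵐ[circ] optChar n μ a ψ := by
  refine ae_eq_optChar_of_specError_le hμ hH hb hψ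
    (isAdmissible_optChar hμ hH hb hs.canonical (hD _ hψD)) ?_
  refine (hs.le _ hψD).trans ?_
  rwa [specError_optChar_self hμ hH hb hs.canonical, specError_optChar_self hμ hH hb hψ]

/-- A density of the class reaching the saddle value has the same optimal characteristic, so the
saddle inequality passes to it. This settles case (i). -/
lemma IsSaddle.of_le (hμ : 1 ≤ μ) (hH : opDA n μ a = hankel (bCoeff n μ a))
    (hb : Summable fun k => ‖bCoeff n μ a k‖) (hD : ∀ f ∈ D, IsSpectralDensity f)
    (hs : IsSaddle n μ a D φ) {ψ : ℕ → ℂ} (hψ : IsCanonical ψ) (hψD : densityOf ψ ∈ D)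
    (hle : sqNorm (opDAW n μ a φ) ≤ sqNorm (opDAW n μ a ψ)) : IsSaddle n μ a D ψ := by
  refine ⟨hψ, hψD, fun f hf => ?_⟩
  rw [← specError_congr (hs.optChar_ae_eq hμ hH hb hD hψ hψD hle)]
  refine (hs.le f hf).trans ?_
  rwa [specError_optChar_self hμ hH hb hs.canonical, specError_optChar_self hμ hH hb hψ]

/-! ### The class `classD` -/

variable {v : ℝ → ℝ} {ε : ℝ}

lemma powerP_nonneg (hv : IsSpectralDensity v) (hε : 0 ≤ ε) : 0 ≤ powerP v ε := by
  have : 0 ≤ ∫ t, v t ∂circ := integral_nonneg_of_ae hv.2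
  unfold powerP
  positivity

lemma integral_densityOf_candidate (hv : IsSpectralDensity v) (hε : 0 ≤ ε)
    (hφ : φ ∈ candidates v ε) :
    1 / (2 * Real.pi) * ∫ t, densityOf φ t ∂circ = powerP v ε := by
  have h := lintegral_densityOf hφ.1.summable
  rw [hφ.2] at h
  have h0 : 0 ≤ ∫ t, densityOf φ t ∂circ := integral_nonneg fun _ => sq_nonneg _
  exact (ENNReal.ofReal_eq_ofReal_iff (by positivity) (powerP_nonneg hv hε)).1 h

/-- When v ≤ |Φ|² the L¹ distance is the difference of the integrals, and ‖φ‖² = P₁ makes it exactly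
2πε. -/
lemma densityOf_mem_classD (hv : IsSpectralDensity v) (hε : 0 ≤ ε) (hφ : φ ∈ candidates v ε)
    (hle : ∀ᵐ t ∂circ, v t ≤ densityOf φ t) : densityOf φ ∈ classD v ε := by
  have hf := isSpectralDensity_densityOf hφ.1.summable
  refine ⟨hf, ?_⟩
  have e : ∫ t, |densityOf φ t - v t| ∂circ = ∫ t, densityOf φ t ∂circ - ∫ t, v t ∂circ := by
    rw [← integral_sub hf.1 hv.1]
    refine integral_congr_ae ?_
    filter_upwards [hle] with t ht
    exact abs_of_nonneg (by linarith)
  have h := integral_densityOf_candidate hv hε hφ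
  rw [powerP] at h
  rw [e, mul_sub]
  linarith

lemma norm_mul_plusSeries_sq (hφ : IsCanonical φ) (c : ℂ) (t : ℝ) :
    ‖c * plusSeries (opDA n μ a (opW n μ φ)) t‖ ^ 2 =
      ‖c‖ ^ 2 * (errorDensity n μ a φ t * densityOf φ t) := by
  have := (densityOf_pos hφ t).ne'
  rw [errorDensity, norm_mul, mul_pow]
  field_simp

/-- Since |r|² = ρ|Φ|², the assumption reads |Φ|² = max {v, |c|² ρ |Φ|²}. The conclusions are the
Kuhn–Tucker conditions: ρ is at most its multiplier |c|⁻² and equals it where |Φ|² > v. -/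
lemma errorDensity_of_eq_max (hφ : IsCanonical φ) {c : ℂ} (hc0 : c ≠ 0)
    (hc : ∀ᵐ t ∂circ, densityOf φ t =
      max (v t) (‖c * plusSeries (opDA n μ a (opW n μ φ)) t‖ ^ 2)) :
    ∀ᵐ t ∂circ, errorDensity n μ a φ t ≤ 1 / ‖c‖ ^ 2 ∧
      errorDensity n μ a φ t * (densityOf φ t - v t) = 1 / ‖c‖ ^ 2 * (densityOf φ t - v t) := by
  have hc2 : 0 < ‖c‖ ^ 2 := by positivity
  filter_upwards [hc] with t ht
  have h0 := densityOf_pos hφ t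
  rw [norm_mul_plusSeries_sq hφ] at ht
  refine ⟨?_, ?_⟩
  · have h1 : ‖c‖ ^ 2 * (errorDensity n μ a φ t * densityOf φ t) ≤ densityOf φ t :=
      (le_max_right _ _).trans ht.ge
    rw [le_div_iff₀ hc2]
    by_contra hcon
    push Not at hcon
    nlinarith
  · rcases le_total (v t) (‖c‖ ^ 2 * (errorDensity n μ a φ t * densityOf φ t)) with h | h
    · rw [max_eq_right h] at ht
      have : errorDensity n μ a φ t = 1 / ‖c‖ ^ 2 := by
        rw [eq_div_iff hc2.ne']
        have : densityOf φ t * (errorDensity n μ a φ t * ‖c‖ ^ 2 - 1) = 0 := by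
          linear_combination -ht
        rcases mul_eq_zero.1 this with h' | h'
        · exact absurd h' h0.ne'
        · linarith
      rw [this]
    · rw [max_eq_left h] at ht
      rw [ht]; ring

lemma ae_eq_of_mem_classD_zero (hv : IsSpectralDensity v) {f : ℝ → ℝ} (hf : f ∈ classD v 0) :
    f =ᵐ[circ] v := by
  have hfe : ∫ t, |f t - v t| ∂circ = 0 :=
    le_antisymm (nonpos_of_mul_nonpos_right hf.2 (by positivity))
      (integral_nonneg fun _ => abs_nonneg _)
  filter_upwards [(integral_eq_zero_iff_of_nonneg (fun _ => abs_nonneg _)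
    (hf.1.1.sub hv.1).abs).1 hfe] with t ht
  simpa [sub_eq_zero] using ht

/-- With multiplier 0 the density is v itself, and its power leaves no room for ε. -/
lemma eq_zero_of_densityOf_eq_max_zero (hv : IsSpectralDensity v) (hε : 0 ≤ ε)
    (hφ : φ ∈ candidates v ε) {r : ℝ → ℂ}
    (hc : ∀ᵐ t ∂circ, densityOf φ t = max (v t) (‖0 * r t‖ ^ 2)) : ε = 0 := by
  have hv0 : ∀ᵐ t ∂circ, densityOf φ t = v t := by
    filter_upwards [hc, hv.2] with t ht hvt
    rw [ht]
    simpa using hvt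
  have hP := integral_densityOf_candidate hv hε hφ
  rw [powerP, integral_congr_ae hv0] at hP
  linarith

/-- A density of the form `max {v, |c r|²}` gives a saddle point. -/
lemma isSaddle_of_mem_maxSet (hμ : 1 ≤ μ) (hH : opDA n μ a = hankel (bCoeff n μ a))
    (hb : Summable fun k => ‖bCoeff n μ a k‖) (hv : IsSpectralDensity v) (hε : 0 ≤ ε)
    (hφ : φ ∈ maxSet n μ a v ε) : IsSaddle n μ a (classD v ε) φ := by
  obtain ⟨hcand, c, hc⟩ := hφ
  have hcan := hcand.1
  have hle : ∀ᵐ t ∂circ, v t ≤ densityOf φ t := by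
    filter_upwards [hc] with t ht
    rw [ht]; exact le_max_left _ _
  have hmem := densityOf_mem_classD hv hε hcand hle
  have hf0 := hmem.1
  have hpi : 0 < 1 / (2 * Real.pi) := by positivity
  have hP := integral_densityOf_candidate hv hε hcand
  rw [powerP] at hP
  refine ⟨hcan, hmem, fun f hf => ?_⟩
  rw [specError_optChar hμ hH hb hcan hf.1, specError_optChar hμ hH hb hcan hf0]
  refine ENNReal.ofReal_le_ofReal (mul_le_mul_of_nonneg_left ?_ hpi.le)
  set ρ := errorDensity n μ a φ
  have hρ0 : ∀ t, 0 ≤ ρ t := fun t => errorDensity_nonneg t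
  have hiv := integrable_errorDensity_mul hμ hH hb hcan hv.1
  have hif := integrable_errorDensity_mul hμ hH hb hcan hf.1.1
  have hi0 := integrable_errorDensity_mul hμ hH hb hcan hf0.1
  have hfv : Integrable (fun t => |f t - v t|) circ := (hf.1.1.sub hv.1).abs
  by_cases hc0 : c = 0
  · subst hc0
    obtain rfl := eq_zero_of_densityOf_eq_max_zero hv hε hcand hc
    refine le_of_eq (integral_congr_ae ?_)
    filter_upwards [ae_eq_of_mem_classD_zero hv hf, ae_eq_of_mem_classD_zero hv hmem] with t h1 h2
    rw [h1, h2]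
  · set M : ℝ := 1 / ‖c‖ ^ 2
    have hM0 : 0 < M := by positivity
    have hmax := errorDensity_of_eq_max hcan hc0 hc
    -- The bound 0 ≤ ρ ≤ M holds everywhere, hence also where f < v.
    have h1 : ∫ t, ρ t * f t ∂circ - ∫ t, ρ t * v t ∂circ ≤ M * ∫ t, |f t - v t| ∂circ := by
      rw [← integral_sub hif hiv, ← integral_const_mul]
      refine integral_mono_ae (hif.sub hiv) (hfv.const_mul M) ?_
      filter_upwards [hmax] with t ⟨ht, _⟩
      have h2 : f t - v t ≤ |f t - v t| := le_abs_self _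
      have h3 : 0 ≤ |f t - v t| := abs_nonneg _
      calc ρ t * f t - ρ t * v t = ρ t * (f t - v t) := by ring
        _ ≤ ρ t * |f t - v t| := mul_le_mul_of_nonneg_left h2 (hρ0 t)
        _ ≤ M * |f t - v t| := mul_le_mul_of_nonneg_right ht h3
    -- Equality for |Φ|², because ρ = M wherever it differs from v.
    have h2 : ∫ t, ρ t * densityOf φ t ∂circ - ∫ t, ρ t * v t ∂circ =
        M * (∫ t, densityOf φ t ∂circ - ∫ t, v t ∂circ) := by
      rw [← integral_sub hi0 hiv, ← integral_sub hf0.1 hv.1, ← integral_const_mul]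
      refine integral_congr_ae ?_
      filter_upwards [hmax] with t ⟨_, ht⟩
      linear_combination ht
    -- The left side is at most 2πε; the right side equals 2πε by the power constraint.
    have h3 : ∫ t, |f t - v t| ∂circ ≤ ∫ t, densityOf φ t ∂circ - ∫ t, v t ∂circ := by
      refine le_of_mul_le_mul_left ?_ hpi
      rw [mul_sub]
      linarith [hf.2]
    have h4 := mul_le_mul_of_nonneg_left h3 hM0.le
    linarith

/-- A candidate with the same error as a density of the form `max {v, |c r|²}` is itself of this
form. -/
lemma mem_maxSet_of_le (hμ : 1 ≤ μ) (hH : opDA n μ a = hankel (bCoeff n μ a))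
    (hb : Summable fun k => ‖bCoeff n μ a k‖) (hv : IsSpectralDensity v) (hε : 0 ≤ ε)
    (hφ : φ ∈ maxSet n μ a v ε) {ψ : ℕ → ℂ} (hψ : ψ ∈ candidates v ε)
    (hψD : densityOf ψ ∈ classD v ε)
    (hle : sqNorm (opDAW n μ a φ) ≤ sqNorm (opDAW n μ a ψ)) : ψ ∈ maxSet n μ a v ε := by
  have hs := isSaddle_of_mem_maxSet hμ hH hb hv hε hφ
  have hD : ∀ f ∈ classD v ε, IsSpectralDensity f := fun f hf => hf.1
  have he := hs.optChar_ae_eq hμ hH hb hD hψ.1 hψD hle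
  obtain ⟨hcand, c, hc⟩ := hφ
  have hcan := hcand.1
  have hpi : 0 < 1 / (2 * Real.pi) := by positivity
  have hPφ := integral_densityOf_candidate hv hε hcand
  have hPψ := integral_densityOf_candidate hv hε hψ
  rw [powerP] at hPφ hPψ
  have hf0 := hs.mem.1
  have hg := hψD.1
  have hgi : Integrable (fun t => densityOf ψ t - v t) circ := hg.1.sub hv.1
  -- The power constraint gives ∫ (|Ψ|² - v) = 2πε ≥ ∫ | |Ψ|² - v |, so the integrand is nonnegative
  -- a.e.
  have hgv : ∀ᵐ t ∂circ, v t ≤ densityOf ψ t := by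
    have hi : Integrable (fun t => |densityOf ψ t - v t|) circ := (hg.1.sub hv.1).abs
    have h1 : ∫ t, (|densityOf ψ t - v t| - (densityOf ψ t - v t)) ∂circ = 0 := by
      refine le_antisymm ?_ (integral_nonneg fun t => sub_nonneg.2 (le_abs_self _))
      rw [integral_sub hi hgi, integral_sub hg.1 hv.1]
      refine le_of_mul_le_mul_left ?_ hpi
      rw [mul_sub, mul_sub]
      linarith [hψD.2]
    have h2 := (integral_eq_zero_iff_of_nonneg
      (f := fun t => |densityOf ψ t - v t| - (densityOf ψ t - v t))
      (fun t => sub_nonneg.2 (le_abs_self _)) (hi.sub hgi)).1 h1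
    filter_upwards [h2] with t ht
    have : |densityOf ψ t - v t| = densityOf ψ t - v t := by
      simpa [sub_eq_zero] using ht
    have := abs_eq_self.1 this
    linarith
  refine ⟨hψ, ?_⟩
  by_cases hc0 : c = 0
  · refine ⟨0, ?_⟩
    subst hc0
    obtain rfl := eq_zero_of_densityOf_eq_max_zero hv hε hcand hc
    filter_upwards [ae_eq_of_mem_classD_zero hv hψD, hv.2] with t h1 h2
    rw [h1]
    simpa using h2
  · refine ⟨c, ?_⟩
    have hc2 : 0 < ‖c‖ ^ 2 := by positivity
    set M : ℝ := 1 / ‖c‖ ^ 2 with hM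
    set ρ := errorDensity n μ a φ
    have hmax := errorDensity_of_eq_max hcan hc0 hc
    -- The function ρ depends on φ only through the optimal characteristic, which φ and ψ share.
    have hρψ : ∀ᵐ t ∂circ, errorDensity n μ a ψ t = ρ t := by
      filter_upwards [he, ae_norm_sub_optChar (n := n) (a := a) hμ hcan,
        ae_norm_sub_optChar (n := n) (a := a) hμ hψ.1] with t h1 h2 h3
      rw [← h3, ← h1, h2]
    have hiv := integrable_errorDensity_mul hμ hH hb hcan hv.1
    have hig := integrable_errorDensity_mul hμ hH hb hcan hg.1
    have hi0 := integrable_errorDensity_mul hμ hH hb hcan hf0.1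
    have hint : ∫ t, ρ t * densityOf φ t ∂circ ≤ ∫ t, ρ t * densityOf ψ t ∂circ := by
      have h1 : specError n μ a (optChar n μ a φ) (densityOf φ) ≤
          specError n μ a (optChar n μ a φ) (densityOf ψ) := by
        rw [specError_congr (f := densityOf ψ) he, specError_optChar_self hμ hH hb hcan,
          specError_optChar_self hμ hH hb hψ.1]
        exact hle
      rw [specError_optChar hμ hH hb hcan hf0, specError_optChar hμ hH hb hcan hg] at h1
      have h2 : 0 ≤ 1 / (2 * Real.pi) * ∫ t, ρ t * densityOf ψ t ∂circ :=
        mul_nonneg hpi.le (integral_nonneg fun t => mul_nonneg (errorDensity_nonneg t) (sq_nonneg _))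
      exact le_of_mul_le_mul_left ((ENNReal.ofReal_le_ofReal_iff h2).1 h1) hpi
    have h2 : ∫ t, ρ t * densityOf φ t ∂circ - ∫ t, ρ t * v t ∂circ =
        M * (∫ t, densityOf φ t ∂circ - ∫ t, v t ∂circ) := by
      rw [← integral_sub hi0 hiv, ← integral_sub hf0.1 hv.1, ← integral_const_mul]
      refine integral_congr_ae ?_
      filter_upwards [hmax] with t ⟨_, ht⟩
      linear_combination ht
    have h3 : ∫ t, densityOf φ t ∂circ = ∫ t, densityOf ψ t ∂circ := by
      refine mul_left_cancel₀ hpi.ne' ?_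
      rw [hPφ, hPψ]
    have hid : Integrable (fun t => ρ t * densityOf ψ t - ρ t * v t) circ := hig.sub hiv
    have hiM : Integrable (fun t => (M * (densityOf ψ t - v t)) -
        (ρ t * densityOf ψ t - ρ t * v t)) circ :=
      (hgi.const_mul M).sub hid
    have hnn : 0 ≤ᵐ[circ] fun t => (M * (densityOf ψ t - v t)) -
        (ρ t * densityOf ψ t - ρ t * v t) := by
      filter_upwards [hmax, hgv] with t ⟨h4, _⟩ h5
      have : 0 ≤ (M - ρ t) * (densityOf ψ t - v t) := mul_nonneg (by linarith) (by linarith)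
      simp only [Pi.zero_apply]
      linarith
    -- Equality in the saddle inequality: the nonnegative function (M - ρ)(|Ψ|² - v) integrates to
    -- 0. Complementary slackness then yields the max form with the same c.
    have h4 : ∫ t, ((M * (densityOf ψ t - v t)) - (ρ t * densityOf ψ t - ρ t * v t)) ∂circ = 0 := by
      refine le_antisymm ?_ (integral_nonneg_of_ae hnn)
      rw [integral_sub (hgi.const_mul M) hid, integral_const_mul,
        integral_sub hg.1 hv.1, integral_sub hig hiv, ← h3]
      linarith
    have h5 := (integral_eq_zero_iff_of_nonneg_ae hnn hiM).1 h4
    filter_upwards [h5, hmax, hgv, hρψ] with t h6 ⟨h7, _⟩ h8 h9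
    simp only [Pi.zero_apply] at h6
    have h10 : (M - ρ t) * (densityOf ψ t - v t) = 0 := by linarith
    have h0 := densityOf_pos hψ.1 t
    rw [norm_mul_plusSeries_sq hψ.1, h9]
    have hcM : ‖c‖ ^ 2 * M = 1 := by rw [hM]; field_simp
    have h11 : ‖c‖ ^ 2 * (ρ t * densityOf ψ t) ≤ densityOf ψ t := by
      have : ‖c‖ ^ 2 * ρ t ≤ 1 := by
        rw [← hcM]; exact mul_le_mul_of_nonneg_left h7 hc2.le
      nlinarith
    rcases mul_eq_zero.1 h10 with h | h
    · have : ρ t = M := by linarith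
      rw [this, ← mul_assoc, hcM, one_mul, max_eq_right h8]
    · have : densityOf ψ t = v t := by linarith
      rw [this] at h11 ⊢
      rw [max_eq_left h11]

end Minimax

/-! ### The extremal problem -/

section Extremal

variable {n μ : ℕ} {a φ : ℕ → ℂ}

lemma IsWiener.exists_minusSeries {q : ℂ → ℂ} (hq : IsWiener q) :
    ∃ c : ℕ → ℂ, (Summable fun k => ‖c k‖) ∧
      ∀ t : ℝ, q (Complex.exp (-(Complex.I * t))) = minusSeries c t := by
  obtain ⟨c, hc, h⟩ := hq
  refine ⟨c, hc, fun t => ?_⟩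
  rw [minusSeries_eq]
  exact (h _ (norm_exp_neg_I t).le).tsum_eq.symm

lemma enorm_fc_sq_le {F : ℝ → ℂ} (hF : MemLp F 2 circ) (k : ℤ) :
    ‖fc F k‖ₑ ^ 2 ≤ eLpNorm F 2 circ ^ 2 * ENNReal.ofReal (1 / (2 * Real.pi)) := by
  refine (ENNReal.le_tsum (f := fun k : ℤ => ‖fc F k‖ₑ ^ 2) k).trans ?_
  rw [tsum_enorm_sq_fc hF, eLpNorm_two_sq,
    lintegral_mul_const'' _ (hF.1.enorm.pow_const 2)]

lemma fc_sub {F G : ℝ → ℂ} (hF : Integrable F circ) (hG : Integrable G circ) (k : ℤ) :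
    fc (fun t => F t - G t) k = fc F k - fc G k := by
  have h := fc_add hF (hG.const_mul (-1)) k
  rw [fc_const_mul] at h
  simpa [sub_eq_add_neg] using h

lemma tendsto_fc {F : ℕ → ℝ → ℂ} {G : ℝ → ℂ} (hF : ∀ K, MemLp (F K) 2 circ) (hG : MemLp G 2 circ)
    (h : Tendsto (fun K => eLpNorm (fun t => F K t - G t) 2 circ) atTop (𝓝 0)) (k : ℤ) :
    Tendsto (fun K => fc (F K) k) atTop (𝓝 (fc G k)) := by
  have h1 : ∀ K, ‖fc (F K) k - fc G k‖ₑ ^ 2 ≤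
      eLpNorm (fun t => F K t - G t) 2 circ ^ 2 * ENNReal.ofReal (1 / (2 * Real.pi)) := fun K => by
    rw [← fc_sub ((hF K).integrable one_le_two) (hG.integrable one_le_two)]
    exact enorm_fc_sq_le ((hF K).sub hG) k
  have h2 : Tendsto (fun K => eLpNorm (fun t => F K t - G t) 2 circ ^ 2 *
      ENNReal.ofReal (1 / (2 * Real.pi))) atTop (𝓝 0) := by
    have := ENNReal.Tendsto.mul_const (((ENNReal.continuous_pow 2).tendsto _).comp h)
      (Or.inr (ENNReal.ofReal_ne_top (r := 1 / (2 * Real.pi))))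
    simpa [Function.comp_def] using this
  have h3 := tendsto_of_tendsto_of_tendsto_of_le_of_le tendsto_const_nhds h2 (fun _ => zero_le) h1
  have h4 := h3.ennrpow_const (1 / 2 : ℝ)
  rw [ENNReal.zero_rpow_of_pos (by norm_num)] at h4
  rw [tendsto_iff_edist_tendsto_0]
  refine h4.congr fun K => ?_
  rw [edist_eq_enorm_sub, ← ENNReal.rpow_natCast, ← ENNReal.rpow_mul]
  norm_num

/-- The truncation of a sequence. -/
def truncSeq (K : ℕ) (x : ℕ → ℂ) (k : ℕ) : ℂ := if k < K then x k else 0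

lemma summable_truncSeq (K : ℕ) (x : ℕ → ℂ) : Summable fun k => ‖truncSeq K x k‖ :=
  summable_of_ne_finset_zero (s := Finset.range K) fun k hk => by
    have : ¬ k < K := by simpa using hk
    simp [truncSeq, this]

lemma minusSeries_truncSeq (K : ℕ) (x : ℕ → ℂ) (t : ℝ) : minusSeries (truncSeq K x) t =
    ∑ k ∈ Finset.range K, x k * Complex.exp (-(Complex.I * k * t)) := by
  rw [minusSeries, tsum_eq_sum (s := Finset.range K)]
  · refine Finset.sum_congr rfl fun k hk => ?_
    rw [truncSeq, if_pos (Finset.mem_range.1 hk)]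
  · intro k hk
    rw [truncSeq, if_neg (by simpa using hk), zero_mul]

lemma fc_minusSeries {x : ℕ → ℂ} (hx : Summable fun k => ‖x k‖) (k : ℕ) :
    fc (minusSeries x) (-k) = x k := by
  have h := hasSum_fc_exp hx (fun j => -(j : ℤ))
    (Eventually.of_forall fun t => by simpa using hasSum_minusSeries hx t) (-k)
  refine h.unique ?_
  convert hasSum_single k fun j hj => ?_ using 1
  · simp
  · exact if_neg fun h => hj (by simpa using h)

lemma IsL2Series.eq_fc {ψ : ℕ → ℂ} {g : ℝ → ℂ} (h : IsL2Series ψ g) (k : ℕ) : ψ k = fc g (-k) := by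
  have h1 := tendsto_fc (F := fun K => minusSeries (truncSeq K ψ))
    (fun K => memLp_circ_of_continuousOn (continuous_minusSeries (summable_truncSeq K ψ)).continuousOn 2)
    h.1 (by simpa only [minusSeries_truncSeq] using h.2) (-k)
  refine tendsto_nhds_unique (tendsto_const_nhds.congr' ?_) h1
  filter_upwards [eventually_gt_atTop k] with K hK
  rw [fc_minusSeries (summable_truncSeq K ψ), truncSeq, if_pos hK]

lemma IsL2Series.exists_bound {ψ : ℕ → ℂ} {g : ℝ → ℂ} (h : IsL2Series ψ g) :
    ∃ C : ℝ, 0 ≤ C ∧ ∀ k, ‖ψ k‖ ≤ C := by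
  set c := eLpNorm g 2 circ ^ 2 * ENNReal.ofReal (1 / (2 * Real.pi))
  have hc : c ≠ ∞ := ENNReal.mul_ne_top (ENNReal.pow_ne_top h.1.2.ne) ENNReal.ofReal_ne_top
  -- From x² ≤ c with x, c ≥ 0 it follows that x ≤ c + 1.
  refine ⟨c.toReal + 1, by positivity, fun k => ?_⟩
  have h1 := enorm_fc_sq_le h.1 (-k)
  rw [← h.eq_fc, ← ofReal_norm, ← ENNReal.ofReal_pow (norm_nonneg _),
    ENNReal.ofReal_le_iff_le_toReal hc] at h1
  change ‖ψ k‖ ^ 2 ≤ c.toReal at h1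
  have h0 : 0 ≤ c.toReal := ENNReal.toReal_nonneg
  nlinarith [norm_nonneg (ψ k)]

lemma norm_opW_le (hμ : 1 ≤ μ) {x : ℕ → ℂ} {C : ℝ} (hx : ∀ k, ‖x k‖ ≤ C) (k : ℕ) :
    ‖opW n μ x k‖ ≤ (∑' k, ‖wCoeff n μ k‖) * C := by
  have hC : 0 ≤ C := (norm_nonneg _).trans (hx 0)
  have hw := summable_wCoeff n hμ
  rw [opW]
  refine (norm_sum_le _ _).trans ?_
  calc ∑ j ∈ Finset.range (k + 1), ‖wCoeff n μ (k - j) * x j‖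
      ≤ ∑ j ∈ Finset.range (k + 1), ‖wCoeff n μ (k - j)‖ * C :=
        Finset.sum_le_sum fun j _ => by
          rw [norm_mul]; exact mul_le_mul_of_nonneg_left (hx j) (norm_nonneg _)
    _ = (∑ j ∈ Finset.range (k + 1), ‖wCoeff n μ j‖) * C := by
        rw [← Finset.sum_mul, ← Finset.sum_range_reflect]
        congr 1
        refine Finset.sum_congr rfl fun j hj => ?_
        have := Finset.mem_range.1 hj
        congr 2
        omega
    _ ≤ _ := mul_le_mul_of_nonneg_right (hw.sum_le_tsum _ fun _ _ => norm_nonneg _) hC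

/-- Each entry of W^μ is a finite sum and is eventually unaffected by the truncation; summability of
b and the uniform bound on W^μ x dominate the Hankel series. -/
lemma tendsto_hankel_opW (hμ : 1 ≤ μ) {b x : ℕ → ℂ} (hb : Summable fun k => ‖b k‖) {C : ℝ}
    (hx : ∀ k, ‖x k‖ ≤ C) (k : ℕ) :
    Tendsto (fun K => hankel b (opW n μ (truncSeq K x)) k) atTop (𝓝 (hankel b (opW n μ x) k)) := by
  have hC : 0 ≤ C := (norm_nonneg _).trans (hx 0)
  refine tendsto_tsum_of_dominated_convergence
    (bound := fun j => ‖b (k + j)‖ * ((∑' k, ‖wCoeff n μ k‖) * C)) ?_ (fun j => ?_) ?_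
  · exact (hb.comp_injective (add_right_injective k)).mul_right _
  · refine tendsto_const_nhds.congr' ?_
    filter_upwards [eventually_gt_atTop j] with K hK
    congr 1
    refine Finset.sum_congr rfl fun i hi => ?_
    rw [truncSeq, if_pos]
    have := Finset.mem_range.1 hi
    omega
  · refine Eventually.of_forall fun K j => ?_
    rw [norm_mul]
    refine mul_le_mul_of_nonneg_left (norm_opW_le hμ (fun i => ?_) j) (norm_nonneg _)
    rw [truncSeq]
    split_ifs
    · exact hx i
    · simpa using hC

/-- The quotient `r / Φ`. -/
noncomputable def errorQuotient (n μ : ℕ) (a φ : ℕ → ℂ) (t : ℝ) : ℂ :=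
  plusSeries (opDA n μ a (opW n μ φ)) t * (minusSeries φ t)⁻¹

lemma continuous_errorQuotient (hμ : 1 ≤ μ) (hH : opDA n μ a = hankel (bCoeff n μ a))
    (hb : Summable fun k => ‖bCoeff n μ a k‖) (hφ : IsCanonical φ) :
    Continuous (errorQuotient n μ a φ) :=
  (continuous_plusSeries (summable_opDA hμ hH hb hφ.summable)).mul
    ((continuous_minusSeries hφ.summable).inv₀ hφ.minusSeries_ne_zero)

/-- Up to negative frequencies r equals A w_μ Φ. Dividing by Φ and multiplying by the series X of x
turns this into A w_μ X, since X/Φ is a power series in e^{-it} and keeps negative frequencies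
negative. The nonnegative part of A w_μ X is D^μ A W^μ x. -/
lemma fc_errorQuotient_mul (hμ : 1 ≤ μ) (hH : opDA n μ a = hankel (bCoeff n μ a))
    (hb : Summable fun k => ‖bCoeff n μ a k‖) (hφ : IsCanonical φ) {x : ℕ → ℂ}
    (hx : Summable fun k => ‖x k‖) (k : ℕ) :
    fc (fun t => errorQuotient n μ a φ t * minusSeries x t) k = opDAW n μ a x k := by
  set b := bCoeff n μ a
  have hWφ := summable_opW n hμ hφ.summable
  have hWx := summable_opW n hμ hx
  obtain ⟨c, hc, hcm⟩ := IsWiener.exists_minusSeries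
    ((isWiener_tsum (summable_coHankel hb hWx)).add ((isWiener_const (-1)).mul
      ((isWiener_tsum (summable_coHankel hb hWφ)).mul
        ((isWiener_inv_of_ne_zero hφ).mul (isWiener_tsum hx)))))
  have e : ∀ t, errorQuotient n μ a φ t * minusSeries x t = plusSeries (hankel b (opW n μ x)) t +
      Complex.exp (Complex.I * (-1 : ℤ) * t) * minusSeries c t := by
    intro t
    have h1 := plusSeries_mul_minusSeries hb hWφ t
    have h2 := plusSeries_mul_minusSeries hb hWx t
    rw [minusSeries_opW n hμ hφ.summable] at h1
    rw [minusSeries_opW n hμ hx] at h2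
    have h0 := hφ.minusSeries_ne_zero t
    have e1 : Complex.exp (Complex.I * (-1 : ℤ) * t) = Complex.exp (-(Complex.I * t)) := by
      push_cast; ring_nf
    rw [← hcm, e1, ← minusSeries_eq, ← minusSeries_eq, ← minusSeries_eq, ← minusSeries_eq,
      errorQuotient, hH]
    have h3 := eq_sub_of_add_eq h1.symm
    have h4 := eq_sub_of_add_eq h2.symm
    change plusSeries (hankel b (opW n μ φ)) t * _ * _ = _
    rw [h3, h4]
    field_simp
    ring
  have hmc : Integrable (fun t : ℝ => Complex.exp (Complex.I * (-1 : ℤ) * t) * minusSeries c t)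
      circ := integrable_circ_of_continuousOn
    (Continuous.mul (by fun_prop) (continuous_minusSeries hc)).continuousOn
  simp_rw [e]
  rw [fc_add (integrable_circ_of_continuousOn
      (continuous_plusSeries (summable_hankel hb hWx)).continuousOn) hmc,
    fc_plusSeries (summable_hankel hb hWx), fc_exp_mul_minusSeries hc (by omega), add_zero, opDAW, hH]

/-- Extends the identity to square summable ψ by truncation: r/Φ is bounded, so the left side is
continuous in L₂, and the right side converges entrywise. -/
lemma fc_errorQuotient_mul_of_isL2Series (hμ : 1 ≤ μ) (hH : opDA n μ a = hankel (bCoeff n μ a))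
    (hb : Summable fun k => ‖bCoeff n μ a k‖) (hφ : IsCanonical φ) {ψ : ℕ → ℂ} {g : ℝ → ℂ}
    (hg : IsL2Series ψ g) :
    MemLp (fun t => errorQuotient n μ a φ t * g t) 2 circ ∧
      ∀ k : ℕ, fc (fun t => errorQuotient n μ a φ t * g t) k = opDAW n μ a ψ k := by
  have hcont := continuous_errorQuotient hμ hH hb hφ
  obtain ⟨C, hC⟩ := (isCompact_Icc (a := -Real.pi) (b := Real.pi)).exists_bound_of_continuousOn
    hcont.continuousOn
  have hae : ∀ᵐ t ∂circ, ‖errorQuotient n μ a φ t‖ ≤ C := by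
    filter_upwards [ae_circ_mem] with t ht using hC t (Set.Ioc_subset_Icc_self ht)
  have hmul : ∀ {F : ℝ → ℂ}, MemLp F 2 circ →
      MemLp (fun t => errorQuotient n μ a φ t * F t) 2 circ := fun {F} hF => by
    refine MemLp.of_le_mul (c := C) hF (hcont.aestronglyMeasurable.mul hF.1) ?_
    filter_upwards [hae] with t ht
    rw [norm_mul]
    exact mul_le_mul_of_nonneg_right ht (norm_nonneg _)
  refine ⟨hmul hg.1, fun k => ?_⟩
  obtain ⟨M, -, hM⟩ := hg.exists_bound
  have hS : ∀ K, MemLp (minusSeries (truncSeq K ψ)) 2 circ := fun K =>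
    memLp_circ_of_continuousOn (continuous_minusSeries (summable_truncSeq K ψ)).continuousOn 2
  have h1 : Tendsto (fun K => fc (fun t => errorQuotient n μ a φ t * minusSeries (truncSeq K ψ) t) k)
      atTop (𝓝 (fc (fun t => errorQuotient n μ a φ t * g t) k)) := by
    refine tendsto_fc (fun K => hmul (hS K)) (hmul hg.1) ?_ k
    have h2 := ENNReal.Tendsto.const_mul (a := ENNReal.ofReal C) hg.2 (Or.inr ENNReal.ofReal_ne_top)
    rw [mul_zero] at h2
    refine tendsto_of_tendsto_of_tendsto_of_le_of_le tendsto_const_nhds h2 (fun _ => zero_le)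
      fun K => ?_
    refine eLpNorm_le_mul_eLpNorm_of_ae_le_mul ?_ 2
    filter_upwards [hae] with t ht
    rw [← mul_sub, norm_mul, minusSeries_truncSeq]
    exact mul_le_mul_of_nonneg_right ht (norm_nonneg _)
  refine tendsto_nhds_unique h1 ?_
  simp_rw [fc_errorQuotient_mul hμ hH hb hφ (summable_truncSeq _ ψ), opDAW, hH]
  exact tendsto_hankel_opW hμ hb hM k

/-- Bessel's inequality for (r/Φ)g, whose squared modulus is the error density ρ|g|². -/
lemma sqNorm_opDAW_le_specError (hμ : 1 ≤ μ) (hH : opDA n μ a = hankel (bCoeff n μ a))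
    (hb : Summable fun k => ‖bCoeff n μ a k‖) (hφ : IsCanonical φ) {ψ : ℕ → ℂ} {g : ℝ → ℂ}
    (hg : IsL2Series ψ g) (hgd : IsSpectralDensity fun t => ‖g t‖ ^ 2) :
    sqNorm (opDAW n μ a ψ) ≤ specError n μ a (optChar n μ a φ) fun t => ‖g t‖ ^ 2 := by
  obtain ⟨hF, hfc⟩ := fc_errorQuotient_mul_of_isL2Series hμ hH hb hφ hg
  have h := sqNorm_fc_le hF
  simp_rw [hfc] at h
  refine h.trans (le_of_eq ?_)
  rw [specError, lintegral_specMeasure hgd]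
  refine lintegral_congr_ae ?_
  filter_upwards [ae_norm_sub_optChar (n := n) (a := a) hμ hφ] with t ht
  rw [← ofReal_norm, ← ofReal_norm, ← ENNReal.ofReal_pow (norm_nonneg _),
    ← ENNReal.ofReal_pow (norm_nonneg _), ht, ← ENNReal.ofReal_mul (errorDensity_nonneg t),
    ← ENNReal.ofReal_mul (sq_nonneg _), errorDensity, errorQuotient, densityOf, norm_mul, norm_mul,
    norm_inv]
  congr 1
  ring

lemma isL2Series_minusSeries {x : ℕ → ℂ} (hx : Summable fun k => ‖x k‖) :
    IsL2Series x (minusSeries x) := by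
  refine ⟨memLp_circ_of_continuousOn (continuous_minusSeries hx).continuousOn 2, ?_⟩
  refine tendsto_eLpNorm_of_bounded (C := ∑' k, ‖x k‖) (fun K => by fun_prop)
    (fun K => Eventually.of_forall fun t => ?_)
    (Eventually.of_forall fun t => (hasSum_minusSeries hx t).tendsto_sum_nat)
  refine (norm_sum_le _ _).trans ?_
  refine le_trans (le_of_eq (Finset.sum_congr rfl fun k _ => ?_))
    (hx.sum_le_tsum (Finset.range K) fun _ _ => norm_nonneg _)
  have := norm_exp_neg_I_int k t
  simp only [Int.cast_natCast] at this
  rw [norm_mul, this, mul_one]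

lemma IsSaddle.solvesExtremal {D : Set (ℝ → ℝ)} (hμ : 1 ≤ μ)
    (hH : opDA n μ a = hankel (bCoeff n μ a)) (hb : Summable fun k => ‖bCoeff n μ a k‖)
    (hD : ∀ f ∈ D, IsSpectralDensity f) (hs : IsSaddle n μ a D φ) {K : Set (ℕ → ℂ)} (hK : φ ∈ K) :
    SolvesExtremal n μ a D K φ := by
  refine ⟨hK, hs.mem, fun ψ _ g hg hgD => ?_⟩
  rw [← specError_optChar_self hμ hH hb hs.canonical]
  exact (sqNorm_opDAW_le_specError hμ hH hb hs.canonical hg (hD _ hgD)).trans (hs.le _ hgD)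

end Extremal

/-! ### Families with the same Gram matrix -/

section Gram

variable {ι E F : Type*} [NormedAddCommGroup E] [InnerProductSpace ℂ E]
  [NormedAddCommGroup F] [InnerProductSpace ℂ F]

/-- Two families with the same Gram matrix are related by a linear map that is isometric on the
closed span of the first. -/
theorem exists_map_of_gram_eq [CompleteSpace E] [CompleteSpace F] (x : ι → E) (y : ι → F)
    (h : ∀ i j, inner ℂ (x i) (x j) = inner ℂ (y i) (y j)) :
    ∃ T : E →L[ℂ] F, (∀ i, T (x i) = y i) ∧
      ∀ z ∈ (Submodule.span ℂ (Set.range x)).topologicalClosure, ‖T z‖ = ‖z‖ := by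
  set M := (Submodule.span ℂ (Set.range x)).topologicalClosure
  have hMc : IsClosed (M : Set E) := Submodule.isClosed_topologicalClosure _
  have : CompleteSpace M := hMc.completeSpace_coe
  set X := Finsupp.linearCombination ℂ x
  set Y := Finsupp.linearCombination ℂ y
  have hin : ∀ c : ι →₀ ℂ, inner ℂ (X c) (X c) = inner ℂ (Y c) (Y c) := fun c => by
    simp only [X, Y, Finsupp.linearCombination_apply, Finsupp.sum, sum_inner, inner_sum,
      inner_smul_left, inner_smul_right, h]
  have hnorm : ∀ c : ι →₀ ℂ, ‖Y c‖ = ‖X c‖ := fun c => by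
    rw [@norm_eq_sqrt_re_inner ℂ, @norm_eq_sqrt_re_inner ℂ, hin]
  have hXM : ∀ c, X c ∈ M := fun c => by
    refine Submodule.le_topologicalClosure _ ?_
    rw [← Finsupp.range_linearCombination]
    exact LinearMap.mem_range_self X c
  set e : (ι →₀ ℂ) →ₗ[ℂ] M := X.codRestrict M hXM
  have hden : DenseRange e := by
    rw [DenseRange, Subtype.dense_iff]
    intro z hz
    have e1 : Subtype.val '' Set.range e = (Submodule.span ℂ (Set.range x) : Set E) := by
      rw [← Set.range_comp, ← Finsupp.range_linearCombination]
      rfl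
    have hz' : z ∈ closure (Submodule.span ℂ (Set.range x) : Set E) := hz
    rwa [← e1] at hz'
  have hb : ∀ c, ‖Y c‖ ≤ 1 * ‖e c‖ := fun c => by
    rw [one_mul, hnorm]; rfl
  set T₀ := Y.extendOfNorm e
  have hT₀ : ∀ c, T₀ (e c) = Y c := LinearMap.extendOfNorm_eq hden ⟨1, hb⟩
  have hiso : ∀ z : M, ‖T₀ z‖ = ‖z‖ := fun z =>
    hden.induction (P := fun z => ‖T₀ z‖ = ‖z‖) (by rintro _ ⟨c, rfl⟩; rw [hT₀, hnorm]; rfl)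
      (isClosed_eq (by fun_prop) continuous_norm) z
  -- Composing with the projection makes the map total; off M its values play no role.
  refine ⟨T₀.comp M.orthogonalProjectionOnto, fun i => ?_, fun z hz => ?_⟩
  · have hi : x i ∈ M := subset_closure (Submodule.subset_span ⟨i, rfl⟩)
    have e1 : e (Finsupp.single i 1) = ⟨x i, hi⟩ := by
      ext
      simp [e, X]
    rw [ContinuousLinearMap.comp_apply,
      Submodule.orthogonalProjectionOnto_mem_subspace_eq_self (⟨x i, hi⟩ : M), ← e1, hT₀]
    simp [Y]
  · rw [ContinuousLinearMap.comp_apply,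
      Submodule.orthogonalProjectionOnto_mem_subspace_eq_self (⟨z, hz⟩ : M), hiso]
    rfl

/-- A map that is isometric on a closed subspace commutes there with closed spans. -/
theorem map_topologicalClosure_span [CompleteSpace E] {T : E →L[ℂ] F} {M : Submodule ℂ E}
    (hM : IsClosed (M : Set E))
    (hT : ∀ z ∈ M, ‖T z‖ = ‖z‖) {s : Set E} (hs : s ⊆ M) :
    (Submodule.span ℂ s).topologicalClosure.map (T : E →ₗ[ℂ] F) =
      (Submodule.span ℂ (T '' s)).topologicalClosure := by
  set K := (Submodule.span ℂ s).topologicalClosure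
  have hK : K ≤ M := Submodule.topologicalClosure_minimal _ (Submodule.span_le.2 hs) hM
  have hKc : IsClosed (K : Set E) := Submodule.isClosed_topologicalClosure _
  have : CompleteSpace K := hKc.completeSpace_coe
  refine le_antisymm ?_ ?_
  · rintro _ ⟨z, hz, rfl⟩
    have h1 := image_closure_subset_closure_image T.continuous
      (Set.mem_image_of_mem T (show z ∈ closure (Submodule.span ℂ s : Set E) from hz))
    have e : T '' (Submodule.span ℂ s : Set E) = (Submodule.span ℂ (T '' s) : Set F) := by
      have := Submodule.map_span (T : E →ₗ[ℂ] F) s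
      exact congrArg (fun S : Submodule ℂ F => (S : Set F)) this
    rw [e] at h1
    exact h1
  · let J : K →ₗᵢ[ℂ] F := ⟨(T : E →ₗ[ℂ] F) ∘ₗ K.subtype, fun z => hT z (hK z.2)⟩
    -- The isometric image of a complete space is closed.
    have hc : IsClosed ((K.map (T : E →ₗ[ℂ] F) : Submodule ℂ F) : Set F) := by
      have h1 := J.isometry.isClosedEmbedding.isClosed_range
      convert h1 using 1
      ext w
      constructor
      · rintro ⟨z, hz, rfl⟩
        exact ⟨⟨z, hz⟩, rfl⟩
      · rintro ⟨z, rfl⟩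
        exact ⟨z, z.2, rfl⟩
    refine Submodule.topologicalClosure_minimal _ (Submodule.span_le.2 ?_) hc
    rintro _ ⟨z, hz, rfl⟩
    exact ⟨z, subset_closure (Submodule.subset_span hz), rfl⟩

theorem inner_map_of_norm_eq {T : E →L[ℂ] F} {M : Submodule ℂ E} (hT : ∀ z ∈ M, ‖T z‖ = ‖z‖)
    {z w : E} (hz : z ∈ M) (hw : w ∈ M) : inner ℂ (T z) (T w) = inner ℂ z w := by
  let J : M →ₗᵢ[ℂ] F := ⟨(T : E →ₗ[ℂ] F) ∘ₗ M.subtype, fun z => hT z z.2⟩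
  exact J.inner_map_map ⟨z, hz⟩ ⟨w, hw⟩

end Gram

lemma lintegral_enorm_sub_sq {α : Type*} [MeasurableSpace α] {ν : Measure α} (x y : Lp ℂ 2 ν) :
    ∫⁻ ω, ‖x ω - y ω‖ₑ ^ 2 ∂ν = ENNReal.ofReal (‖x - y‖ ^ 2) := by
  rw [ENNReal.ofReal_pow (norm_nonneg _), ofReal_norm, Lp.enorm_def, eLpNorm_two_sq]
  refine lintegral_congr_ae ?_
  filter_upwards [Lp.coeFn_sub x y] with ω h
  rw [h, Pi.sub_apply]

/-! ### The spectral representation of the increments -/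

/-- The spectral image of the increment `ξ^{(n)}(m, s)`. -/
noncomputable def incrGen (ν : Measure ℝ) [IsFiniteMeasure ν] (n : ℕ) (i : ℕ × ℤ) : Lp ℂ 2 ν :=
  (memLp_incr_shift (ν := ν) n i.1 i.2).toLp

lemma incrFactor_mul_conj (n : ℕ) (i j : ℕ × ℤ) (t : ℝ) :
    Complex.exp (Complex.I * j.2 * t) * incrFactor n j.1 t *
        conj (Complex.exp (Complex.I * i.2 * t) * incrFactor n i.1 t) =
      Complex.exp (Complex.I * (j.2 - i.2 : ℤ) * t) *
        (1 - Complex.exp (-(Complex.I * (j.1 : ℤ) * t))) ^ n *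
        (1 - Complex.exp (Complex.I * (i.1 : ℤ) * t)) ^ n * (1 / (t : ℂ) ^ (2 * n)) := by
  have e1 : conj (Complex.exp (Complex.I * i.2 * t)) = Complex.exp (-(Complex.I * i.2 * t)) := by
    rw [← Complex.exp_conj]; simp
  have e2 : conj (Complex.exp (-(Complex.I * i.1 * t))) = Complex.exp (Complex.I * i.1 * t) := by
    rw [← Complex.exp_conj]; simp
  have e3 : Complex.exp (Complex.I * (j.2 - i.2 : ℤ) * t) =
      Complex.exp (Complex.I * j.2 * t) * Complex.exp (-(Complex.I * i.2 * t)) := by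
    rw [← Complex.exp_add]; push_cast; ring_nf
  have e4 : ((t : ℂ) ^ (2 * n)) = (Complex.I * t) ^ n * (-Complex.I * t) ^ n := by
    rw [← mul_pow, pow_mul]
    congr 1
    linear_combination ((t : ℂ) ^ 2) * Complex.I_sq
  rw [e3, e4, incrFactor, incrFactor, map_mul, e1, map_div₀, map_pow, map_pow, map_sub, map_one, e2,
    map_mul, Complex.conj_I, Complex.conj_ofReal]
  push_cast
  rw [one_div, mul_inv, div_eq_mul_inv, div_eq_mul_inv]
  ring

section Sequences

variable {Ω : Type*} [MeasurableSpace Ω] {n : ℕ} {P : Measure Ω} {ξ : ℤ → Ω → ℂ} {f : ℝ → ℝ}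

/-- The structural function, at base time `i.2` and lag `j.2 - i.2`, is an inner product in L₂ of
the spectral measure once λ^{2n} is split as (iλ)ⁿ(-iλ)ⁿ. -/
lemma inner_incrGen (hf : IsSpectralDensity f) [IsFiniteMeasure (specMeasure f)]
    (hξ : HasIncrementDensity n P ξ f) (i j : ℕ × ℤ) :
    inner ℂ (incrGen (specMeasure f) n i) (incrGen (specMeasure f) n j) =
      inner ℂ (incrLp hξ i.1 i.2) (incrLp hξ j.1 j.2) := by
  have h := hξ.structural i.2 (j.2 - i.2) j.1 i.1
  rw [add_sub_cancel] at h
  have e1 : inner ℂ (incrLp hξ i.1 i.2) (incrLp hξ j.1 j.2) =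
      ∫ ω, increment n j.1 ξ j.2 ω * conj (increment n i.1 ξ i.2 ω) ∂P := by
    rw [L2.inner_def]
    refine integral_congr_ae ?_
    filter_upwards [(hξ.memLp i.1 i.2).coeFn_toLp, (hξ.memLp j.1 j.2).coeFn_toLp] with ω h1 h2
    rw [incrLp, incrLp, h1, h2, RCLike.inner_apply]
  have e2 : inner ℂ (incrGen (specMeasure f) n i) (incrGen (specMeasure f) n j) =
      ∫ t, Complex.exp (Complex.I * j.2 * t) * incrFactor n j.1 t *
        conj (Complex.exp (Complex.I * i.2 * t) * incrFactor n i.1 t) ∂specMeasure f := by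
    rw [L2.inner_def]
    refine integral_congr_ae ?_
    filter_upwards [(memLp_incr_shift (ν := specMeasure f) n i.1 i.2).coeFn_toLp,
      (memLp_incr_shift (ν := specMeasure f) n j.1 j.2).coeFn_toLp] with t h1 h2
    rw [incrGen, incrGen, h1, h2, RCLike.inner_apply]
  rw [e1, e2, h, integral_specMeasure hf]
  simp_rw [incrFactor_mul_conj]

end Sequences

/-! ### Series of shifts in the spectral space -/

section Series

variable {ν : Measure ℝ}

lemma norm_toLp_shift {g : ℝ → ℂ} (hg : MemLp g 2 ν) {k : ℤ}
    (h : MemLp (fun t : ℝ => Complex.exp (Complex.I * k * t) * g t) 2 ν) :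
    ‖h.toLp‖ = ‖hg.toLp‖ := by
  rw [Lp.norm_toLp, Lp.norm_toLp]
  congr 1
  refine eLpNorm_congr_norm_ae (Eventually.of_forall fun t => ?_)
  rw [norm_mul, norm_exp_I_int, one_mul]

lemma sum_range_toLp {F : ℕ → ℝ → ℂ} (hF : ∀ k, MemLp (F k) 2 ν) (N : ℕ) :
    ∑ k ∈ Finset.range N, (hF k).toLp =
      (memLp_finsetSum (Finset.range N) fun k _ => hF k).toLp := by
  induction N with
  | zero =>
    simp only [Finset.range_zero, Finset.sum_empty]
    exact (MemLp.toLp_zero _).symm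
  | succ N ih =>
    rw [Finset.sum_range_succ, ih, ← MemLp.toLp_add]
    refine MemLp.toLp_congr _ _ (Eventually.of_forall fun t => ?_)
    simp [Finset.sum_range_succ]

/-- All shifts of g have the same norm, so the series converges absolutely; bounded convergence of
the partial sums identifies its limit. -/
lemma hasSum_toLp_shift [IsFiniteMeasure ν] {g G : ℝ → ℂ} (hg : AEStronglyMeasurable g ν) {C : ℝ}
    (hC : ∀ᵐ t ∂ν, ‖g t‖ ≤ C) {c : ℕ → ℂ} (hc : Summable fun k => ‖c k‖) (κ : ℕ → ℤ)
    (hG : MemLp G 2 ν)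
    (h : ∀ᵐ t : ℝ ∂ν, HasSum (fun k => c k * (Complex.exp (Complex.I * κ k * t) * g t)) (G t)) :
    HasSum (fun k => c k • (memLp_shift hg hC (κ k)).toLp) hG.toLp := by
  have hg2 : MemLp g 2 ν := MemLp.of_bound hg C hC
  have hs : Summable fun k => c k • (memLp_shift hg hC (κ k)).toLp := by
    refine Summable.of_norm ?_
    simp_rw [norm_smul, norm_toLp_shift hg2]
    exact hc.mul_right _
  have h1 := hs.hasSum.tendsto_sum_nat
  set F : ℕ → ℝ → ℂ := fun N t =>
    ∑ k ∈ Finset.range N, c k * (Complex.exp (Complex.I * κ k * t) * g t)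
  have hF : ∀ N, MemLp (F N) 2 ν := fun N =>
    memLp_finsetSum _ fun k _ => (memLp_shift hg hC (κ k)).const_mul (c k)
  have e : ∀ N, ∑ k ∈ Finset.range N, c k • (memLp_shift hg hC (κ k)).toLp = (hF N).toLp :=
    fun N => sum_range_toLp (fun k => (memLp_shift hg hC (κ k)).const_mul (c k)) N
  have h2 : Tendsto (fun N => (hF N).toLp) atTop (𝓝 hG.toLp) := by
    rw [Lp.tendsto_Lp_iff_tendsto_eLpNorm'' F hF G hG]
    refine tendsto_eLpNorm_of_bounded (C := (∑' k, ‖c k‖) * C) (fun N => (hF N).1) (fun N => ?_) ?_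
    · filter_upwards [hC] with t ht
      refine (norm_sum_le _ _).trans ?_
      calc ∑ k ∈ Finset.range N, ‖c k * (Complex.exp (Complex.I * κ k * t) * g t)‖
          = (∑ k ∈ Finset.range N, ‖c k‖) * ‖g t‖ := by
            rw [Finset.sum_mul]
            refine Finset.sum_congr rfl fun k _ => ?_
            rw [norm_mul, norm_mul, norm_exp_I_int, one_mul]
        _ ≤ (∑' k, ‖c k‖) * C := by
            refine mul_le_mul (hc.sum_le_tsum _ fun _ _ => norm_nonneg _) ht (norm_nonneg _)
              (tsum_nonneg fun _ => norm_nonneg _)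
    · filter_upwards [h] with t ht using ht.tendsto_sum_nat
  simp_rw [e] at h1
  rw [← tendsto_nhds_unique h1 h2]
  exact hs.hasSum

end Series

lemma geomPoly_one (z : ℂ) : geomPoly 1 z = 1 := by simp [geomPoly]

lemma shiftSpace_mono {ν : Measure ℝ} (g : ℝ → ℂ) {k m : ℤ} (h : k ≤ m) :
    shiftSpace ν g k ≤ shiftSpace ν g m := by
  refine Submodule.topologicalClosure_mono (Submodule.span_mono ?_)
  rintro x ⟨j, hj, h'⟩
  exact ⟨j, hj.trans h, h'⟩

/-! ### Estimation of sequences with stationary increments -/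

section Sequences

variable {Ω : Type*} [MeasurableSpace Ω] {n : ℕ} {P : Measure Ω} {ξ : ℤ → Ω → ℂ} {f : ℝ → ℝ}

/-- The closed span of the spectral images of all increments. -/
noncomputable def incrGenSpace (ν : Measure ℝ) [IsFiniteMeasure ν] (n : ℕ) :
    Submodule ℂ (Lp ℂ 2 ν) :=
  (Submodule.span ℂ (Set.range (incrGen ν n))).topologicalClosure

lemma isClosed_incrGenSpace (ν : Measure ℝ) [IsFiniteMeasure ν] (n : ℕ) :
    IsClosed (incrGenSpace ν n : Set (Lp ℂ 2 ν)) :=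
  Submodule.isClosed_topologicalClosure _

lemma incrGen_mem (ν : Measure ℝ) [IsFiniteMeasure ν] (n : ℕ) (i : ℕ × ℤ) :
    incrGen ν n i ∈ incrGenSpace ν n :=
  Submodule.le_topologicalClosure _ (Submodule.subset_span ⟨i, rfl⟩)

lemma shiftGen_incrFactor (ν : Measure ℝ) [IsFiniteMeasure ν] (n μ : ℕ) (m : ℤ) :
    shiftGen ν (incrFactor n μ) m = {x | ∃ k : ℤ, k ≤ m ∧ x = incrGen ν n (μ, k)} := by
  ext x
  constructor
  · rintro ⟨k, hk, h, rfl⟩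
    exact ⟨k, hk, rfl⟩
  · rintro ⟨k, hk, rfl⟩
    exact ⟨k, hk, memLp_incr_shift n μ k, rfl⟩

lemma shiftGen_subset (ν : Measure ℝ) [IsFiniteMeasure ν] (n μ : ℕ) (m : ℤ) :
    shiftGen ν (incrFactor n μ) m ⊆ incrGenSpace ν n := by
  rw [shiftGen_incrFactor]
  rintro x ⟨k, -, rfl⟩
  exact incrGen_mem ν n _

lemma shiftSpace_le_incrGenSpace (ν : Measure ℝ) [IsFiniteMeasure ν] (n μ : ℕ) (m : ℤ) :
    shiftSpace ν (incrFactor n μ) m ≤ incrGenSpace ν n :=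
  Submodule.topologicalClosure_minimal _ (Submodule.span_le.2 (shiftGen_subset ν n μ m))
    (isClosed_incrGenSpace ν n)

/-- The spectral representation of the increments. -/
lemma exists_spectral_map (hf : IsSpectralDensity f) [IsFiniteMeasure (specMeasure f)]
    (hξ : HasIncrementDensity n P ξ f) :
    ∃ T : Lp ℂ 2 (specMeasure f) →L[ℂ] Lp ℂ 2 P,
      (∀ (s : ℕ) (m : ℤ), T (incrGen (specMeasure f) n (s, m)) = incrLp hξ s m) ∧
      ∀ z ∈ incrGenSpace (specMeasure f) n, ‖T z‖ = ‖z‖ := by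
  obtain ⟨T, h1, h2⟩ := exists_map_of_gram_eq (incrGen (specMeasure f) n)
    (fun i : ℕ × ℤ => incrLp hξ i.1 i.2) (inner_incrGen hf hξ)
  exact ⟨T, fun s m => h1 (s, m), h2⟩

/-- The error of the optimal estimate of `Aξ` is determined by the spectral density. -/
theorem sequenceError_eq {μ : ℕ} (hμ : 1 ≤ μ) {a : ℕ → ℂ} (hb : Summable fun k => ‖bCoeff n μ a k‖)
    (hf : IsSpectralDensity f) (hξ : HasIncrementDensity n P ξ f) :
    sequenceError μ a hξ = minError n μ a f := by
  have := isFiniteMeasure_specMeasure hf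
  set ν := specMeasure f with hν
  obtain ⟨T, hT, hTn⟩ := exists_spectral_map hf hξ
  have hX : MemLp (fun t => plusSeries (bCoeff n μ a) t * incrFactor n μ t) 2 ν := by
    refine MemLp.of_bound ((continuous_plusSeries hb).aestronglyMeasurable.mul
      (aestronglyMeasurable_incrFactor n μ)) ((∑' k, ‖bCoeff n μ a k‖) * (μ : ℝ) ^ n)
      (Eventually.of_forall fun t => ?_)
    rw [norm_mul]
    exact mul_le_mul (norm_plusSeries_le hb t) (norm_incrFactor_le n μ t) (norm_nonneg _)
      (tsum_nonneg fun _ => norm_nonneg _)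
  have hsum : HasSum (fun k : ℕ => bCoeff n μ a k • incrGen ν n (μ, (k : ℤ))) hX.toLp := by
    refine hasSum_toLp_shift (aestronglyMeasurable_incrFactor n μ)
      (Eventually.of_forall (norm_incrFactor_le n μ)) hb (fun k => (k : ℤ)) hX
      (Eventually.of_forall fun t => ?_)
    have h := (hasSum_plusSeries hb t).mul_right (incrFactor n μ t)
    refine Eq.mpr (congrArg (HasSum · _) (funext fun k => ?_)) h
    push_cast
    ring
  have hB : T hX.toLp = functionalB μ a hξ := by
    have h := hsum.mapL T
    have e : ∀ k : ℕ, T (bCoeff n μ a k • incrGen ν n (μ, (k : ℤ))) =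
        bCoeff n μ a k • incrLp hξ μ k := fun k =>
      (T.map_smul _ _).trans (congrArg _ (hT μ k))
    simp_rw [e] at h
    exact h.tsum_eq.symm
  have hXM : hX.toLp ∈ incrGenSpace ν n := by
    refine (isClosed_incrGenSpace ν n).mem_of_tendsto hsum (Eventually.of_forall fun s => ?_)
    exact Submodule.sum_mem _ fun k _ => Submodule.smul_mem _ _ (incrGen_mem ν n _)
  have hmap : (Submodule.span ℂ {x | ∃ m : ℤ, m ≤ -1 ∧ x = incrLp hξ μ m}).topologicalClosure =
      (shiftSpace ν (incrFactor n μ) (-1)).map (T : Lp ℂ 2 ν →ₗ[ℂ] Lp ℂ 2 P) := by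
    rw [shiftSpace, map_topologicalClosure_span (isClosed_incrGenSpace ν n) hTn
      (shiftGen_subset ν n μ (-1)), shiftGen_incrFactor]
    congr 2
    ext x
    constructor
    · rintro ⟨k, hk, rfl⟩
      exact ⟨_, ⟨k, hk, rfl⟩, hT μ k⟩
    · rintro ⟨_, ⟨k, hk, rfl⟩, rfl⟩
      exact ⟨k, hk, hT μ k⟩
  -- Vξ is subtracted from both Aξ and its estimate and cancels; only the distance from Bξ to the
  -- past remains.
  have hval : ∀ z ∈ shiftSpace ν (incrFactor n μ) (-1),
      ∫⁻ ω, ‖functionalA μ a hξ ω - ((T z : Ω → ℂ) ω - functionalV n μ a ξ ω)‖ₑ ^ 2 ∂P =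
        ENNReal.ofReal (‖hX.toLp - z‖ ^ 2) := by
    intro z hz
    rw [← hTn _ (Submodule.sub_mem _ hXM (shiftSpace_le_incrGenSpace ν n μ (-1) hz)), map_sub, hB,
      ← lintegral_enorm_sub_sq]
    refine lintegral_congr fun ω => ?_
    rw [functionalA, sub_sub_sub_cancel_right]
  have hspec : ∀ (h : ℝ → ℂ) (hh : MemLp (fun t => h t * incrFactor n μ t) 2 ν),
      specError n μ a h f = ENNReal.ofReal (‖hX.toLp - hh.toLp‖ ^ 2) := by
    intro h hh
    rw [← lintegral_enorm_sub_sq, specError]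
    refine lintegral_congr_ae ?_
    filter_upwards [hX.coeFn_toLp, hh.coeFn_toLp] with t h1 h2
    rw [h1, h2, sub_mul]
  rw [sequenceError, minError, hmap]
  refine le_antisymm (le_iInf₂ fun h hh => ?_) (le_iInf₂ fun η hη => ?_)
  · obtain ⟨hL, hS⟩ := (memPast_iff hf _).1 hh
    rw [hspec h hL, ← hval _ hS]
    exact iInf₂_le (T hL.toLp) ⟨_, hS, rfl⟩
  · obtain ⟨z, hz, rfl⟩ := hη
    -- Every element z of the past has the form hu with h = z/u, since u ≠ 0 a.e.; no estimate is
    -- missed.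
    have he : (fun t => z t / incrFactor n μ t * incrFactor n μ t) =ᵐ[ν] z := by
      filter_upwards [(specMeasure_ac f).ae_le (ae_incrFactor_ne_zero n hμ)] with t ht
      exact div_mul_cancel₀ _ ht
    have hL : MemLp (fun t => z t / incrFactor n μ t * incrFactor n μ t) 2 ν :=
      (Lp.memLp z).ae_eq he.symm
    have hzL : hL.toLp = z := by
      refine Lp.ext ?_
      exact hL.coeFn_toLp.trans he
    have hadm : IsAdmissible n μ f fun t => z t / incrFactor n μ t :=
      (memPast_iff hf _).2 ⟨hL, by rwa [hzL]⟩
    refine (iInf₂_le _ hadm).trans (le_of_eq ?_)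
    rw [hspec _ hL, hzL]
    exact (hval z hz).symm

/-! ### The moving average representation -/

/-- The spectral image of the innovations. -/
noncomputable def innovFactor (n : ℕ) (φ : ℕ → ℂ) (t : ℝ) : ℂ :=
  (regFactor n (Complex.exp (-(Complex.I * t))))⁻¹ * (minusSeries φ t)⁻¹ * incrFactor n 1 t

variable {φ : ℕ → ℂ}

lemma lpMem_innovFactor {ν : Measure ℝ} [IsFiniteMeasure ν] (hν : ν ≪ circ) (n : ℕ) {μ : ℕ}
    (hμ : 1 ≤ μ) (hφ : IsCanonical φ) (m : ℤ) :
    LpMem (shiftSpace ν (incrFactor n μ) m) fun t : ℝ =>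
      Complex.exp (Complex.I * m * t) * innovFactor n φ t := by
  have h := lpMem_wiener_mul_incrFactor_one hν n hμ m
    ((isWiener_regFactor_inv n).mul (isWiener_inv_of_ne_zero hφ))
  simp_rw [← minusSeries_eq] at h
  exact h

lemma aestronglyMeasurable_innovFactor {ν : Measure ℝ} (n : ℕ) (hφ : IsCanonical φ) :
    AEStronglyMeasurable (innovFactor n φ) ν :=
  ((isWiener_regFactor_inv n).continuous_exp.mul
    ((continuous_minusSeries hφ.summable).inv₀ hφ.minusSeries_ne_zero)).aestronglyMeasurable.mul
    (aestronglyMeasurable_incrFactor n 1)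

lemma incrFactor_eq_mul_innovFactor (n s : ℕ) (hφ : IsCanonical φ) (t : ℝ) :
    incrFactor n s t = geomPoly s (Complex.exp (-(Complex.I * t))) ^ n *
      regFactor n (Complex.exp (-(Complex.I * t))) * minusSeries φ t * innovFactor n φ t := by
  have h1 := hφ.minusSeries_ne_zero t
  have h2 := regFactor_ne_zero n (Complex.exp (-(Complex.I * t)))
  rw [incrFactor_eq_geomPoly, innovFactor]
  field_simp

lemma ae_norm_innovFactor (n : ℕ) (φ : ℕ → ℂ) :
    ∀ᵐ t ∂circ, ‖innovFactor n φ t‖ = ‖minusSeries φ t‖⁻¹ := by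
  filter_upwards [ae_norm_incrFactor n le_rfl] with t ht
  have h2 := regFactor_ne_zero n (Complex.exp (-(Complex.I * t)))
  rw [minusSeries_wCoeff n le_rfl, geomPoly_one, one_pow, one_mul] at ht
  rw [innovFactor, norm_mul, ht, norm_mul, norm_inv, norm_inv]
  field_simp

lemma exists_norm_innovFactor_le (n : ℕ) (hφ : IsCanonical φ) :
    ∃ C : ℝ, ∀ᵐ t ∂circ, ‖innovFactor n φ t‖ ≤ C := by
  obtain ⟨C, hC⟩ := (isCompact_Icc (a := -Real.pi) (b := Real.pi)).exists_bound_of_continuousOn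
    ((continuous_minusSeries hφ.summable).inv₀ hφ.minusSeries_ne_zero).continuousOn
  refine ⟨C, ?_⟩
  filter_upwards [ae_norm_innovFactor n φ, ae_circ_mem] with t h1 h2
  rw [h1, ← norm_inv]
  exact hC t (Set.Ioc_subset_Icc_self h2)

/-- The innovation factor has squared modulus 1/|Φ|², so weighting by |Φ|² leaves plain exponentials
on the circle. -/
lemma inner_innov (n : ℕ) (hφ : IsCanonical φ) {j k : ℤ}
    (hj : MemLp (fun t : ℝ => Complex.exp (Complex.I * j * t) * innovFactor n φ t) 2
      (specMeasure (densityOf φ)))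
    (hk : MemLp (fun t : ℝ => Complex.exp (Complex.I * k * t) * innovFactor n φ t) 2
      (specMeasure (densityOf φ))) :
    inner ℂ hj.toLp hk.toLp = if j = k then 1 else 0 := by
  have e : inner ℂ hj.toLp hk.toLp =
      ∫ t, Complex.exp (Complex.I * k * t) * innovFactor n φ t *
        conj (Complex.exp (Complex.I * j * t) * innovFactor n φ t) ∂specMeasure (densityOf φ) := by
    rw [L2.inner_def]
    refine integral_congr_ae ?_
    filter_upwards [hj.coeFn_toLp, hk.coeFn_toLp] with t h1 h2
    rw [h1, h2, RCLike.inner_apply]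
  have e2 : ∫ t, Complex.exp (Complex.I * k * t) * innovFactor n φ t *
        conj (Complex.exp (Complex.I * j * t) * innovFactor n φ t) * (densityOf φ t : ℂ) ∂circ =
      ∫ t, Complex.exp (Complex.I * (k - j : ℤ) * t) ∂circ := by
    refine integral_congr_ae ?_
    filter_upwards [ae_norm_innovFactor n φ] with t ht
    have h0 : ‖minusSeries φ t‖ ≠ 0 := norm_ne_zero_iff.2 (hφ.minusSeries_ne_zero t)
    have e1 : conj (Complex.exp (Complex.I * j * t)) = Complex.exp (-(Complex.I * j * t)) := by
      rw [← Complex.exp_conj]; simp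
    have e3 : Complex.exp (Complex.I * (k - j : ℤ) * t) =
        Complex.exp (Complex.I * k * t) * Complex.exp (-(Complex.I * j * t)) := by
      rw [← Complex.exp_add]; push_cast; ring_nf
    have e4 : innovFactor n φ t * conj (innovFactor n φ t) * (densityOf φ t : ℂ) = 1 := by
      rw [Complex.mul_conj, Complex.normSq_eq_norm_sq, ht, densityOf, ← Complex.ofReal_mul, inv_pow,
        inv_mul_cancel₀ (pow_ne_zero 2 h0), Complex.ofReal_one]
    rw [map_mul, e1, e3]
    linear_combination (Complex.exp (Complex.I * k * t) * Complex.exp (-(Complex.I * j * t))) * e4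
  rw [e, integral_specMeasure (isSpectralDensity_densityOf hφ.summable), e2, integral_exp_circ]
  have hpi : (Real.pi : ℂ) ≠ 0 := by exact_mod_cast Real.pi_ne_zero
  by_cases h : j = k
  · subst h
    simp only [sub_self, if_true]
    field_simp
  · rw [if_neg (sub_ne_zero.2 (Ne.symm h)), if_neg h, mul_zero]

/-- The past of all increments is the past of the innovations. -/
lemma closure_span_incrGen_eq {ν : Measure ℝ} [IsFiniteMeasure ν] (hν : ν ≪ circ) (n : ℕ)
    (hφ : IsCanonical φ) (t : ℤ) :
    (Submodule.span ℂ {x | ∃ (m : ℤ) (s : ℕ), m ≤ t ∧ 0 < s ∧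
      x = incrGen ν n (s, m)}).topologicalClosure = shiftSpace ν (innovFactor n φ) t := by
  obtain ⟨C, hC⟩ := exists_norm_innovFactor_le n hφ
  refine le_antisymm (Submodule.topologicalClosure_minimal _ (Submodule.span_le.2 ?_)
    (isClosed_shiftSpace _ _)) ?_
  · rintro x ⟨m, s, hm, -, rfl⟩
    -- The factor u_s is a power series in e^{-it} times the innovation factor, for every step s.
    have h := (lpMem_shift_wiener (aestronglyMeasurable_innovFactor n hφ) (hν.ae_le hC)
      ((((isWiener_geomPoly s).pow n).mul (isWiener_regFactor n)).mul (isWiener_tsum hφ.summable))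
      m).mono (shiftSpace_mono (innovFactor n φ) hm)
    simp_rw [← minusSeries_eq, ← incrFactor_eq_mul_innovFactor n s hφ] at h
    exact h.2
  -- Conversely, the innovation factor is a power series in e^{-it} times u_1, since `regFactor` and
  -- Φ are invertible.
  · refine shiftSpace_le (Submodule.isClosed_topologicalClosure _) fun k hk => ?_
    refine (lpMem_innovFactor hν n le_rfl hφ k).mono ?_
    refine Submodule.topologicalClosure_mono (Submodule.span_mono ?_)
    rw [shiftGen_incrFactor]
    rintro x ⟨j, hj, rfl⟩
    exact ⟨j, 1, hj.trans hk, one_pos, rfl⟩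

/-- The mean is the inner product with the constant 1, so vanishing mean passes to the closed span.
-/
lemma integral_eq_zero_of_mem_closure [IsProbabilityMeasure P] {s : Set (Lp ℂ 2 P)}
    (hs : ∀ x ∈ s, ∫ ω, x ω ∂P = 0) {y : Lp ℂ 2 P}
    (hy : y ∈ (Submodule.span ℂ s).topologicalClosure) : ∫ ω, y ω ∂P = 0 := by
  have key : ∀ x : Lp ℂ 2 P,
      inner ℂ (indicatorConstLp 2 MeasurableSet.univ (measure_ne_top P Set.univ) (1 : ℂ)) x =
        ∫ ω, x ω ∂P := fun x => by
    rw [L2.inner_indicatorConstLp_one, Measure.restrict_univ]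
  have hle : (Submodule.span ℂ s).topologicalClosure ≤ (Submodule.span ℂ
      {indicatorConstLp 2 MeasurableSet.univ (measure_ne_top P Set.univ) (1 : ℂ)})ᗮ := by
    refine Submodule.topologicalClosure_minimal _ (Submodule.span_le.2 fun x hx => ?_)
      (Submodule.isClosed_orthogonal _)
    rw [SetLike.mem_coe, Submodule.mem_orthogonal_singleton_iff_inner_right, key]
    exact hs x hx
  rw [← key]
  exact Submodule.mem_orthogonal_singleton_iff_inner_right.1 (hle hy)

/-- The innovations are the images of e^{imt} times `innovFactor` under the spectral isometry. The
identity u_μ = Φ_μ · `innovFactor` gives the coefficients W^μ φ. -/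
theorem hasMovingAverage_of_isCanonical [IsProbabilityMeasure P] {μ : ℕ} (hμ : 1 ≤ μ)
    (hφ : IsCanonical φ) (hξ : HasIncrementDensity n P ξ (densityOf φ)) :
    HasMovingAverage μ hξ (opW n μ φ) := by
  have hf := isSpectralDensity_densityOf hφ.summable
  have := isFiniteMeasure_specMeasure hf
  set ν := specMeasure (densityOf φ) with hν
  have hac : ν ≪ circ := specMeasure_ac _
  obtain ⟨T, hT, hTn⟩ := exists_spectral_map hf hξ
  have hW := summable_opW n hμ hφ.summable
  obtain ⟨C, hC⟩ := exists_norm_innovFactor_le n hφ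
  have hCν := hac.ae_le hC
  have hm := aestronglyMeasurable_innovFactor (ν := ν) n hφ
  set E : ℤ → Lp ℂ 2 ν := fun m => (memLp_shift hm hCν m).toLp with hE
  have hES : ∀ m, E m ∈ shiftSpace ν (incrFactor n μ) m := fun m =>
    (lpMem_innovFactor hac n hμ hφ m).2
  have hEM : ∀ m, E m ∈ incrGenSpace ν n := fun m => shiftSpace_le_incrGenSpace ν n μ m (hES m)
  have hgen : ∀ t, shiftGen ν (innovFactor n φ) t = {x | ∃ m : ℤ, m ≤ t ∧ x = E m} := by
    intro t
    ext x
    constructor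
    · rintro ⟨k, hk, h, rfl⟩
      exact ⟨k, hk, rfl⟩
    · rintro ⟨k, hk, rfl⟩
      exact ⟨k, hk, memLp_shift hm hCν k, rfl⟩
  refine ⟨?_, fun m => T (E m), ?_, fun m => ?_, fun t => ?_, fun m => ?_⟩
  · refine Summable.of_nonneg_of_le (fun _ => sq_nonneg _) (fun k => ?_)
      (hW.mul_left (∑' k, ‖opW n μ φ k‖))
    rw [sq]
    exact mul_le_mul_of_nonneg_right (hW.le_tsum k fun _ _ => norm_nonneg _) (norm_nonneg _)
  · rw [orthonormal_iff_ite]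
    intro j k
    rw [inner_map_of_norm_eq hTn (hEM j) (hEM k)]
    exact inner_innov n hφ _ _
  · have h1 : T (E m) ∈ (Submodule.span ℂ (T '' shiftGen ν (incrFactor n μ) m)).topologicalClosure := by
      rw [← map_topologicalClosure_span (isClosed_incrGenSpace ν n) hTn (shiftGen_subset ν n μ m)]
      exact ⟨_, hES m, rfl⟩
    refine integral_eq_zero_of_mem_closure ?_ h1
    rw [shiftGen_incrFactor]
    rintro _ ⟨_, ⟨k, -, rfl⟩, rfl⟩
    rw [hT, ← hξ.mean μ k]
    exact integral_congr_ae (hξ.memLp μ k).coeFn_toLp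
  · have h1 := congrArg (Submodule.map (T : Lp ℂ 2 ν →ₗ[ℂ] Lp ℂ 2 P))
      (closure_span_incrGen_eq hac n hφ t)
    rw [shiftSpace, hgen, map_topologicalClosure_span (isClosed_incrGenSpace ν n) hTn,
      map_topologicalClosure_span (isClosed_incrGenSpace ν n) hTn] at h1
    · have e1 : T '' {x | ∃ (m : ℤ) (s : ℕ), m ≤ t ∧ 0 < s ∧ x = incrGen ν n (s, m)} =
          {x | ∃ m s : ℤ, m ≤ t ∧ 0 < s ∧ x = incrLp hξ s m} := by
        ext x
        constructor
        · rintro ⟨_, ⟨m, s, hm, hs, rfl⟩, rfl⟩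
          exact ⟨m, s, hm, by exact_mod_cast hs, hT s m⟩
        · rintro ⟨m, s, hm, hs, rfl⟩
          lift s to ℕ using hs.le
          exact ⟨_, ⟨m, s, hm, by exact_mod_cast hs, rfl⟩, hT s m⟩
      have e2 : T '' {x | ∃ m : ℤ, m ≤ t ∧ x = E m} = {x | ∃ m : ℤ, m ≤ t ∧ x = T (E m)} := by
        ext x
        constructor
        · rintro ⟨_, ⟨m, hm, rfl⟩, rfl⟩
          exact ⟨m, hm, rfl⟩
        · rintro ⟨m, hm, rfl⟩
          exact ⟨_, ⟨m, hm, rfl⟩, rfl⟩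
      rw [e1, e2] at h1
      exact h1
    · rintro x ⟨m, -, rfl⟩
      exact hEM m
    · rintro x ⟨m, s, -, -, rfl⟩
      exact incrGen_mem ν n _
  · have h1 : HasSum (fun k : ℕ => opW n μ φ k • E (m - k)) (incrGen ν n (μ, m)) := by
      refine hasSum_toLp_shift hm hCν hW (fun k => m - k) (memLp_incr_shift n μ m)
        (Eventually.of_forall fun t => ?_)
      have h := (hasSum_minusSeries hW t).mul_right
        (Complex.exp (Complex.I * m * t) * innovFactor n φ t)
      have e : Complex.exp (Complex.I * m * t) * incrFactor n μ t = minusSeries (opW n μ φ) t *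
          (Complex.exp (Complex.I * m * t) * innovFactor n φ t) := by
        rw [minusSeries_opW n hμ hφ.summable, minusSeries_wCoeff n hμ,
          incrFactor_eq_mul_innovFactor n μ hφ]
        ring
      rw [e]
      refine Eq.mpr (congrArg (HasSum · _) (funext fun k => ?_)) h
      have e3 : Complex.exp (Complex.I * (m - k : ℤ) * t) =
          Complex.exp (Complex.I * m * t) * Complex.exp (-(Complex.I * k * t)) := by
        rw [← Complex.exp_add]; push_cast; ring_nf
      rw [e3]
      ring
    have h2 := h1.mapL T
    have e : ∀ k : ℕ, T (opW n μ φ k • E (m - k)) = opW n μ φ k • T (E (m - k)) := fun k =>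
      T.map_smul _ _
    simp_rw [e] at h2
    exact hT μ m ▸ h2

end Sequences

/-! ### Minimax solutions -/

section Solution

variable {n μ : ℕ} {a φ : ℕ → ℂ} {D : Set (ℝ → ℝ)} {v : ℝ → ℝ} {ε : ℝ}

lemma IsSaddle.givesMinimaxSolution (hμ : 1 ≤ μ) (hH : opDA n μ a = hankel (bCoeff n μ a))
    (hb : Summable fun k => ‖bCoeff n μ a k‖) (hD : ∀ f ∈ D, IsSpectralDensity f)
    (hs : IsSaddle n μ a D φ) : GivesMinimaxSolution.{u} n μ a D φ where
  leastFavorable := hs.leastFavorable hμ hH hb hD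
  leastFavorableForSequences := by
    intro Ω₀ _ P₀ _ ξ₀ h₀ f hf Ω _ P _ ξ h
    rw [sequenceError_eq hμ hb (hD f hf) h, sequenceError_eq hμ hb (hD _ hs.mem) h₀]
    exact (hs.leastFavorable hμ hH hb hD).2 f hf
  movingAverage := fun _ _ _ _ _ h => hasMovingAverage_of_isCanonical hμ hs.canonical h
  minimaxRobust := hs.isMinimaxRobust_iff hμ hH hb hD

lemma isSpectralDensity_of_mem_classD : ∀ f ∈ classD v ε, IsSpectralDensity f := fun _ hf => hf.1

/-- The maximum over S is attained at a saddle point, whose value φ shares. Leaving S general covers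
both functionals. -/
lemma givesMinimaxSolution_of_isGreatest (hμ : 1 ≤ μ) (hH : opDA n μ a = hankel (bCoeff n μ a))
    (hb : Summable fun k => ‖bCoeff n μ a k‖) (hv : IsSpectralDensity v) (hε : 0 ≤ ε)
    {S : Set (ℕ → ℂ)} (hS : S ⊆ maxSet n μ a v ε) (hφ : φ ∈ candidates v ε)
    (hle : ∀ᵐ t ∂circ, v t ≤ densityOf φ t)
    (hmax : IsGreatest (valuesOn n μ a S) (sqNorm (opDAW n μ a φ))) :
    GivesMinimaxSolution.{u} n μ a (classD v ε) φ := by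
  obtain ⟨ψ, hψ, hψe⟩ := hmax.1
  have hs := isSaddle_of_mem_maxSet hμ hH hb hv hε (hS hψ)
  exact (hs.of_le hμ hH hb isSpectralDensity_of_mem_classD hφ.1
    (densityOf_mem_classD hv hε hφ hle) hψe.le).givesMinimaxSolution hμ hH hb
    isSpectralDensity_of_mem_classD

/-- Any element of the left side serves as comparison: an extremal candidate does at least as well
as it, which forces the max form. -/
lemma mem_maxSet_inter_iff (hμ : 1 ≤ μ) (hH : opDA n μ a = hankel (bCoeff n μ a))
    (hb : Summable fun k => ‖bCoeff n μ a k‖) (hv : IsSpectralDensity v) (hε : 0 ≤ ε)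
    {K : Set (ℕ → ℂ)} {M : ℝ≥0∞} (hM : M ∈ valuesOn n μ a (maxSet n μ a v ε ∩ K)) :
    φ ∈ maxSet n μ a v ε ∩ K ↔
      φ ∈ candidates v ε ∧ SolvesExtremal n μ a (classD v ε) K φ := by
  constructor
  · rintro ⟨h, hK⟩
    exact ⟨h.1, (isSaddle_of_mem_maxSet hμ hH hb hv hε h).solvesExtremal hμ hH hb
      isSpectralDensity_of_mem_classD hK⟩
  · rintro ⟨hφ, hK, hφD, hmax⟩
    obtain ⟨ψ, ⟨hψ, hψK⟩, -⟩ := hM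
    have hψD := (isSaddle_of_mem_maxSet hμ hH hb hv hε hψ).mem
    exact ⟨mem_maxSet_of_le hμ hH hb hv hε hψ hφ hφD
      (hmax ψ hψK _ (isL2Series_minusSeries hψ.1.1.summable) hψD), hK⟩

end Solution

/-! ### Functionals of finitely many values -/

section Truncation

lemma truncCoeff_of_lt {N k : ℕ} (a : ℕ → ℂ) (h : N < k) : truncCoeff N a k = 0 :=
  if_neg h.not_ge

lemma summable_matD_mul_truncCoeff (n μ N : ℕ) (a : ℕ → ℂ) (k : ℕ) :
    Summable (fun m => matD n μ k m * truncCoeff N a m) (SummationFilter.conditional ℕ) := by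
  refine ⟨∑ m ∈ Finset.range (N + 1), matD n μ k m * truncCoeff N a m, ?_⟩
  rw [hasSum_conditional_iff]
  refine tendsto_const_nhds.congr' ?_
  filter_upwards [eventually_ge_atTop (N + 1)] with K hK
  refine Finset.sum_subset (Finset.range_subset_range.2 hK) fun m _ hm => ?_
  rw [Finset.mem_range, not_lt] at hm
  rw [truncCoeff_of_lt a hm, mul_zero]

/-- D^μ is upper triangular, so b_μ inherits the finite support and is summable. -/
lemma bCoeff_truncCoeff_of_lt {n μ N k : ℕ} (a : ℕ → ℂ) (h : N < k) :
    bCoeff n μ (truncCoeff N a) k = 0 := by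
  have e : ∀ m, matD n μ k m * truncCoeff N a m = 0 := fun m => by
    rw [matD]
    split_ifs with hkm
    · rw [truncCoeff_of_lt a (h.trans_le hkm), mul_zero]
    · rw [zero_mul]
  simp [bCoeff, e]

lemma summable_bCoeff_truncCoeff (n μ N : ℕ) (a : ℕ → ℂ) :
    Summable fun k => ‖bCoeff n μ (truncCoeff N a) k‖ :=
  summable_of_ne_finset_zero (s := Finset.range (N + 1)) fun k hk => by
    rw [Finset.mem_range, not_lt] at hk
    rw [bCoeff_truncCoeff_of_lt a hk, norm_zero]

end Truncation

theorem theorem8p1 (n μ : ℕ) (hn : 1 ≤ n) (hμ : 1 ≤ μ)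
    (v : ℝ → ℝ) (hv : IsSpectralDensity v) (hvb : ∃ C : ℝ, ∀ᵐ t ∂circ, v t ≤ C)
    (ε : ℝ) (hε : 0 ≤ ε) :
    -- the functional `Aξ`
    (∀ a : ℕ → ℂ,
      (∀ k, Summable (fun m => matD n μ k m * a m) (SummationFilter.conditional ℕ)) →
      (Summable fun k => ‖bCoeff n μ a k‖) →
      (Summable fun k : ℕ => ((k : ℝ) + 1) * ‖bCoeff n μ a k‖ ^ 2) →
      (∀ φ ∈ eigenSet n μ a v ε,
        IsGreatest (valuesOn n μ a (eigenSet n μ a v ε)) (sqNorm (opDAW n μ a φ)) →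
        IsGreatest (valuesOn n μ a (maxSet n μ a v ε)) (sqNorm (opDAW n μ a φ)) →
        GivesMinimaxSolution.{u} n μ a (classD v ε) φ) ∧
      (∀ M : ℝ≥0∞, IsGreatest (valuesOn n μ a (maxSet n μ a v ε)) M →
        (∀ x ∈ valuesOn n μ a (eigenSet n μ a v ε), x < M) →
        (∀ φ ∈ maxSet n μ a v ε, GivesMinimaxSolution.{u} n μ a (classD v ε) φ) ∧
        (∀ φ, φ ∈ maxSet n μ a v ε ↔
          φ ∈ candidates v ε ∧ SolvesExtremal n μ a (classD v ε) Set.univ φ))) ∧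
    -- the functional `A_N ξ`
    (∀ (a : ℕ → ℂ) (N : ℕ),
      (∀ φ ∈ eigenSetN n μ N a v ε,
        IsGreatest (valuesOn n μ (truncCoeff N a) (eigenSetN n μ N a v ε))
          (sqNorm (opDAW n μ (truncCoeff N a) φ)) →
        IsGreatest (valuesOn n μ (truncCoeff N a)
          (maxSet n μ (truncCoeff N a) v ε ∩ seqUpTo N))
          (sqNorm (opDAW n μ (truncCoeff N a) φ)) →
        GivesMinimaxSolution.{u} n μ (truncCoeff N a) (classD v ε) φ) ∧
      (∀ M : ℝ≥0∞,
        IsGreatest (valuesOn n μ (truncCoeff N a)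
          (maxSet n μ (truncCoeff N a) v ε ∩ seqUpTo N)) M →
        (∀ x ∈ valuesOn n μ (truncCoeff N a) (eigenSetN n μ N a v ε), x < M) →
        (∀ φ ∈ maxSet n μ (truncCoeff N a) v ε ∩ seqUpTo N,
          GivesMinimaxSolution.{u} n μ (truncCoeff N a) (classD v ε) φ) ∧
        (∀ φ, φ ∈ maxSet n μ (truncCoeff N a) v ε ∩ seqUpTo N ↔
          φ ∈ candidates v ε ∧
            SolvesExtremal n μ (truncCoeff N a) (classD v ε) (seqUpTo N) φ))) := by
  refine ⟨fun a ha hb _ => ?_, fun a N => ?_⟩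
  · have hH : opDA n μ a = hankel (bCoeff n μ a) := funext (opDA_eq_hankel ha)
    refine ⟨fun φ hφ _ hmax => ?_, fun M hM _ => ⟨fun φ hφ => ?_, fun φ => ?_⟩⟩
    · exact givesMinimaxSolution_of_isGreatest hμ hH hb hv hε subset_rfl hφ.1 hφ.2.1 hmax
    · exact (isSaddle_of_mem_maxSet hμ hH hb hv hε hφ).givesMinimaxSolution hμ hH hb
        isSpectralDensity_of_mem_classD
    -- Without a restriction on the order the admissible set of sequences is everything.
    · rw [← mem_maxSet_inter_iff hμ hH hb hv hε (by rw [Set.inter_univ]; exact hM.1),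
        Set.inter_univ]
  · have hH : opDA n μ (truncCoeff N a) = hankel (bCoeff n μ (truncCoeff N a)) :=
      funext (opDA_eq_hankel (summable_matD_mul_truncCoeff n μ N a))
    have hb := summable_bCoeff_truncCoeff n μ N a
    refine ⟨fun φ hφ _ hmax => ?_, fun M hM _ => ⟨fun φ hφ => ?_, fun φ => ?_⟩⟩
    · exact givesMinimaxSolution_of_isGreatest hμ hH hb hv hε Set.inter_subset_left hφ.1 hφ.2.2.1
        hmax
    · exact (isSaddle_of_mem_maxSet hμ hH hb hv hε hφ.1).givesMinimaxSolution hμ hH hb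
        isSpectralDensity_of_mem_classD
    · exact mem_maxSet_inter_iff hμ hH hb hv hε hM.1
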